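/- Theorem. A graph is called $(P_3+K_1)$-free if it does not contain, as an induced subgraph, the disjoint union of a path on three vertices and a single vertex. A minimum modulator to a $(P_3+K_1)$-free graph in a graph $G$ is a set $M\subseteq V(G)$ of minimum size such that $G-M$ is $(P_3+K_1)$-free. There is a polynomial-time algorithm that, given any finite simple graph $G$ (and no further information), computes a proper colouring of $G$ that uses, for every minimum modulator $M$ to a $(P_3+K_1)$-free graph in $G$, at most $\chi(G-M)+|M|$ colours, where $\chi$ denotes the chromatic number. Here an algorithm is a program of a random access machine that has the elementary operations of addition, subtraction, indirect reading and writing of memory, and tests for zero; it receives the number $n$ of vertices and the adjacency matrix of $G$ as its input and halts after at most $p(n)$ steps, for a fixed polynomial $p$. -/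

import Mathlib

/-! ## Random access machines with a step count -/

namespace Ram

/-- The memory of a random access machine: registers and arrays of natural numbers. A program
mentions only finitely many registers and arrays, but an array has unboundedly many cells, which
are addressed by the contents of registers. -/
structure State where
  reg : ℕ → ℕ
  arr : ℕ → ℕ → ℕ

/-- The state `s` with `v` written to register `x`. -/
def State.setReg (s : State) (x v : ℕ) : State :=
  { s with reg := Function.update s.reg x v }

/-- The state `s` with `v` written to cell `i` of array `a`. -/
def State.setArr (s : State) (a i v : ℕ) : State :=
  { s with arr := Function.update s.arr a (Function.update (s.arr a) i v) }

/-- Programs of a random access machine whose only arithmetic operations are addition and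
subtraction (so that unit cost is a realistic measure of time). -/
inductive Program : Type
  /-- `x := c` -/
  | const (x c : ℕ)
  /-- `x := y + z` -/
  | add (x y z : ℕ)
  /-- `x := y - z`, truncated at zero -/
  | sub (x y z : ℕ)
  /-- `x := a[i]`, where the index is the content of register `i` -/
  | load (x a i : ℕ)
  /-- `a[i] := x`, where the index is the content of register `i` -/
  | store (a i x : ℕ)
  /-- first `P`, then `Q` -/
  | seq (P Q : Program)
  /-- `P` if register `x` is nonzero, otherwise `Q` -/
  | ite (x : ℕ) (P Q : Program)
  /-- repeat `P` as long as register `x` is nonzero -/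
  | loop (x : ℕ) (P : Program)

/-- `Exec P s t s'`: started in state `s`, the program `P` halts after exactly `t` steps, in
state `s'`. Every instruction and every test of a register counts as one step. -/
inductive Exec : Program → State → ℕ → State → Prop
  | const (x c : ℕ) (s : State) : Exec (.const x c) s 1 (s.setReg x c)
  | add (x y z : ℕ) (s : State) : Exec (.add x y z) s 1 (s.setReg x (s.reg y + s.reg z))
  | sub (x y z : ℕ) (s : State) : Exec (.sub x y z) s 1 (s.setReg x (s.reg y - s.reg z))
  | load (x a i : ℕ) (s : State) : Exec (.load x a i) s 1 (s.setReg x (s.arr a (s.reg i)))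
  | store (a i x : ℕ) (s : State) : Exec (.store a i x) s 1 (s.setArr a (s.reg i) (s.reg x))
  | seq {P Q : Program} {s s₁ s₂ : State} {t₁ t₂ : ℕ} (hP : Exec P s t₁ s₁)
      (hQ : Exec Q s₁ t₂ s₂) : Exec (.seq P Q) s (t₁ + t₂) s₂
  | ite_true {x : ℕ} {P Q : Program} {s s₁ : State} {t : ℕ} (hx : s.reg x ≠ 0)
      (hP : Exec P s t s₁) : Exec (.ite x P Q) s (t + 1) s₁
  | ite_false {x : ℕ} {P Q : Program} {s s₁ : State} {t : ℕ} (hx : s.reg x = 0)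
      (hQ : Exec Q s t s₁) : Exec (.ite x P Q) s (t + 1) s₁
  | loop_done {x : ℕ} {P : Program} {s : State} (hx : s.reg x = 0) : Exec (.loop x P) s 1 s
  | loop_step {x : ℕ} {P : Program} {s s₁ s₂ : State} {t₁ t₂ : ℕ} (hx : s.reg x ≠ 0)
      (hP : Exec P s t₁ s₁) (hL : Exec (.loop x P) s₁ t₂ s₂) :
      Exec (.loop x P) s (t₁ + t₂ + 1) s₂

/-- The machine is deterministic: the running time and the final state are determined by the
program and the initial state. -/
theorem Exec.deterministic {P : Program} {s s₁ s₂ : State} {t₁ t₂ : ℕ} (h₁ : Exec P s t₁ s₁)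
    (h₂ : Exec P s t₂ s₂) : t₁ = t₂ ∧ s₁ = s₂ := by
  induction h₁ generalizing t₂ s₂ with
  | const | add | sub | load | store => cases h₂; exact ⟨rfl, rfl⟩
  | seq _ _ ihP ihQ =>
    cases h₂ with
    | seq hP hQ =>
      obtain ⟨rfl, rfl⟩ := ihP hP
      obtain ⟨rfl, rfl⟩ := ihQ hQ
      exact ⟨rfl, rfl⟩
  | ite_true hx _ ih =>
    cases h₂ with
    | ite_true _ h => obtain ⟨rfl, rfl⟩ := ih h; exact ⟨rfl, rfl⟩
    | ite_false h _ => exact absurd h hx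
  | ite_false hx _ ih =>
    cases h₂ with
    | ite_true h _ => exact absurd hx h
    | ite_false _ h => obtain ⟨rfl, rfl⟩ := ih h; exact ⟨rfl, rfl⟩
  | loop_done hx =>
    cases h₂ with
    | loop_done _ => exact ⟨rfl, rfl⟩
    | loop_step h _ _ => exact absurd hx h
  | loop_step hx _ _ ihP ihL =>
    cases h₂ with
    | loop_done h => exact absurd h hx
    | loop_step _ hP hL =>
      obtain ⟨rfl, rfl⟩ := ihP hP
      obtain ⟨rfl, rfl⟩ := ihL hL
      exact ⟨rfl, rfl⟩

open Classical in
/-- The initial state on input `G`: register `0` holds the number `n` of vertices, array `0` holds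
the adjacency matrix of `G` row by row, and everything else is `0`. -/
noncomputable def graphInput {n : ℕ} (G : SimpleGraph (Fin n)) : State where
  reg x := if x = 0 then n else 0
  arr a k := if a = 0 ∧ ∃ u v : Fin n, k = u * n + v ∧ G.Adj u v then 1 else 0

/-- The colour that is assigned to the vertex `v` in a final state: the content of cell `v` of
array `1`. -/
def State.colour {n : ℕ} (s : State) (v : Fin n) : ℕ := s.arr 1 v

end Ram

/-! ## Modulators and `(P₃ + K₁)`-free graphs -/

open SimpleGraph in
/-- `G` does not contain the disjoint union of a path on three vertices and a single vertex as an
induced subgraph. -/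
def P3K1Free {V : Type} (G : SimpleGraph V) : Prop :=
  ¬ (pathGraph 3 ⊕g completeGraph (Fin 1)).IsIndContained G

/-- `M` is a modulator to the graph class `C` in `G`: the graph `G - M` belongs to `C`. -/
def IsModulator (C : ∀ ⦃V : Type⦄, SimpleGraph V → Prop) {V : Type} (G : SimpleGraph V)
    (M : Finset V) : Prop :=
  C (G.induce (M : Set V)ᶜ)

/-- `M` is a modulator to the graph class `C` in `G` of minimum size. -/
def IsMinimumModulator (C : ∀ ⦃V : Type⦄, SimpleGraph V → Prop) {V : Type} (G : SimpleGraph V)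
    (M : Finset V) : Prop :=
  IsModulator C G M ∧ ∀ M' : Finset V, IsModulator C G M' → M.card ≤ M'.card

/-! The colouring is built in two phases, neither of which sees a modulator. As long as the
uncoloured set `U` contains three independent vertices, the greedy phase extends them to a maximal
independent subset of `U` and makes it a colour class. When no independent triple is left, colour
classes in `U` have at most two vertices, so an optimal colouring of the rest is a maximum matching
of the complement of `G[U]`.

The bound is an invariant over all `M` and `k` such that `G - M` is (P₃ + K₁)-free and
`k`-colourable: after `r` classes, `U \ M` is `l`-colourable for some `l` with `r + l + |M ∩ U| ≤ k
+ |M|` (`IsGreedy.bound`). A class that meets `M` is paid for by the drop of `|M ∩ U|`. A class that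
avoids `M` is a maximal independent subset of `U \ M` with at least three vertices, and by
`ColorableOn.diff` its removal saves a colour. The reason is that a vertex outside such a set `S`
has one neighbour in `S` or is adjacent to all of `S`; hence the colour of a fixed `a ∈ S` can be
eliminated outside `S` by giving each of its vertices the colour of the only neighbour in `S`. In
the end, `l` classes on `U \ M` and singletons on `M ∩ U` form a matching of the complement, and a
maximum matching is at least as good (`IsGreedy.card_image_le`).

The maximum matching comes from a form of Edmonds' blossom algorithm that never traces paths. For
every outer vertex `x` the alternating forest stores a whole matching `N x` of the current size that
misses `x`. An edge between two blossoms yields a larger blossom or a larger matching, and every new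
matching is a `mix` of two stored ones. When no edge can be used, the odd blossoms and the inner
vertices certify maximality, as in the Tutte–Berge formula (`IsForest.le_ncard_missed`).

For the running time, the algorithm is written in a language with first-order formulas on ternary
relations, choice of a vertex that satisfies a formula, and loops of `n` rounds. Formulas are
decided by exhaustive search, so every such program compiles to a polynomial-time machine
(`exists_program`). Choice is nondeterministic in the semantics: correctness is shown for all runs,
and the machine carries out one of them. -/

/-! ## Total correctness of programs with a time bound -/

namespace Ram

/-- Started in `s`, the program `P` halts after at most `T` steps in a state that satisfies `Q`. -/
def Runs (P : Program) (s : State) (T : ℕ) (Q : State → Prop) : Prop :=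
  ∃ t s', Exec P s t s' ∧ t ≤ T ∧ Q s'

@[simp] theorem State.setReg_arr (s : State) (x v : ℕ) : (s.setReg x v).arr = s.arr := rfl

@[simp] theorem State.setReg_reg (s : State) (x v : ℕ) :
    (s.setReg x v).reg = Function.update s.reg x v := rfl

@[simp] theorem State.setArr_reg (s : State) (a i v : ℕ) : (s.setArr a i v).reg = s.reg := rfl

@[simp] theorem State.setArr_arr (s : State) (a i v : ℕ) :
    (s.setArr a i v).arr = Function.update s.arr a (Function.update (s.arr a) i v) := rfl

theorem Runs.mono {P : Program} {s : State} {T T' : ℕ} {Q Q' : State → Prop}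
    (h : Runs P s T Q) (hT : T ≤ T') (hQ : ∀ s', Q s' → Q' s') : Runs P s T' Q' := by
  obtain ⟨t, s', h1, h2, h3⟩ := h
  exact ⟨t, s', h1, h2.trans hT, hQ _ h3⟩

theorem Runs.const {x c : ℕ} {s : State} {Q : State → Prop} (h : Q (s.setReg x c)) :
    Runs (.const x c) s 1 Q := ⟨_, _, .const _ _ _, le_rfl, h⟩

theorem Runs.add {x y z : ℕ} {s : State} {Q : State → Prop}
    (h : Q (s.setReg x (s.reg y + s.reg z))) : Runs (.add x y z) s 1 Q :=
  ⟨_, _, .add _ _ _ _, le_rfl, h⟩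

theorem Runs.sub {x y z : ℕ} {s : State} {Q : State → Prop}
    (h : Q (s.setReg x (s.reg y - s.reg z))) : Runs (.sub x y z) s 1 Q :=
  ⟨_, _, .sub _ _ _ _, le_rfl, h⟩

theorem Runs.load {x a i : ℕ} {s : State} {Q : State → Prop}
    (h : Q (s.setReg x (s.arr a (s.reg i)))) : Runs (.load x a i) s 1 Q :=
  ⟨_, _, .load _ _ _ _, le_rfl, h⟩

theorem Runs.store {x a i : ℕ} {s : State} {Q : State → Prop}
    (h : Q (s.setArr a (s.reg i) (s.reg x))) : Runs (.store a i x) s 1 Q :=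
  ⟨_, _, .store _ _ _ _, le_rfl, h⟩

theorem Runs.seq {P P' : Program} {s : State} {T T' : ℕ} {Q : State → Prop}
    (h : Runs P s T fun s₁ => Runs P' s₁ T' Q) : Runs (.seq P P') s (T + T') Q := by
  obtain ⟨t, s₁, h1, h2, t', s₂, h3, h4, h5⟩ := h
  exact ⟨_, _, .seq h1 h3, by omega, h5⟩

theorem Runs.ite {x : ℕ} {P P' : Program} {s : State} {T : ℕ} {Q : State → Prop}
    (h1 : s.reg x ≠ 0 → Runs P s T Q) (h2 : s.reg x = 0 → Runs P' s T Q) :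
    Runs (.ite x P P') s (T + 1) Q := by
  by_cases hx : s.reg x = 0
  · obtain ⟨t, s', h3, h4, h5⟩ := h2 hx
    exact ⟨_, _, .ite_false hx h3, by omega, h5⟩
  · obtain ⟨t, s', h3, h4, h5⟩ := h1 hx
    exact ⟨_, _, .ite_true hx h3, by omega, h5⟩

/-- `x := y`, by way of the volatile register `1` -/
def Program.move (x y : ℕ) : Program := .seq (.const 1 0) (.add x y 1)

theorem Runs.move {x y : ℕ} {s : State} {Q : State → Prop} (hy : y ≠ 1)
    (h : Q ((s.setReg 1 0).setReg x (s.reg y))) : Runs (.move x y) s 2 Q := by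
  refine Runs.seq (Runs.const (Runs.add ?_))
  simpa [Function.update_of_ne hy] using h

/-- Run `body` with register `c` counting down from `n - 1` to `0`, where `n` is the content of
register `0`; register `1` is volatile. -/
def Program.forN (c : ℕ) (body : Program) : Program :=
  .seq (.move c 0) (.loop c (.seq (.const 1 1) (.seq (.sub c c 1) body)))

/-- The invariant is indexed by the counter and therefore descends from `J n` to `J 0`. Between
rounds the loop itself writes to register `1` and to the counter, which `hstab` allows for. The
three extra steps per round are the test and the two instructions of the decrement. -/
theorem Runs.forN {c : ℕ} {body : Program} {n T : ℕ} {s : State} (hc1 : c ≠ 1)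
    (J : ℕ → State → Prop) (h0 : s.reg 0 = n) (hJ : J n s)
    (hstab : ∀ i s v w, J i s → J i ((s.setReg 1 v).setReg c w))
    (hbody : ∀ i < n, ∀ s, J (i + 1) s → s.reg c = i →
      Runs body s T fun s' => J i s' ∧ s'.reg c = i) :
    Runs (.forN c body) s (n * (T + 3) + 3) fun s' => J 0 s' ∧ s'.reg c = 0 := by
  have key : ∀ m ≤ n, ∀ s, J m s → s.reg c = m →
      Runs (.loop c (.seq (.const 1 1) (.seq (.sub c c 1) body))) s (m * (T + 3) + 1)
        fun s' => J 0 s' ∧ s'.reg c = 0 := by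
    intro m
    induction m with
    | zero =>
      intro _ s hs hsc
      exact ⟨_, _, .loop_done hsc, by omega, hs, hsc⟩
    | succ m ih =>
      intro hm s hs hsc
      have hb := hbody m (by omega) ((s.setReg 1 1).setReg c m) (hstab _ _ _ _ hs) (by simp)
      have hstep : Runs (.seq (.const 1 1) (.seq (.sub c c 1) body)) s (1 + (1 + T))
          fun s' => J m s' ∧ s'.reg c = m := by
        refine Runs.seq (Runs.const (Runs.seq (Runs.sub ?_)))
        simpa [Function.update_of_ne hc1, hsc] using hb
      obtain ⟨t, s₁, e1, l1, j1, k1⟩ := hstep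
      obtain ⟨t', s₂, e2, l2, j2⟩ := ih (by omega) s₁ j1 k1
      refine ⟨_, _, .loop_step (by omega) e1 e2, ?_, j2⟩
      rw [Nat.add_mul]; omega
  refine (Runs.seq (T := 2) (T' := n * (T + 3) + 1) (Runs.move (by omega) ?_)).mono (by omega)
    (fun _ h => h)
  refine key n le_rfl _ ?_ (by simp [h0])
  exact hstab _ _ _ _ hJ

/-- `d := x * n + y`, with the counter `c` -/
def Program.index (d c x y : ℕ) : Program := .seq (.move d y) (.forN c (.add d d x))

theorem Runs.index {d c x y n : ℕ} {s : State} (h0 : s.reg 0 = n) (hd : d ≠ 0)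
    (hc1 : c ≠ 1) (hd1 : d ≠ 1) (hdc : d ≠ c) (hx1 : x ≠ 1) (hxc : x ≠ c) (hxd : x ≠ d)
    (hy1 : y ≠ 1) :
    Runs (.index d c x y) s (n * 4 + 5) fun s' => s'.arr = s.arr ∧
      (∀ r, r ≠ d → r ≠ c → r ≠ 1 → s'.reg r = s.reg r) ∧
      s'.reg d = s.reg x * n + s.reg y := by
  have main := Runs.forN (body := .add d d x) (T := 1) (n := n)
    (s := (s.setReg 1 0).setReg d (s.reg y)) hc1
    (fun i s' => i ≤ n ∧ s'.arr = s.arr ∧ (∀ r, r ≠ d → r ≠ c → r ≠ 1 → s'.reg r = s.reg r) ∧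
      s'.reg d + i * s.reg x = s.reg x * n + s.reg y)
    (by simp [Function.update_of_ne hd.symm, h0])
    (by
      refine ⟨le_rfl, rfl, ?_, ?_⟩
      · intro r h1 h2 h3
        simp [h1, h3]
      · simp; ring)
    (by
      rintro i s' v w ⟨h1, h2, h3, h4⟩
      refine ⟨h1, h2, ?_, ?_⟩
      · intro r k1 k2 k3
        simpa [k2, k3] using h3 r k1 k2 k3
      · simpa [hdc, hd1] using h4)
    (by
      rintro i hi s' ⟨h1, h2, h3, h4⟩ h5
      refine Runs.add ⟨⟨by omega, h2, ?_, ?_⟩, ?_⟩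
      · intro r k1 k2 k3
        simpa [k1] using h3 r k1 k2 k3
      · simp only [State.setReg_reg, Function.update_self]
        rw [h3 x hxd hxc hx1, ← h4]; ring
      · simpa [hdc.symm] using h5)
  refine (Runs.seq (T := 2) (Runs.move hy1 main)).mono (by omega) ?_
  rintro s' ⟨⟨-, h2, h3, h4⟩, -⟩
  exact ⟨h2, h3, by simpa using h4⟩

/-- `d := (x * n + y) * n + z`, with the counter `c` and the auxiliary register `e` -/
def Program.index₃ (d e c x y z : ℕ) : Program := .seq (.index e c x y) (.index d c e z)

theorem Runs.index₃ {d e c x y z n : ℕ} {s : State} (h0 : s.reg 0 = n) (hc : c ≠ 0) (hd : d ≠ 0)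
    (he : e ≠ 0) (hc1 : c ≠ 1) (hd1 : d ≠ 1) (he1 : e ≠ 1) (hdc : d ≠ c) (hec : e ≠ c)
    (hed : e ≠ d) (hx1 : x ≠ 1) (hxc : x ≠ c) (hxe : x ≠ e) (hy1 : y ≠ 1)
    (hz1 : z ≠ 1) (hzc : z ≠ c) (hze : z ≠ e) :
    Runs (.index₃ d e c x y z) s (n * 8 + 10) fun s' => s'.arr = s.arr ∧
      (∀ r, r ≠ d → r ≠ e → r ≠ c → r ≠ 1 → s'.reg r = s.reg r) ∧
      s'.reg d = (s.reg x * n + s.reg y) * n + s.reg z := by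
  refine (Runs.seq (T := n * 4 + 5) (T' := n * 4 + 5)
    ((Runs.index h0 he hc1 he1 hec hx1 hxc hxe hy1).mono le_rfl ?_)).mono
    (by omega) (fun _ h => h)
  rintro s₁ ⟨a1, a2, a3⟩
  refine (Runs.index (n := n) ((a2 0 he.symm hc.symm (by omega)).trans h0) hd hc1 hd1 hdc he1
    hec hed hz1).mono le_rfl ?_
  rintro s₂ ⟨b1, b2, b3⟩
  refine ⟨b1.trans a1, ?_, ?_⟩
  · intro r r1 r2 r3 r4
    rw [b2 r r1 r3 r4, a2 r r2 r3 r4]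
  · rw [b3, a3, a2 z hze hzc hz1]

end Ram

/-! ## A language of programs on ternary relations -/

namespace RelProg

open Ram Function

/-- The memory of a program on relations: variables and ternary relations on `Fin n`. -/
structure Store (n : ℕ) where
  env : ℕ → Fin n
  rel : ℕ → Fin n → Fin n → Fin n → Prop

/-- The store `h` with `a` assigned to the variable `x`. -/
def Store.setVar {n : ℕ} (h : Store n) (x : ℕ) (a : Fin n) : Store n :=
  { h with env := update h.env x a }

/-- First-order formulas on a graph with ternary relations -/
inductive Fml : Type
  | adj (x y : ℕ)
  | eq (x y : ℕ)
  | rel (a x y z : ℕ)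
  | neg (φ : Fml)
  | and (φ ψ : Fml)
  | ex (x : ℕ) (φ : Fml)

/-- Truth of a formula -/
def Fml.Holds {n : ℕ} (G : SimpleGraph (Fin n)) : Fml → Store n → Prop
  | adj x y, h => G.Adj (h.env x) (h.env y)
  | eq x y, h => h.env x = h.env y
  | rel a x y z, h => h.rel a (h.env x) (h.env y) (h.env z)
  | neg φ, h => ¬ φ.Holds G h
  | and φ ψ, h => φ.Holds G h ∧ ψ.Holds G h
  | ex x φ, h => ∃ a, φ.Holds G (h.setVar x a)

/-- Nondeterministic programs on relations -/
inductive Stmt : Type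
  | skip
  /-- replace relation `a` by the relation that `φ` defines in the variables `0`, `1`, `2` -/
  | assign (a : ℕ) (φ : Fml)
  /-- choose a value of `x` that satisfies `φ` and run `P`, or run `Q` if there is none -/
  | pick (x : ℕ) (φ : Fml) (P Q : Stmt)
  | seq (P Q : Stmt)
  /-- run `P` as many times as there are vertices -/
  | iter (P : Stmt)

/-- `P.Exec G h h'`: a run of `P` that starts with `h` can end with `h'`. -/
def Stmt.Exec {n : ℕ} (G : SimpleGraph (Fin n)) : Stmt → Store n → Store n → Prop
  | skip, h, h' => h' = h
  | assign a φ, h, h' =>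
    h'.rel = update h.rel a
      (fun p q r => φ.Holds G (((h.setVar 0 p).setVar 1 q).setVar 2 r)) ∧
    ∀ x, 3 ≤ x → h'.env x = h.env x
  | pick x φ P Q, h, h' =>
    (∃ a, φ.Holds G (h.setVar x a) ∧ P.Exec G (h.setVar x a) h') ∨
    ((∀ a, ¬ φ.Holds G (h.setVar x a)) ∧ Q.Exec G h h')
  | seq P Q, h, h' => ∃ h₁, P.Exec G h h₁ ∧ Q.Exec G h₁ h'
  | iter P, h, h' => ∃ f : ℕ → Store n, f 0 = h ∧ f n = h' ∧ ∀ i < n, P.Exec G (f i) (f (i + 1))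

/-! ### Representation of a store by a machine state -/

/-- Register `2 * x + 2` holds variable `x`, array `a + 2` holds relation `a`. -/
structure Rep {n : ℕ} (G : SimpleGraph (Fin n)) (h : Store n) (s : State) : Prop where
  size : s.reg 0 = n
  env : ∀ x, s.reg (2 * x + 2) = h.env x
  graph : ∀ u v : Fin n, s.arr 0 (u * n + v) ≠ 0 ↔ G.Adj u v
  rel : ∀ (a : ℕ) (u v w : Fin n), s.arr (a + 2) ((u * n + v) * n + w) ≠ 0 ↔ h.rel a u v w

/-- The registers that a program with `K` auxiliary registers must not change -/
def Keep (K : ℕ) (s s' : State) : Prop :=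
  ∀ r, r % 2 = 0 ∨ 2 * K + 3 ≤ r → s'.reg r = s.reg r

theorem Keep.mono {K L : ℕ} {s s' : State} (h : Keep K s s') (hKL : K ≤ L) : Keep L s s' :=
  fun r hr => h r (by omega)

theorem Keep.trans {K : ℕ} {s s' s'' : State} (h : Keep K s s') (h' : Keep K s' s'') :
    Keep K s s'' := fun r hr => (h' r hr).trans (h r hr)

theorem Rep.of_keep {n K : ℕ} {G : SimpleGraph (Fin n)} {h : Store n} {s s' : State}
    (hs : Rep G h s) (harr : s'.arr = s.arr) (hk : Keep K s s') : Rep G h s' where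
  size := (hk 0 (by omega)).trans hs.size
  env x := (hk _ (by omega)).trans (hs.env x)
  graph := by rw [harr]; exact hs.graph
  rel := by rw [harr]; exact hs.rel

theorem Rep.setVar {n : ℕ} {G : SimpleGraph (Fin n)} {h : Store n} {s s' : State}
    (hs : Rep G h s) {x : ℕ} {a : Fin n} (harr : s'.arr = s.arr)
    (hk : ∀ r, r % 2 = 0 → r ≠ 2 * x + 2 → s'.reg r = s.reg r) (hx : s'.reg (2 * x + 2) = a) :
    Rep G (h.setVar x a) s' where
  size := (hk 0 (by omega) (by omega)).trans hs.size
  env y := by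
    by_cases hy : y = x
    · subst hy; simpa [Store.setVar] using hx
    · simpa [Store.setVar, hy] using (hk _ (by omega) (by omega)).trans (hs.env y)
  graph := by rw [harr]; exact hs.graph
  rel := by rw [harr]; exact hs.rel

/-! ### Deciding first-order formulas in polynomial time -/

/-- The program `P` decides the formula `φ`, with the answer in register `1`. -/
def Decides (P : Program) (K : ℕ) (p : Polynomial ℕ) (φ : Fml) : Prop :=
  ∀ (n : ℕ) (G : SimpleGraph (Fin n)) (h : Store n) (s : State), Rep G h s →
    Runs P s (p.eval n) fun s' => s'.arr = s.arr ∧ Keep K s s' ∧ (s'.reg 1 ≠ 0 ↔ φ.Holds G h)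

theorem decides_adj (x y : ℕ) : ∃ P K p, Decides P K p (.adj x y) := by
  refine ⟨.seq (.index 3 5 (2 * x + 2) (2 * y + 2)) (.load 1 0 3), 2,
    .X * 4 + 6, ?_⟩
  intro n G h s hs
  refine (Runs.seq ((Runs.index (n := n) hs.size (by omega) (by omega) (by omega)
    (by omega) (by omega) (by omega) (by omega) (by omega)).mono le_rfl
      (fun s₁ h₁ => Runs.load ?_))).mono (T := n * 4 + 5 + 1) (by simp) (fun _ h => h)
  obtain ⟨h1, h2, h3⟩ := h₁
  refine ⟨h1, ?_, ?_⟩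
  · intro r hr
    simpa [show r ≠ 1 by omega] using h2 r (by omega) (by omega) (by omega)
  · simp only [State.setReg_reg, update_self, h1, h3, hs.env]
    exact hs.graph _ _

theorem decides_rel (a x y z : ℕ) : ∃ P K p, Decides P K p (.rel a x y z) := by
  refine ⟨.seq (.index₃ 3 7 5 (2 * x + 2) (2 * y + 2) (2 * z + 2)) (.load 1 (a + 2) 3), 3,
    .X * 8 + 11, ?_⟩
  intro n G h s hs
  refine (Runs.seq ((Runs.index₃ (n := n) hs.size (by omega) (by omega) (by omega) (by omega)
    (by omega) (by omega) (by omega) (by omega) (by omega) (by omega) (by omega) (by omega)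
    (by omega) (by omega) (by omega) (by omega)).mono le_rfl
      (fun s₁ h₁ => Runs.load ?_))).mono (T := n * 8 + 10 + 1) (by simp) (fun _ h => h)
  obtain ⟨h1, h2, h3⟩ := h₁
  refine ⟨h1, ?_, ?_⟩
  · intro r hr
    simpa [show r ≠ 1 by omega] using h2 r (by omega) (by omega) (by omega) (by omega)
  · simp only [State.setReg_reg, update_self, h1, h3, hs.env]
    exact hs.rel _ _ _ _

/-- Subtraction is truncated, so the two differences are both zero exactly for equal values. -/
theorem decides_eq (x y : ℕ) : ∃ P K p, Decides P K p (.eq x y) := by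
  refine ⟨.seq (.sub 1 (2 * x + 2) (2 * y + 2)) (.seq (.sub 3 (2 * y + 2) (2 * x + 2))
    (.seq (.add 1 1 3) (.ite 1 (.const 1 0) (.const 1 1)))), 1, 5, ?_⟩
  intro n G h s hs
  refine (Runs.seq (Runs.sub (Runs.seq (Runs.sub (Runs.seq (Runs.add (Runs.ite (T := 1)
    (fun hr => Runs.const ?_) (fun hr => Runs.const ?_)))))))).mono (T := 1 + (1 + (1 + 2)))
    (by simp) (fun _ h => h)
  all_goals
    refine ⟨by simp, ?_, ?_⟩
    · intro r hr
      simp [show r ≠ 1 by omega, show r ≠ 3 by omega]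
    · simp [hs.env, Fin.ext_iff, Fml.Holds] at hr ⊢
      omega

theorem Decides.neg {P : Program} {K : ℕ} {p : Polynomial ℕ} {φ : Fml} (hP : Decides P K p φ) :
    Decides (.seq P (.ite 1 (.const 1 0) (.const 1 1))) K (p + 2) (.neg φ) := by
  intro n G h s hs
  refine (Runs.seq ((hP n G h s hs).mono le_rfl (fun s₁ h₁ => ?_))).mono
    (T' := (p + 2).eval n) (T := p.eval n + 2) (by simp) (fun _ h => h)
  obtain ⟨h1, h2, h3⟩ := h₁
  refine Runs.ite (T := 1) (fun hr => Runs.const ⟨h1, ?_, ?_⟩) (fun hr => Runs.const ⟨h1, ?_, ?_⟩)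
  · intro r hr
    simpa [show r ≠ 1 by omega] using h2 r hr
  · simpa [Fml.Holds] using h3.1 hr
  · intro r hr
    simpa [show r ≠ 1 by omega] using h2 r hr
  · simpa [Fml.Holds, ← h3] using hr

theorem Decides.and {P Q : Program} {K L : ℕ} {p q : Polynomial ℕ} {φ ψ : Fml}
    (hP : Decides P K p φ) (hQ : Decides Q L q ψ) :
    Decides (.seq P (.ite 1 Q (.const 1 0))) (K + L) (p + q + 2) (.and φ ψ) := by
  intro n G h s hs
  refine (Runs.seq ((hP n G h s hs).mono le_rfl (fun s₁ h₁ => ?_))).mono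
    (T' := (p + q + 2).eval n) (T := p.eval n + (q.eval n + 1 + 1)) (by simp; omega) (fun _ h => h)
  obtain ⟨h1, h2, h3⟩ := h₁
  refine Runs.ite (fun hr => ?_)
    (fun hr => (Runs.const ⟨h1, ?_, ?_⟩).mono (by omega) (fun _ h => h))
  · refine (hQ n G h s₁ (hs.of_keep h1 h2)).mono (by omega) ?_
    rintro s₂ ⟨k1, k2, k3⟩
    refine ⟨k1.trans h1, (h2.mono (by omega)).trans (k2.mono (by omega)), ?_⟩
    rw [k3]
    simp [Fml.Holds, h3.1 hr]
  · intro r hr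
    simpa [show r ≠ 1 by omega] using h2 r (by omega)
  · have : ¬ φ.Holds G h := by simpa [← h3] using hr
    simp [Fml.Holds, this]

/-- Search for a value of the variable `x` for which `P` gives a nonzero answer; the auxiliary
register `K + 1` tells whether there is one, and the auxiliary register `K + 2` holds it. -/
def search (x K : ℕ) (P : Program) : Program :=
  .seq (.move (2 * K + 9) (2 * x + 2)) (.seq (.const (2 * K + 5) 0)
    (.seq (.forN (2 * K + 3) (.seq (.move (2 * x + 2) (2 * K + 3))
      (.seq P (.ite 1 (.seq (.const (2 * K + 5) 1) (.move (2 * K + 7) (2 * K + 3))) (.const 1 0)))))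
      (.move (2 * x + 2) (2 * K + 9))))

/-- The search descends: with the counter at `i`, an unset flag says that no value from `i` on
satisfies `φ`, and a set flag comes with a witness. Register `2 * K + 9` keeps the old value of
variable `x`, which the search overwrites. -/
theorem Decides.search {P : Program} {K : ℕ} {p : Polynomial ℕ} {φ : Fml} (hP : Decides P K p φ)
    (x n : ℕ) (G : SimpleGraph (Fin n)) (h : Store n) (s : State) (hs : Rep G h s) :
    Runs (search x K P) s (n * (p.eval n + 9) + 8) fun s' => s'.arr = s.arr ∧ Keep (K + 4) s s' ∧
      (s'.reg (2 * K + 5) ≠ 0 → ∃ a : Fin n, s'.reg (2 * K + 7) = a ∧ φ.Holds G (h.setVar x a)) ∧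
      (s'.reg (2 * K + 5) = 0 → ∀ a, ¬ φ.Holds G (h.setVar x a)) := by
  have main := Runs.forN (n := n) (c := 2 * K + 3) (T := p.eval n + 6)
    (body := .seq (.move (2 * x + 2) (2 * K + 3)) (.seq P (.ite 1 (.seq (.const (2 * K + 5) 1)
      (.move (2 * K + 7) (2 * K + 3))) (.const 1 0))))
    (s := ((s.setReg 1 0).setReg (2 * K + 9) (s.reg (2 * x + 2))).setReg (2 * K + 5) 0) (by omega)
    (fun i s' => s'.arr = s.arr ∧
      (∀ r, r ≠ 2 * x + 2 → r % 2 = 0 ∨ 2 * (K + 4) + 3 ≤ r → s'.reg r = s.reg r) ∧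
      s'.reg (2 * K + 9) = s.reg (2 * x + 2) ∧
      (s'.reg (2 * K + 5) ≠ 0 → ∃ a : Fin n, s'.reg (2 * K + 7) = a ∧ φ.Holds G (h.setVar x a)) ∧
      (s'.reg (2 * K + 5) = 0 → ∀ a : Fin n, i ≤ a → ¬ φ.Holds G (h.setVar x a)))
    (by
      have : (0 : ℕ) ≠ 2 * K + 5 := by omega
      have : (0 : ℕ) ≠ 2 * K + 9 := by omega
      simp [*, hs.size])
    (by
      refine ⟨rfl, ?_, ?_, ?_, ?_⟩
      · intro r _ hr
        simp [show r ≠ 1 by omega, show r ≠ 2 * K + 5 by omega, show r ≠ 2 * K + 9 by omega]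
      · simp
      · simp
      · intro _ a ha
        omega)
    (by
      rintro i s' v w ⟨h1, h2, h3, h4, h5⟩
      refine ⟨h1, ?_, ?_, ?_, ?_⟩
      · intro r hx hr
        simpa [show r ≠ 1 by omega, show r ≠ 2 * K + 3 by omega] using h2 r hx hr
      · simpa using h3
      · simpa using h4
      · simpa using h5)
    (by
      rintro i hi s' ⟨h1, h2, h3, h4, h5⟩ h6
      refine (Runs.seq (Runs.move (by omega) (Runs.seq ((hP n G (h.setVar x ⟨i, hi⟩) _ (hs.setVar
        (s' := (s'.setReg 1 0).setReg (2 * x + 2) (s'.reg (2 * K + 3))) h1 ?_ ?_)).mono le_rfl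
        (fun s₂ k => Runs.ite (T := 3) (fun hr => Runs.seq (Runs.const (Runs.move (by omega) ?_)))
        (fun hr => (Runs.const ?_).mono (by omega) (fun _ h => h))))))).mono (by omega)
        (fun _ h => h)
      · intro r hr hr'
        simpa [show r ≠ 1 by omega, hr'] using h2 r hr' (by omega)
      · simpa using h6
      · obtain ⟨k1, k2, k3⟩ := k
        have k4 : ∀ r, r ≠ 1 → (r % 2 = 0 ∨ 2 * K + 3 ≤ r) → r ≠ 2 * x + 2 →
            s₂.reg r = s'.reg r := by
          intro r e1 e2 e3
          rw [k2 r e2]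
          simp [e1, e3]
        have k5 : s₂.reg (2 * K + 3) = i := by rw [k4 _ (by omega) (by omega) (by omega), h6]
        refine ⟨⟨k1.trans h1, ?_, ?_, ?_, ?_⟩, ?_⟩
        · intro r hx hr
          simp only [State.setReg_reg]
          rw [update_of_ne (by omega), update_of_ne (by omega), update_of_ne (by omega),
            k4 r (by omega) (by omega) (by omega), h2 r hx hr]
        · simp only [State.setReg_reg]
          rw [update_of_ne (by omega), update_of_ne (by omega), update_of_ne (by omega),
            k4 _ (by omega) (by omega) (by omega), h3]
        · intro _
          exact ⟨⟨i, hi⟩, by simp [k5], k3.1 hr⟩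
        · simp
        · simpa using k5
      · obtain ⟨k1, k2, k3⟩ := k
        have k4 : ∀ r, r ≠ 1 → (r % 2 = 0 ∨ 2 * K + 3 ≤ r) → r ≠ 2 * x + 2 →
            s₂.reg r = s'.reg r := by
          intro r e1 e2 e3
          rw [k2 r e2]
          simp [e1, e3]
        refine ⟨⟨k1.trans h1, ?_, ?_, ?_, ?_⟩, ?_⟩
        · intro r hx hr
          simp only [State.setReg_reg]
          rw [update_of_ne (by omega), k4 r (by omega) (by omega) (by omega), h2 r hx hr]
        · simp only [State.setReg_reg]
          rw [update_of_ne (by omega), k4 _ (by omega) (by omega) (by omega), h3]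
        · simp only [State.setReg_reg]
          rw [update_of_ne (by omega), k4 _ (by omega) (by omega) (by omega),
            update_of_ne (by omega), k4 _ (by omega) (by omega) (by omega)]
          exact h4
        · simp only [State.setReg_reg]
          rw [update_of_ne (by omega), k4 _ (by omega) (by omega) (by omega)]
          intro hf a ha
          rcases Nat.lt_or_ge i a with h' | h'
          · exact h5 hf a h'
          · have : a = ⟨i, hi⟩ := Fin.ext (by simp; omega)
            rw [this, ← k3]
            exact fun hn => hn hr
        · simp only [State.setReg_reg]
          rw [update_of_ne (by omega), k4 _ (by omega) (by omega) (by omega), h6])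
  refine (Runs.seq (T := 2) (Runs.move (by omega) (Runs.seq (T := 1) (Runs.const
    (Runs.seq (T' := 2) (main.mono le_rfl fun s' h' => Runs.move (by omega) ?_)))))).mono (by rw [show p.eval n + 6 + 3 = p.eval n + 9 by omega]; omega)
    (fun _ h => h)
  obtain ⟨⟨h1, h2, h3, h4, h5⟩, -⟩ := h'
  refine ⟨h1, ?_, ?_, ?_⟩
  · intro r hr
    by_cases hx : r = 2 * x + 2
    · subst hx; simpa using h3
    · simpa [hx, show r ≠ 1 by omega] using h2 r hx (by omega)
  · simpa [show 2 * K + 5 ≠ 2 * x + 2 by omega, show 2 * K + 7 ≠ 2 * x + 2 by omega] using h4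
  · simpa [show 2 * K + 5 ≠ 2 * x + 2 by omega] using h5

theorem Decides.ex {P : Program} {K : ℕ} {p : Polynomial ℕ} {φ : Fml} (hP : Decides P K p φ)
    (x : ℕ) : Decides (.seq (RelProg.search x K P) (.move 1 (2 * K + 5))) (K + 4)
      (.X * (p + 9) + 10) (.ex x φ) := by
  intro n G h s hs
  refine (Runs.seq (T := n * (p.eval n + 9) + 8) (T' := 2) ((hP.search x n G h s hs).mono le_rfl
    (fun s₁ h₁ => Runs.move (by omega) ?_))).mono (by simp) (fun _ h => h)
  obtain ⟨h1, h2, h3, h4⟩ := h₁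
  refine ⟨h1, ?_, ?_⟩
  · intro r hr
    simpa [show r ≠ 1 by omega] using h2 r hr
  · simp only [State.setReg_reg, update_self, Fml.Holds]
    refine ⟨fun hf => (h3 hf).imp fun _ h => h.2, fun ⟨a, ha⟩ hf => h4 hf a ha⟩

theorem exists_decides (φ : Fml) : ∃ P K p, Decides P K p φ := by
  induction φ with
  | adj x y => exact decides_adj x y
  | eq x y => exact decides_eq x y
  | rel a x y z => exact decides_rel a x y z
  | neg φ ih => obtain ⟨P, K, p, h⟩ := ih; exact ⟨_, _, _, h.neg⟩
  | and φ ψ ih ih' =>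
    obtain ⟨P, K, p, h⟩ := ih
    obtain ⟨Q, L, q, h'⟩ := ih'
    exact ⟨_, _, _, h.and h'⟩
  | ex x φ ih => obtain ⟨P, K, p, h⟩ := ih; exact ⟨_, _, _, h.ex x⟩

end RelProg

/-! ### Compiling statements on relations to machine programs -/

namespace RelProg

open Ram Function

/-- Run `body` for all values of the variables `0`, `1`, `2`. -/
def fill (body : Program) : Program := .forN 2 (.forN 4 (.forN 6 body))

theorem index₃_inj {n : ℕ} {p q r p' q' r' : Fin n}
    (h : ((p : ℕ) * n + q) * n + r = (p' * n + q') * n + r') : p = p' ∧ q = q' ∧ r = r' := by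
  have aux : ∀ {a b : ℕ} {c d : Fin n}, a * n + c = b * n + d → a = b ∧ c = d := by
    intro a b c d h
    have hn : 0 < n := c.pos
    have h1 := congrArg (· / n) h
    have h2 := congrArg (· % n) h
    simp only [Nat.add_comm _ (c : ℕ), Nat.add_comm _ (d : ℕ), Nat.add_mul_div_right _ _ hn,
      Nat.div_eq_of_lt c.2, Nat.div_eq_of_lt d.2] at h1
    simp only [Nat.mul_add_mod', Nat.mod_eq_of_lt c.2, Nat.mod_eq_of_lt d.2] at h2
    exact ⟨by omega, Fin.ext h2⟩
  obtain ⟨h1, h2⟩ := aux h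
  obtain ⟨h3, h4⟩ := aux h1
  exact ⟨Fin.ext h3, h4, h2⟩

/-- The three counters are the registers of the variables `0`, `1`, `2`, so `body` sees the current
triple as their values. Since the counters descend, the invariant is that the cells of all
lexicographically later triples are correct; later writes do not spoil them because distinct triples
have distinct addresses (`index₃_inj`). -/
theorem runs_fill {n K T b : ℕ} {body : Program} {s₀ : State} (h0 : s₀.reg 0 = n)
    (V : Fin n → Fin n → Fin n → Prop)
    (hbody : ∀ (s : State) (p q r : Fin n), s.reg 2 = p → s.reg 4 = q → s.reg 6 = r →
      (∀ a, a ≠ b → s.arr a = s₀.arr a) →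
      (∀ x, x ≠ 2 → x ≠ 4 → x ≠ 6 → x % 2 = 0 ∨ 2 * K + 3 ≤ x → s.reg x = s₀.reg x) →
      Runs body s T fun s' => ∃ v, (v ≠ 0 ↔ V p q r) ∧ Keep K s s' ∧
        s'.arr = update s.arr b (update (s.arr b) ((p * n + q) * n + r) v)) :
    Runs (fill body) s₀ (n * (n * (n * (T + 3) + 6) + 6) + 3) fun s' =>
      (∀ a, a ≠ b → s'.arr a = s₀.arr a) ∧
      (∀ x, x ≠ 2 → x ≠ 4 → x ≠ 6 → x % 2 = 0 ∨ 2 * K + 3 ≤ x → s'.reg x = s₀.reg x) ∧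
      ∀ p q r : Fin n, s'.arr b ((p * n + q) * n + r) ≠ 0 ↔ V p q r := by
  set F : State → Prop := fun s => (∀ a, a ≠ b → s.arr a = s₀.arr a) ∧
    (∀ x, x ≠ 2 → x ≠ 4 → x ≠ 6 → x % 2 = 0 ∨ 2 * K + 3 ≤ x → s.reg x = s₀.reg x) with hF
  have hFstab : ∀ s v c w, (c = 2 ∨ c = 4 ∨ c = 6) → F s → F ((s.setReg 1 v).setReg c w) := by
    rintro s v c w hc ⟨h1, h2⟩
    refine ⟨h1, fun x x2 x4 x6 hx => ?_⟩
    simpa [show x ≠ c by omega, show x ≠ 1 by omega] using h2 x x2 x4 x6 hx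
  set Good : State → Fin n → Fin n → Fin n → Prop := fun s p q r =>
    s.arr b ((p * n + q) * n + r) ≠ 0 ↔ V p q r with hGood
  have hsize : ∀ s, F s → s.reg 0 = n := fun s hs =>
    (hs.2 0 (by omega) (by omega) (by omega) (by omega)).trans h0
  refine (Runs.forN (n := n) (T := n * (n * (T + 3) + 6) + 3) (by omega)
    (fun i s => F s ∧ ∀ p q r : Fin n, i ≤ p → Good s p q r) h0 ⟨⟨by simp, by simp⟩, ?_⟩ ?_
    ?_).mono le_rfl ?_
  · intro p q r hp; omega
  · rintro i s v w ⟨h1, h2⟩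
    exact ⟨hFstab _ _ _ _ (by omega) h1, h2⟩
  · rintro i hi s ⟨h1, h2⟩ hsi
    refine (Runs.forN (n := n) (T := n * (T + 3) + 3) (by omega)
      (fun j s => (F s ∧ s.reg 2 = i) ∧ ∀ p q r : Fin n, (i < p ∨ p = i ∧ j ≤ q) → Good s p q r)
      (hsize s h1) ⟨⟨h1, hsi⟩, ?_⟩ ?_ ?_).mono le_rfl ?_
    · rintro p q r (hp | hp)
      · exact h2 p q r hp
      · omega
    · rintro j s v w ⟨⟨h1, h2⟩, h3⟩
      exact ⟨⟨hFstab _ _ _ _ (by omega) h1, by simpa using h2⟩, h3⟩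
    · rintro j hj s ⟨⟨h1, hsi⟩, h2⟩ hsj
      refine (Runs.forN (n := n) (T := T) (by omega)
        (fun k s => (F s ∧ s.reg 2 = i ∧ s.reg 4 = j) ∧
          ∀ p q r : Fin n, (i < p ∨ p = i ∧ (j < q ∨ q = j ∧ k ≤ r)) → Good s p q r)
        (hsize s h1) ⟨⟨h1, hsi, hsj⟩, ?_⟩ ?_ ?_).mono le_rfl ?_
      · intro p q r hp
        exact h2 p q r (by omega)
      · rintro j s v w ⟨⟨h1, h2, h3⟩, h4⟩
        exact ⟨⟨hFstab _ _ _ _ (by omega) h1, by simpa using h2, by simpa using h3⟩, h4⟩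
      · rintro k hk s ⟨⟨h1, hsi, hsj⟩, h2⟩ hsk
        refine (hbody s ⟨i, hi⟩ ⟨j, hj⟩ ⟨k, hk⟩ hsi hsj hsk h1.1 h1.2).mono le_rfl ?_
        rintro s' ⟨v, hv, hk', harr⟩
        refine ⟨⟨⟨⟨?_, ?_⟩, ?_, ?_⟩, ?_⟩, ?_⟩
        · intro a ha
          rw [harr, update_of_ne ha, h1.1 a ha]
        · intro x x2 x4 x6 hx
          rw [hk' x hx, h1.2 x x2 x4 x6 hx]
        · rw [hk' 2 (by omega), hsi]
        · rw [hk' 4 (by omega), hsj]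
        · intro p q r hpqr
          by_cases hne : p = ⟨i, hi⟩ ∧ q = ⟨j, hj⟩ ∧ r = ⟨k, hk⟩
          · obtain ⟨rfl, rfl, rfl⟩ := hne
            simpa [hGood, harr] using hv
          · have : ((p : ℕ) * n + q) * n + r ≠ (i * n + j) * n + k :=
              fun h => hne (index₃_inj (p' := ⟨i, hi⟩) (q' := ⟨j, hj⟩) (r' := ⟨k, hk⟩) h)
            simp only [hGood, harr, update_self, update_of_ne this]
            refine h2 p q r ?_
            simp only [Fin.ext_iff] at hne
            omega
        · rw [hk' 6 (by omega), hsk]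
      · rintro s' ⟨⟨⟨h1, h2, h3⟩, h4⟩, -⟩
        refine ⟨⟨⟨h1, h2⟩, fun p q r hp => h4 p q r (by omega)⟩, h3⟩
    · rintro s' ⟨⟨⟨h1, h2⟩, h3⟩, -⟩
      refine ⟨⟨h1, fun p q r hp => h3 p q r (by omega)⟩, h2⟩
  · rintro s' ⟨⟨h1, h2⟩, -⟩
    exact ⟨h1.1, h1.2, fun p q r => h2 p q r (by omega)⟩

/-- The machine program `P` realizes the statement `S`. -/
def Realizes (P : Program) (K : ℕ) (p : Polynomial ℕ) (S : Stmt) : Prop :=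
  ∀ (n : ℕ) (G : SimpleGraph (Fin n)) (h : Store n) (s : State), Rep G h s →
    Runs P s (p.eval n) fun s' => (∃ h', S.Exec G h h' ∧ Rep G h' s') ∧
      ∀ r, r % 2 = 1 → 2 * K + 3 ≤ r → s'.reg r = s.reg r

/-- The body of the loop that evaluates a formula, decided by `P`, into array `1` -/
def tabulate (K : ℕ) (P : Program) : Program :=
  .seq P (.seq (.const (2 * K + 3) 0) (.seq (.add (2 * K + 3) 1 (2 * K + 3))
    (.seq (.index₃ (2 * K + 5) (2 * K + 7) (2 * K + 9) 2 4 6)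
      (.store 1 (2 * K + 5) (2 * K + 3)))))

/-- The answer of `P` has to leave register `1` before the address is computed, because that
computation uses register `1` itself. -/
theorem Decides.runs_tabulate {P : Program} {K : ℕ} {p : Polynomial ℕ} {φ : Fml}
    (hP : Decides P K p φ) {n : ℕ} {G : SimpleGraph (Fin n)} {h : Store n} {s₀ : State}
    (hs : Rep G h s₀) :
    Runs (fill (tabulate K P)) s₀ (n * (n * (n * (p.eval n + n * 8 + 16) + 6) + 6) + 3) fun s' =>
      (∀ a, a ≠ 1 → s'.arr a = s₀.arr a) ∧
      (∀ x, x ≠ 2 → x ≠ 4 → x ≠ 6 → x % 2 = 0 ∨ 2 * (K + 4) + 3 ≤ x → s'.reg x = s₀.reg x) ∧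
      ∀ p q r : Fin n, s'.arr 1 ((p * n + q) * n + r) ≠ 0 ↔
        φ.Holds G (((h.setVar 0 p).setVar 1 q).setVar 2 r) := by
  refine runs_fill (K := K + 4) (T := p.eval n + n * 8 + 13) hs.size _ ?_
  intro s u v w hu hv hw harr hreg
  have hrep : Rep G (((h.setVar 0 u).setVar 1 v).setVar 2 w) s := by
    refine ⟨?_, ?_, ?_, ?_⟩
    · rw [hreg 0 (by omega) (by omega) (by omega) (by omega), hs.size]
    · intro x
      match x with
      | 0 => simpa [Store.setVar, update_apply] using hu
      | 1 => simpa [Store.setVar, update_apply] using hv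
      | 2 => simpa [Store.setVar, update_apply] using hw
      | x + 3 =>
        rw [hreg _ (by omega) (by omega) (by omega) (by omega), hs.env]
        simp [Store.setVar]
    · rw [harr 0 (by omega)]; exact hs.graph
    · intro a
      rw [harr (a + 2) (by omega)]; exact hs.rel a
  refine (Runs.seq (T := p.eval n) (T' := 1 + (1 + (n * 8 + 10 + 1)))
    ((hP n G _ s hrep).mono le_rfl ?_)).mono (by omega) (fun _ h => h)
  rintro s₁ ⟨a1, a2, a3⟩
  refine Runs.seq (Runs.const (Runs.seq (Runs.add (Runs.seq ((Runs.index₃ (n := n) ?_ (by omega)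
    (by omega) (by omega) (by omega) (by omega) (by omega) (by omega) (by omega) (by omega)
    (by omega) (by omega) (by omega) (by omega) (by omega) (by omega) (by omega)).mono le_rfl
    fun s₂ h₂ => Runs.store ?_)))))
  · have := a2 0 (by omega)
    simpa [show 0 ≠ 2 * K + 3 by omega, hrep.size] using this
  · obtain ⟨b1, b2, b3⟩ := h₂
    have hi : s₂.reg (2 * K + 5) = ((u : ℕ) * n + v) * n + w := by
      rw [b3]
      simp [show 4 ≠ 2 * K + 3 by omega,
        show 6 ≠ 2 * K + 3 by omega, a2 2 (by omega), a2 4 (by omega), a2 6 (by omega), hu, hv, hw]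
    have hx : s₂.reg (2 * K + 3) = s₁.reg 1 := by
      rw [b2 _ (by omega) (by omega) (by omega) (by omega)]
      simp
    refine ⟨s₁.reg 1, a3, ?_, ?_⟩
    · intro r hr
      rw [State.setArr_reg, b2 r (by omega) (by omega) (by omega) (by omega)]
      simp [show r ≠ 2 * K + 3 by omega, a2 r (by omega)]
    · rw [State.setArr_arr, hi, hx, b1]
      simp [a1]

/-- The body of the loop that copies array `1` to array `b` -/
def transfer (b : ℕ) : Program :=
  .seq (.index₃ 3 5 7 2 4 6) (.seq (.load 1 1 3) (.store b 3 1))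

theorem runs_transfer {n b : ℕ} {s₀ : State} (h0 : s₀.reg 0 = n) (hb : b ≠ 1) :
    Runs (fill (transfer b)) s₀ (n * (n * (n * (n * 8 + 15) + 6) + 6) + 3) fun s' =>
      (∀ a, a ≠ b → s'.arr a = s₀.arr a) ∧
      (∀ x, x ≠ 2 → x ≠ 4 → x ≠ 6 → x % 2 = 0 ∨ 2 * 3 + 3 ≤ x → s'.reg x = s₀.reg x) ∧
      ∀ p q r : Fin n, s'.arr b ((p * n + q) * n + r) ≠ 0 ↔
        s₀.arr 1 ((p * n + q) * n + r) ≠ 0 := by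
  refine runs_fill (K := 3) (T := n * 8 + 12) h0 (fun p q r => s₀.arr 1 ((p * n + q) * n + r) ≠ 0) ?_
  intro s u v w hu hv hw harr hreg
  refine Runs.seq (T := n * 8 + 10) (T' := 2) ((Runs.index₃ (n := n) ?_ (by omega)
    (by omega) (by omega) (by omega) (by omega) (by omega) (by omega) (by omega) (by omega)
    (by omega) (by omega) (by omega) (by omega) (by omega) (by omega) (by omega)).mono le_rfl
    fun s₂ h₂ => Runs.seq (Runs.load (Runs.store ?_)))
  · rw [hreg 0 (by omega) (by omega) (by omega) (by omega), h0]
  · obtain ⟨b1, b2, b3⟩ := h₂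
    rw [hu, hv, hw] at b3
    refine ⟨s₀.arr 1 ((u * n + v) * n + w), Iff.rfl, ?_, ?_⟩
    · intro r hr
      simp [show r ≠ 1 by omega, b2 r (by omega) (by omega) (by omega) (by omega)]
    · simp [b1, b3, harr 1 hb.symm]

/-- The formula may mention relation `a`, so the new relation is tabulated in the scratch array `1`
and copied only when complete. The loops use the variables `0`, `1`, `2` as counters; these are
finally set to the vertex `0`, which exists because the store gives variable `0` a value in `Fin n`.
-/
theorem Decides.assign {P : Program} {K : ℕ} {p : Polynomial ℕ} {φ : Fml}
    (hP : Decides P K p φ) (a : ℕ) :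
    ∃ P' K' p', Realizes P' K' p' (.assign a φ) := by
  refine ⟨.seq (fill (tabulate K P)) (.seq (fill (transfer (a + 2)))
    (.seq (.const 2 0) (.seq (.const 4 0) (.const 6 0)))), K + 4,
    (.X * (.X * (.X * (p + .X * 8 + 16) + 6) + 6) + 3) +
      ((.X * (.X * (.X * (.X * 8 + 15) + 6) + 6) + 3) + 3), ?_⟩
  intro n G h s hs
  refine (Runs.seq ((hP.runs_tabulate hs).mono le_rfl fun s₁ h₁ =>
    Runs.seq (T' := 3) ((runs_transfer (n := n) ?_ (by omega)).mono le_rfl fun s₂ h₂ =>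
      Runs.seq (Runs.const (Runs.seq (Runs.const (Runs.const ?_))))))).mono (by simp) (fun _ h => h)
  · rw [h₁.2.1 0 (by omega) (by omega) (by omega) (by omega), hs.size]
  · obtain ⟨a1, a2, a3⟩ := h₁
    obtain ⟨b1, b2, b3⟩ := h₂
    have hn : 0 < n := (h.env 0).pos
    refine ⟨⟨⟨fun x => if x < 3 then ⟨0, hn⟩ else h.env x, update h.rel a
      (fun p q r => φ.Holds G (((h.setVar 0 p).setVar 1 q).setVar 2 r))⟩, ⟨rfl, ?_⟩, ?_, ?_, ?_, ?_⟩,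
      ?_⟩
    · intro x hx
      simp [show ¬ x < 3 by omega]
    · simp [b2, a2, hs.size]
    · intro x
      by_cases hx : x < 3
      · obtain rfl | rfl | rfl : x = 0 ∨ x = 1 ∨ x = 2 := by omega
        all_goals simp
      · simp only [State.setReg_reg, hx, if_false]
        rw [update_of_ne (by omega), update_of_ne (by omega), update_of_ne (by omega),
          b2 _ (by omega) (by omega) (by omega) (by omega),
          a2 _ (by omega) (by omega) (by omega) (by omega), hs.env]
    · simp only [State.setReg_arr]
      rw [b1 0 (by omega), a1 0 (by omega)]
      exact hs.graph
    · intro a' u v w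
      simp only [State.setReg_arr]
      by_cases ha : a' = a
      · subst ha
        rw [b3, a3, update_self]
      · rw [b1 _ (by omega), a1 _ (by omega), update_of_ne ha]
        exact hs.rel _ _ _ _
    · intro r hr hr'
      simp only [State.setReg_reg]
      rw [update_of_ne (by omega), update_of_ne (by omega), update_of_ne (by omega),
          b2 _ (by omega) (by omega) (by omega) (by omega),
          a2 _ (by omega) (by omega) (by omega) (by omega)]

theorem Decides.pick {P Q R : Program} {K L M : ℕ} {p q r : Polynomial ℕ} {φ : Fml} {S S' : Stmt}
    (hP : Decides P K p φ) (x : ℕ) (hQ : Realizes Q L q S) (hR : Realizes R M r S') :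
    Realizes (.seq (RelProg.search x K P)
      (.ite (2 * K + 5) (.seq (.move (2 * x + 2) (2 * K + 7)) Q) R)) (K + 4 + L + M)
      ((.X * (p + 9) + 8) + (q + r + 3)) (.pick x φ S S') := by
  intro n G h s hs
  refine (Runs.seq (T := n * (p.eval n + 9) + 8) (T' := 2 + q.eval n + r.eval n + 1)
    ((hP.search x n G h s hs).mono le_rfl ?_)).mono (by simp; omega) (fun _ h => h)
  rintro s₁ ⟨a1, a2, a3, a4⟩
  refine Runs.ite (fun hf => ?_) (fun hf => ?_)
  · obtain ⟨a, ha, hφ⟩ := a3 hf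
    refine (Runs.seq (T := 2) (T' := q.eval n) (Runs.move (by omega) ((hQ n G (h.setVar x a) _ ?_).mono
      le_rfl ?_))).mono (by omega) (fun _ h => h)
    · refine hs.setVar a1 ?_ (by simp [ha])
      intro r hr hr'
      simpa [hr', show r ≠ 1 by omega] using a2 r (by omega)
    · rintro s₂ ⟨⟨h', h1, h2⟩, h3⟩
      refine ⟨⟨h', .inl ⟨a, hφ, h1⟩, h2⟩, fun r hr hr' => ?_⟩
      rw [h3 r hr (by omega)]
      simpa [show r ≠ 2 * x + 2 by omega, show r ≠ 1 by omega] using a2 r (by omega)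
  · refine (hR n G h s₁ (hs.of_keep a1 a2)).mono (by omega) ?_
    rintro s₂ ⟨⟨h', h1, h2⟩, h3⟩
    exact ⟨⟨h', .inr ⟨a4 hf, h1⟩, h2⟩, fun r hr hr' => (h3 r hr (by omega)).trans (a2 r (by omega))⟩

theorem Realizes.seq {P Q : Program} {K L : ℕ} {p q : Polynomial ℕ} {S S' : Stmt}
    (hP : Realizes P K p S) (hQ : Realizes Q L q S') :
    Realizes (.seq P Q) (K + L) (p + q) (.seq S S') := by
  intro n G h s hs
  refine (Runs.seq ((hP n G h s hs).mono le_rfl ?_)).mono (T := p.eval n + q.eval n) (by simp)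
    (fun _ h => h)
  rintro s₁ ⟨⟨h₁, a1, a2⟩, a3⟩
  refine (hQ n G h₁ s₁ a2).mono le_rfl ?_
  rintro s₂ ⟨⟨h₂, b1, b2⟩, b3⟩
  exact ⟨⟨h₂, ⟨h₁, a1, b1⟩, b2⟩, fun r hr hr' =>
    (b3 r hr (by omega)).trans (a3 r hr (by omega))⟩

/-- The counter is the first odd register beyond those that `P` may change. The invariant carries
the sequence of stores passed so far, and each round appends one. -/
theorem Realizes.iter {P : Program} {K : ℕ} {p : Polynomial ℕ} {S : Stmt}
    (hP : Realizes P K p S) :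
    Realizes (.forN (2 * K + 3) P) (K + 1) (.X * (p + 3) + 3) (.iter S) := by
  intro n G h s hs
  refine (Runs.forN (n := n) (T := p.eval n) (by omega) (fun i s' => i ≤ n ∧ (∃ f : ℕ → Store n,
    f 0 = h ∧ (∀ k < n - i, S.Exec G (f k) (f (k + 1))) ∧ Rep G (f (n - i)) s') ∧
    ∀ r, r % 2 = 1 → 2 * (K + 1) + 3 ≤ r → s'.reg r = s.reg r) hs.size
    ⟨le_rfl, ⟨fun _ => h, rfl, by omega, hs⟩, fun _ _ _ => rfl⟩ ?_ ?_).mono (by simp) ?_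
  · rintro i s' v w ⟨h1, ⟨f, h2, h3, h4⟩, h5⟩
    refine ⟨h1, ⟨f, h2, h3, h4.of_keep (K := K + 1) rfl ?_⟩, ?_⟩
    · intro r hr
      simp [show r ≠ 1 by omega, show r ≠ 2 * K + 3 by omega]
    · intro r hr hr'
      simpa [show r ≠ 1 by omega, show r ≠ 2 * K + 3 by omega] using h5 r hr hr'
  · rintro i hi s' ⟨h1, ⟨f, h2, h3, h4⟩, h5⟩ h6
    refine (hP n G _ s' h4).mono le_rfl ?_
    rintro s₁ ⟨⟨h', a1, a2⟩, a3⟩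
    refine ⟨⟨by omega, ⟨fun k => if k ≤ n - (i + 1) then f k else h', by simp [h2], ?_, ?_⟩, ?_⟩, ?_⟩
    · intro k hk
      by_cases hk' : k < n - (i + 1)
      · simpa [show k ≤ n - (i + 1) by omega, show k + 1 ≤ n - (i + 1) by omega] using h3 k hk'
      · obtain rfl : k = n - (i + 1) := by omega
        simpa using a1
    · simpa [show ¬ n - i ≤ n - (i + 1) by omega] using a2
    · intro r hr hr'
      rw [a3 r hr (by omega), h5 r hr hr']
    · rw [a3 _ (by omega) (by omega), h6]
  · rintro s' ⟨⟨-, ⟨f, h2, h3, h4⟩, h5⟩, -⟩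
    exact ⟨⟨f n, ⟨f, h2, rfl, h3⟩, h4⟩, h5⟩

theorem exists_realizes (S : Stmt) : ∃ P K p, Realizes P K p S := by
  induction S with
  | skip =>
    exact ⟨.const 1 0, 0, 1, fun n G h s hs => (Runs.const
      ⟨⟨h, rfl, hs.of_keep (K := 0) rfl fun r hr => by simp [show r ≠ 1 by omega]⟩,
        fun r _ hr => by simp [show r ≠ 1 by omega]⟩).mono (by simp) (fun _ h => h)⟩
  | assign a φ =>
    obtain ⟨P, K, p, h⟩ := exists_decides φ
    exact h.assign a
  | pick x φ S S' ih ih' =>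
    obtain ⟨P, K, p, h⟩ := exists_decides φ
    obtain ⟨Q, L, q, hQ⟩ := ih
    obtain ⟨R, M, r, hR⟩ := ih'
    exact ⟨_, _, _, h.pick x hQ hR⟩
  | seq S S' ih ih' =>
    obtain ⟨Q, L, q, hQ⟩ := ih
    obtain ⟨R, M, r, hR⟩ := ih'
    exact ⟨_, _, _, hQ.seq hR⟩
  | iter S ih =>
    obtain ⟨Q, L, q, hQ⟩ := ih
    exact ⟨_, _, _, hQ.iter⟩

/-! ### Output of the colours -/

/-- Write to cell `v` of array `1` the least `u` that `P` accepts, where `v` and `u` are the values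
of the variables `0` and `1`. -/
def output (P : Program) : Program :=
  .forN 2 (.forN 4 (.seq P (.ite 1 (.store 1 2 4) (.const 1 0))))

/-- The counter for `u` descends, so the last accepted value written to cell `v` is the least one.
-/
theorem Decides.runs_output {P : Program} {K e : ℕ} {p : Polynomial ℕ}
    (hP : Decides P K p (.rel e 0 1 1)) {n : ℕ} {G : SimpleGraph (Fin n)} {h : Store n}
    {s : State} (hs : Rep G h s) :
    Runs (output P) s (n * (n * (p.eval n + 5) + 6) + 3) fun s' =>
      ∀ v u : Fin n, h.rel e v u u → ∃ w : Fin n, s'.arr 1 v = w ∧ h.rel e v w w ∧ w ≤ u := by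
  set F : State → Prop := fun s' => (∀ a, a ≠ 1 → s'.arr a = s.arr a) ∧
    (∀ x, x ≠ 2 → x ≠ 4 → x % 2 = 0 → s'.reg x = s.reg x) with hF
  have hFstab : ∀ s v c w, (c = 2 ∨ c = 4) → F s → F ((s.setReg 1 v).setReg c w) := by
    rintro s v c w hc ⟨h1, h2⟩
    refine ⟨h1, fun x x2 x4 hx => ?_⟩
    simpa [show x ≠ c by omega, show x ≠ 1 by omega] using h2 x x2 x4 hx
  set Good : State → ℕ → Fin n → Prop := fun s' j v => ∀ u : Fin n, j ≤ u → h.rel e v u u →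
    ∃ w : Fin n, s'.arr 1 v = w ∧ h.rel e v w w ∧ w ≤ u with hGood
  have hsize : ∀ s', F s' → s'.reg 0 = n := fun s' hs' =>
    (hs'.2 0 (by omega) (by omega) (by omega)).trans hs.size
  refine (Runs.forN (n := n) (T := n * (p.eval n + 5) + 3) (by omega)
    (fun i s => F s ∧ ∀ v : Fin n, i ≤ v → Good s 0 v) hs.size ⟨⟨by simp, by simp⟩, ?_⟩ ?_
    ?_).mono le_rfl ?_
  · intro v hv; omega
  · rintro i s v w ⟨h1, h2⟩
    exact ⟨hFstab _ _ _ _ (by omega) h1, h2⟩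
  · rintro i hi s' ⟨h1, h2⟩ hsi
    refine (Runs.forN (n := n) (T := p.eval n + 2) (by omega)
      (fun j s => (F s ∧ s.reg 2 = i) ∧ (∀ v : Fin n, i < v → Good s 0 v) ∧ Good s j ⟨i, hi⟩)
      (hsize s' h1) ⟨⟨h1, hsi⟩, fun v hv => h2 v hv, ?_⟩ ?_ ?_).mono le_rfl ?_
    · intro u hu; omega
    · rintro j s v w ⟨⟨h1, h2⟩, h3⟩
      exact ⟨⟨hFstab _ _ _ _ (by omega) h1, by simpa using h2⟩, h3⟩
    · rintro j hj s₁ ⟨⟨h1, hsi⟩, h2, h3⟩ hsj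
      have hrep : Rep G ((h.setVar 0 ⟨i, hi⟩).setVar 1 ⟨j, hj⟩) s₁ := by
        refine ⟨hsize _ h1, ?_, ?_, ?_⟩
        · intro x
          match x with
          | 0 => simpa [Store.setVar, update_apply] using hsi
          | 1 => simpa [Store.setVar, update_apply] using hsj
          | x + 2 =>
            rw [h1.2 _ (by omega) (by omega) (by omega), hs.env]
            simp [Store.setVar]
        · rw [h1.1 0 (by omega)]; exact hs.graph
        · intro a
          rw [h1.1 (a + 2) (by omega)]; exact hs.rel a
      refine (Runs.seq (T' := 2) ((hP n G _ s₁ hrep).mono le_rfl ?_)).mono (by omega) (fun _ h => h)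
      rintro s₂ ⟨a1, a2, a3⟩
      have hE : s₂.reg 1 ≠ 0 ↔ h.rel e ⟨i, hi⟩ ⟨j, hj⟩ ⟨j, hj⟩ := by
        simpa [Fml.Holds, Store.setVar] using a3
      have hF2 : ∀ x, x ≠ 2 → x ≠ 4 → x % 2 = 0 → s₂.reg x = s.reg x := fun x x2 x4 hx =>
        (a2 x (by omega)).trans (h1.2 x x2 x4 hx)
      have r2 : s₂.reg 2 = i := (a2 2 (by omega)).trans hsi
      have r4 : s₂.reg 4 = j := (a2 4 (by omega)).trans hsj
      refine Runs.ite (T := 1) (fun hf => Runs.store ?_) (fun hf => Runs.const ?_)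
      · refine ⟨⟨⟨⟨?_, hF2⟩, r2⟩, ?_, ?_⟩, r4⟩
        · intro a ha
          simp [ha, a1, h1.1 a ha]
        · intro v hv u hu hvu
          simpa [r2, show (v : ℕ) ≠ i by omega, a1] using h2 v hv u hu hvu
        · intro u hu hvu
          exact ⟨⟨j, hj⟩, by simp [r2, r4], hE.1 hf, hu⟩
      · refine ⟨⟨⟨⟨?_, ?_⟩, by simpa using r2⟩, ?_, ?_⟩, by simpa using r4⟩
        · intro a ha
          simp [a1, h1.1 a ha]
        · intro x x2 x4 hx
          simpa [show x ≠ 1 by omega] using hF2 x x2 x4 hx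
        · intro v hv u hu hvu
          simpa [a1] using h2 v hv u hu hvu
        · intro u hu hvu
          rcases Nat.lt_or_ge j u with h' | h'
          · simpa [a1] using h3 u h' hvu
          · obtain rfl : u = ⟨j, hj⟩ := Fin.ext (by simp; omega)
            exact absurd hf (hE.2 hvu)
    · rintro s₁ ⟨⟨⟨h1, h2⟩, h3, h4⟩, -⟩
      refine ⟨⟨h1, fun v hv => ?_⟩, h2⟩
      rcases Nat.lt_or_ge i v with h' | h'
      · exact h3 v h'
      · obtain rfl : v = ⟨i, hi⟩ := Fin.ext (by simp; omega)
        exact h4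
  · rintro s' ⟨⟨-, h2⟩, -⟩
    exact fun v u hvu => h2 v (by omega) u (by omega) hvu

theorem rep_graphInput {n : ℕ} (G : SimpleGraph (Fin n)) (h : Store n)
    (henv : ∀ x, (h.env x : ℕ) = 0) (hrel : ∀ a u v w, ¬ h.rel a u v w) :
    Rep G h (graphInput G) where
  size := by simp [graphInput]
  env x := by simp [graphInput, henv]
  graph u v := by
    have key : (∃ u' v' : Fin n, (u : ℕ) * n + v = u' * n + v' ∧ G.Adj u' v') ↔ G.Adj u v := by
      constructor
      · rintro ⟨u', v', h1, h2⟩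
        have := index₃_inj (p := u) (q := v) (r := u) (p' := u') (q' := v') (r' := u) (by rw [h1])
        rwa [this.1, this.2.1]
      · exact fun h => ⟨u, v, rfl, h⟩
    simp [graphInput, key]
  rel a u v w := by simp [graphInput, hrel]

/-- Every program on relations can be run on a machine in polynomial time, with the least element
related to `v` by relation `e` as the colour of `v`. -/
theorem exists_program (S : Stmt) (e : ℕ) : ∃ (A : Program) (p : Polynomial ℕ),
    ∀ (n : ℕ) (G : SimpleGraph (Fin n)), ∃ (t : ℕ) (s : State), Exec A (graphInput G) t s ∧
      t ≤ p.eval n ∧ ∀ h : Store n, (∀ x, (h.env x : ℕ) = 0) → (∀ a u v w, ¬ h.rel a u v w) →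
        ∃ h', S.Exec G h h' ∧ ∀ v u : Fin n, h'.rel e v u u →
          ∃ w : Fin n, s.arr 1 v = w ∧ h'.rel e v w w ∧ w ≤ u := by
  obtain ⟨P, K, p, hP⟩ := exists_realizes S
  obtain ⟨Q, L, q, hQ⟩ := exists_decides (.rel e 0 1 1)
  -- No store exists for `n = 0`, so the empty graph is caught by a test of its own.
  refine ⟨.ite 0 (.seq P (output Q)) (.const 1 0), p + (.X * (.X * (q + 5) + 6) + 3) + 2, ?_⟩
  intro n G
  rcases Nat.eq_zero_or_pos n with rfl | hn
  · refine ⟨_, _, .ite_false (by simp [graphInput]) (.const _ _ _), by simp, ?_⟩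
    intro h
    exact (h.env 0).elim0
  · have hrep := rep_graphInput G ⟨fun _ => ⟨0, hn⟩, fun _ _ _ _ => False⟩ (by simp) (by simp)
    obtain ⟨t, s, h1, h2, h3⟩ := Runs.seq (T := p.eval n) (P' := output Q)
      ((hP n G _ _ hrep).mono le_rfl fun s₁ h₁ => by
        obtain ⟨⟨h', a1, a2⟩, -⟩ := h₁
        exact (hQ.runs_output a2).mono (Q' := fun s => ∃ h', S.Exec G
          ⟨fun _ => ⟨0, hn⟩, fun _ _ _ _ => False⟩ h' ∧ ∀ v u : Fin n, h'.rel e v u u →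
          ∃ w : Fin n, s.arr 1 v = w ∧ h'.rel e v w w ∧ w ≤ u) le_rfl fun _ k => ⟨h', a1, k⟩)
    refine ⟨_, _, .ite_true (by simp [graphInput]; omega) h1, by simp; omega, ?_⟩
    intro h henv hrel
    have : h = ⟨fun _ => ⟨0, hn⟩, fun _ _ _ _ => False⟩ := by
      obtain ⟨env, rel⟩ := h
      congr
      · exact funext fun x => Fin.ext (henv x)
      · funext a u v w
        simpa using hrel a u v w
    rw [this]
    exact h3

end RelProg

/-! ## Maximum matchings -/

namespace Matching

open Function Set

variable {V : Type*} {H : SimpleGraph V}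

/-- A matching of `H`, as an involution whose fixed points are the unmatched vertices -/
structure IsMatch (H : SimpleGraph V) (f : V → V) : Prop where
  invol : ∀ x, f (f x) = x
  adj : ∀ x, f x ≠ x → H.Adj x (f x)

/-- The vertices that the matching `f` leaves unmatched -/
def missed (f : V → V) : Set V := {x | f x = x}

/-- `s` is a vertex of `S` that `f` does not match with another vertex of `S`. -/
def Out (f : V → V) (S : Set V) (s : V) : Prop := s ∈ S ∧ (f s = s ∨ f s ∉ S)

theorem not_out {f : V → V} {S : Set V} {s : V} (hs : s ∈ S) (h : ¬ Out f S s) :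
    f s ≠ s ∧ f s ∈ S := by
  simpa [Out, hs] using h

/-- In the sum of `1 : ZMod 2` over `S`, the two summands of each orbit cancel. -/
theorem even_card_of_involution (S : Finset V) (f : V → V) (h1 : ∀ x ∈ S, f x ∈ S)
    (h2 : ∀ x ∈ S, f (f x) = x) (h3 : ∀ x ∈ S, f x ≠ x) : Even S.card := by
  have := Finset.sum_involution (s := S) (f := fun _ => (1 : ZMod 2)) (fun a _ => f a)
    (fun _ _ => by decide) (fun a ha _ => h3 a ha) (fun a ha => h1 a ha) (fun a ha => h2 a ha)
  rw [Finset.sum_const, nsmul_one] at this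
  exact (ZMod.natCast_eq_zero_iff_even).1 this

/-- An alternating forest in which the class `{l | cl k l}` of an outer vertex `k` is a blossom:
`D` and `I` are the sets of outer and inner vertices, and `N x`, for an outer vertex `x`, is a
matching that misses `x`. -/
structure IsForest (H : SimpleGraph V) (d : ℕ) (D I : Set V) (cl : V → V → Prop)
    (N : V → V → V) : Prop where
  isMatch : ∀ x ∈ D, IsMatch H (N x)
  self : ∀ x ∈ D, N x x = x
  size : ∀ x ∈ D, (missed (N x)).ncard = d
  missed_mem : ∀ x ∈ D, ∀ y, N x y = y → y ∈ D
  disj : ∀ w ∈ I, w ∉ D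
  inner : ∀ x ∈ D, ∀ w ∈ I, N x w ∈ D
  rest : ∀ x ∈ D, ∀ y ∈ D, ∀ r, r ∉ D → r ∉ I → N x r = N y r
  outer : ∀ x ∈ D, ∀ k ∈ D, N x k ∈ I ∨ cl k (N x k)
  refl : ∀ k ∈ D, cl k k
  symm : ∀ k l, cl k l → cl l k
  trans : ∀ k l m, cl k l → cl l m → cl k m
  mem : ∀ k l, cl k l → k ∈ D
  out : ∀ x ∈ D, ∀ k ∈ D, ∃! s, Out (N x) {l | cl k l} s
  two : ∀ w ∈ I, ∃ a b, ∀ x ∈ D, N x w = a ∨ N x w = b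

/-- The missed vertices are the roots, each a blossom by itself, and `f` misses all of them, so it
serves as the matching of each. -/
theorem isForest_initial {f : V → V} (hf : IsMatch H f) :
    IsForest H (missed f).ncard (missed f) ∅ (fun x y => x = y ∧ x ∈ missed f) (fun _ => f) where
  isMatch _ _ := hf
  self _ hx := hx
  size _ _ := rfl
  missed_mem _ _ _ hy := hy
  disj _ h := h.elim
  inner _ _ _ h := h.elim
  rest _ _ _ _ _ _ _ := rfl
  outer _ _ k hk := .inr ⟨hk.symm, hk⟩
  refl _ hk := ⟨rfl, hk⟩
  symm := by rintro k l ⟨rfl, h⟩; exact ⟨rfl, h⟩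
  trans := by rintro k l m ⟨rfl, h⟩ ⟨rfl, -⟩; exact ⟨rfl, h⟩
  mem _ _ h := h.2
  out _ _ k hk := ⟨k, ⟨⟨rfl, hk⟩, .inl hk⟩, fun _ h => h.1.1.symm⟩
  two _ h := h.elim

/-- If no edge leaves a blossom except to inner vertices, then the matchings are maximum. -/
theorem IsForest.le_ncard_missed [Finite V] {d : ℕ} {D I : Set V} {cl : V → V → Prop}
    {N : V → V → V} (h : IsForest H d D I cl N) (hD : D.Nonempty)
    (hstuck : ∀ v ∈ D, ∀ u, H.Adj v u → u ∈ I ∨ cl v u) {g : V → V} (hg : IsMatch H g) :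
    d ≤ (missed g).ncard := by
  classical
  obtain ⟨x, hx⟩ := hD
  have := Fintype.ofFinite V
  set C : Set (Set V) := (fun k => {l | cl k l}) '' D with hC
  have cls : ∀ k l, cl k l → {m | cl k m} = {m | cl l m} := fun k l hkl => by
    ext m
    exact ⟨fun hm => h.trans _ _ _ (h.symm _ _ hkl) hm, fun hm => h.trans _ _ _ hkl hm⟩
  -- By `hstuck`, an edge of `g` that starts in a blossom ends in the same blossom or in `I`. If `g`
  -- matched all vertices of the blossom internally, the blossom would be even; but `N x` pairs off
  -- all of its vertices except one, so it is odd.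
  have key : ∀ K : C, ∃ k ∈ K.1, g k = k ∨ g k ∈ I := by
    rintro ⟨_, k, hk, rfl⟩
    by_contra! hno
    simp only [mem_ofPred_eq] at hno
    obtain ⟨s, hs, hu⟩ := h.out x hx k hk
    have hgK : ∀ l, cl k l → cl k (g l) := fun l hl => by
      rcases hstuck l (h.mem _ _ (h.symm _ _ hl)) _ (hg.adj l (hno l hl).1) with h1 | h1
      · exact absurd h1 (hno l hl).2
      · exact h.trans _ _ _ hl h1
    have e1 : Even (Finset.univ.filter fun l => cl k l).card :=
      even_card_of_involution _ g (by simpa using hgK) (fun l _ => hg.invol l)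
        (fun l hl => (hno l (by simpa using hl)).1)
    have e2 : Even ((Finset.univ.filter fun l => cl k l).erase s).card := by
      have hin : ∀ l, cl k l → l ≠ s → N x l ≠ l ∧ cl k (N x l) := fun l hl hls =>
        not_out (S := {l | cl k l}) hl fun ho => hls (hu l ho)
      refine even_card_of_involution _ (N x) ?_ (fun l _ => (h.isMatch x hx).invol l) ?_
      · intro l hl
        simp only [Finset.mem_erase, Finset.mem_filter, Finset.mem_univ, true_and] at hl ⊢
        refine ⟨fun hls => ?_, (hin l hl.2 hl.1).2⟩
        have hl' : N x s = l := by rw [← hls, (h.isMatch x hx).invol]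
        rcases hs.2 with h1 | h1
        · exact hl.1 (hl'.symm.trans h1)
        · exact h1 (by rw [hl']; exact hl.2)
      · intro l hl
        simp only [Finset.mem_erase, Finset.mem_filter, Finset.mem_univ, true_and] at hl
        exact (hin l hl.2 hl.1).1
    have hsK : s ∈ Finset.univ.filter fun l => cl k l := by simpa using hs.1
    rw [Finset.card_erase_of_mem hsK] at e2
    have hpos := Finset.card_pos.2 ⟨s, hsK⟩
    obtain ⟨a, ha⟩ := e1
    obtain ⟨b, hb⟩ := e2
    omega
  choose q hq hq' using key
  -- Thus there are at most as many blossoms as vertices in `missed g` and `I` together.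
  let Ψ : C → missed g ⊕ I := fun K =>
    if hK : g (q K) = q K then .inl ⟨q K, hK⟩ else .inr ⟨g (q K), (hq' K).resolve_left hK⟩
  have eqC : ∀ K L : C, q K = q L → K = L := by
    rintro ⟨_, k, hk, rfl⟩ ⟨_, l, hl, rfl⟩ he
    have h1 := hq ⟨_, k, hk, rfl⟩
    have h2 := hq ⟨_, l, hl, rfl⟩
    rw [← he] at h2
    exact Subtype.ext (cls _ _ (h.trans _ _ _ h1 (h.symm _ _ h2)))
  have hΨ : Injective Ψ := by
    intro K L hKL
    simp only [Ψ] at hKL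
    split_ifs at hKL with h1 h2 h2
    · exact eqC K L (congrArg Subtype.val (Sum.inl.inj hKL))
    · have : g (q K) = g (q L) := congrArg Subtype.val (Sum.inr.inj hKL)
      refine eqC K L ?_
      rw [← hg.invol (q K), this, hg.invol]
  have mI : ∀ w ∈ I, N x w ∈ D := h.inner x hx
  -- Conversely, the vertices missed by `N x` and the partners of inner vertices lie in different
  -- blossoms, since `N x` leaves out only one vertex of each. This gives `d + |I|` blossoms, and
  -- `|I|` cancels.
  let Φ : missed (N x) ⊕ I → C := Sum.elim
    (fun y => ⟨{l | cl y.1 l}, y.1, h.missed_mem x hx _ y.2, rfl⟩)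
    (fun w => ⟨{l | cl (N x w.1) l}, N x w.1, mI _ w.2, rfl⟩)
  have outI : ∀ w ∈ I, N x (N x w) ∉ {l | cl (N x w) l} := fun w hw hcl => by
    rw [(h.isMatch x hx).invol] at hcl
    exact h.disj w hw (h.mem _ _ (h.symm _ _ hcl))
  have inj : ∀ k l, k ∈ D → l ∈ D → {m | cl k m} = {m | cl l m} →
      (N x k = k ∨ N x k ∉ {m | cl k m}) → (N x l = l ∨ N x l ∉ {m | cl l m}) → k = l := by
    intro k l hk hl he h1 h2
    refine (h.out x hx k hk).unique ⟨h.refl k hk, h1⟩ ?_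
    rw [he]
    exact ⟨h.refl l hl, h2⟩
  have hΦ : Injective Φ := by
    rintro (⟨y, hy⟩ | ⟨w, hw⟩) (⟨y', hy'⟩ | ⟨w', hw'⟩) he <;>
      replace he := congrArg Subtype.val he
    · have := inj _ _ (h.missed_mem x hx _ hy) (h.missed_mem x hx _ hy') he (.inl hy) (.inl hy')
      subst this; rfl
    · have := inj _ _ (h.missed_mem x hx _ hy) (mI _ hw') he (.inl hy) (.inr (outI _ hw'))
      subst this
      have h2 : N x (N x w') = N x w' := hy
      rw [(h.isMatch x hx).invol] at h2
      exact absurd (h2.symm ▸ mI _ hw') (h.disj w' hw')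
    · have := inj _ _ (mI _ hw) (h.missed_mem x hx _ hy') he (.inr (outI _ hw)) (.inl hy')
      subst this
      have h2 : N x (N x w) = N x w := hy'
      rw [(h.isMatch x hx).invol] at h2
      exact absurd (h2.symm ▸ mI _ hw) (h.disj w hw)
    · have := inj _ _ (mI _ hw) (mI _ hw') he (.inr (outI _ hw)) (.inr (outI _ hw'))
      have h2 : w = w' := by
        rw [← (h.isMatch x hx).invol w, this, (h.isMatch x hx).invol]
      subst h2; rfl
  have hle := Nat.card_le_card_of_injective _ (hΨ.comp hΦ)
  simp only [Nat.card_sum, Nat.card_coe_set_eq, h.size x hx] at hle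
  omega

/-! ### Combining two matchings along an edge -/

open Classical in
/-- Match `u` with `v`, the other vertices of `S` as `f` does, and the other vertices outside `S`
as `g` does. -/
noncomputable def mix (S : Set V) (u v : V) (f g : V → V) (y : V) : V :=
  if y = u then v else if y = v then u else if y ∈ S then f y else if g y ∈ S then y else g y

section mix

variable {S : Set V} {u v : V} {f g : V → V}

@[simp] theorem mix_left : mix S u v f g u = v := by simp [mix]

theorem mix_right (huv : u ≠ v) : mix S u v f g v = u := by simp [mix, huv.symm]

theorem mix_of_mem {y : V} (hv : v ∉ S) (hy : y ∈ S) (hyu : y ≠ u) : mix S u v f g y = f y := by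
  have : y ≠ v := fun h => hv (h ▸ hy)
  simp [mix, this, hy, hyu]

theorem mix_of_free {y : V} (hu : u ∈ S) (hy : y ∉ S) (hyv : y ≠ v) (hg : g y ∈ S) :
    mix S u v f g y = y := by
  have : y ≠ u := fun h => hy (h ▸ hu)
  simp [mix, this, hy, hyv, hg]

theorem mix_of_notMem {y : V} (hu : u ∈ S) (hy : y ∉ S) (hyv : y ≠ v) (hg : g y ∉ S) :
    mix S u v f g y = g y := by
  have : y ≠ u := fun h => hy (h ▸ hu)
  simp [mix, this, hy, hyv, hg]

/-- The vertex `v` is free in `g`, and `f` keeps `S` without `u` to itself, so the edge `u v` can be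
added once the edges of `g` across the boundary of `S` are dropped. -/
theorem isMatch_mix (hf : IsMatch H f) (hg : IsMatch H g) (hu : u ∈ S) (hv : v ∉ S)
    (huv : H.Adj v u) (hgv : g v = v) (hS : ∀ y ∈ S, y ≠ u → f y ∈ S ∧ f y ≠ u) :
    IsMatch H (mix S u v f g) := by
  have hne : u ≠ v := huv.ne'
  have cases : ∀ y, y = u ∨ y = v ∨ (y ∈ S ∧ y ≠ u) ∨ (y ∉ S ∧ y ≠ v ∧ g y ∈ S) ∨
      (y ∉ S ∧ y ≠ v ∧ g y ∉ S) := by intro y; tauto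
  refine ⟨fun y => ?_, fun y => ?_⟩
  · rcases cases y with rfl | rfl | ⟨h1, h2⟩ | ⟨h1, h2, h3⟩ | ⟨h1, h2, h3⟩
    · rw [mix_left, mix_right hne]
    · rw [mix_right hne, mix_left]
    · rw [mix_of_mem hv h1 h2, mix_of_mem hv (hS y h1 h2).1 (hS y h1 h2).2, hf.invol]
    · rw [mix_of_free hu h1 h2 h3, mix_of_free hu h1 h2 h3]
    · have h4 : g y ≠ v := fun h => h2 (by rw [← hg.invol y, h, hgv])
      rw [mix_of_notMem hu h1 h2 h3, mix_of_notMem hu h3 h4 (by rwa [hg.invol]), hg.invol]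
  · rcases cases y with rfl | rfl | ⟨h1, h2⟩ | ⟨h1, h2, h3⟩ | ⟨h1, h2, h3⟩
    · rw [mix_left]; exact fun _ => huv.symm
    · rw [mix_right hne]; exact fun _ => huv
    · rw [mix_of_mem hv h1 h2]; exact hf.adj y
    · rw [mix_of_free hu h1 h2 h3]; exact fun h => absurd rfl h
    · rw [mix_of_notMem hu h1 h2 h3]; exact hg.adj y

theorem missed_mix (hu : u ∈ S) (hv : v ∉ S)
    (hgv : g v = v) (hS : ∀ y ∈ S, y ≠ u → f y ≠ y) :
    missed (mix S u v f g) = {y | y ∉ S ∧ y ≠ v ∧ (g y ∈ S ∨ g y = y)} := by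
  have hne : u ≠ v := fun h => hv (h ▸ hu)
  ext y
  have cases : y = u ∨ y = v ∨ (y ∈ S ∧ y ≠ u) ∨ (y ∉ S ∧ y ≠ v ∧ g y ∈ S) ∨
      (y ∉ S ∧ y ≠ v ∧ g y ∉ S) := by tauto
  simp only [missed, mem_ofPred_eq]
  rcases cases with rfl | rfl | ⟨h1, h2⟩ | ⟨h1, h2, h3⟩ | ⟨h1, h2, h3⟩
  · rw [mix_left]; simp [hne.symm, hu]
  · rw [mix_right hne]; simp [hne]
  · rw [mix_of_mem hv h1 h2]; simp [hS y h1 h2, h1]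
  · rw [mix_of_free hu h1 h2 h3]; simp [*]
  · rw [mix_of_notMem hu h1 h2 h3]; simp [*]

/-- The matching `mix S u v f g` has as many edges as `g` if `g` has an edge leaving `S`. -/
theorem ncard_missed_mix [Finite V] (hg : IsMatch H g) (hu : u ∈ S) (hv : v ∉ S)
    (hgv : g v = v) (hS : ∀ y ∈ S, y ≠ u → f y ≠ y) (hout : ∃! s, Out g S s) {w : V} (hw : w ∉ S)
    (hgw : g w ∈ S) : (missed (mix S u v f g)).ncard = (missed g).ncard := by
  have how : Out g S (g w) := ⟨hgw, .inr (by rwa [hg.invol])⟩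
  have hwm : w ∉ missed g := fun h => hw (by have : g w = w := h; rwa [← this])
  -- The only vertex of `S` that `g` leaves out is `g w`. So `g` misses no vertex of `S`, and `w`
  -- alone loses its partner outside: `v` becomes matched and `w` becomes free.
  have heq : missed (mix S u v f g) = insert w (missed g \ {v}) := by
    rw [missed_mix hu hv hgv hS]
    ext y
    simp only [missed, mem_ofPred_eq, mem_insert_iff, mem_sdiff, mem_singleton_iff]
    constructor
    · rintro ⟨h1, h2, h3 | h3⟩
      · left
        have := hout.unique how ⟨h3, .inr (by rwa [hg.invol])⟩
        rw [← hg.invol w, this, hg.invol]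
      · exact .inr ⟨h3, h2⟩
    · rintro (rfl | ⟨h1, h2⟩)
      · exact ⟨hw, fun h => hw (by rw [h, hgv] at hgw; exact absurd hgw hv), .inl hgw⟩
      · refine ⟨fun hy => hw ?_, h2, .inr h1⟩
        have := hout.unique how ⟨hy, .inl h1⟩
        rw [← this, hg.invol] at h1
        rwa [h1]
  rw [heq, ncard_insert_of_notMem (fun h => hwm h.1) (toFinite _),
    ncard_sdiff_singleton_add_one (show v ∈ missed g from hgv) (toFinite _)]

/-- The matching `mix S u v f g` has more edges than `g` if `g` has no edge leaving `S`. -/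
theorem ncard_missed_mix_lt [Finite V] (hu : u ∈ S) (hv : v ∉ S)
    (hgv : g v = v) (hS : ∀ y ∈ S, y ≠ u → f y ≠ y) (hout : ∀ w, w ∉ S → g w ∉ S) :
    (missed (mix S u v f g)).ncard < (missed g).ncard := by
  refine ncard_lt_ncard ?_ (toFinite _)
  rw [missed_mix hu hv hgv hS]
  refine ⟨fun y hy => ?_, fun hss => (hss (show v ∈ missed g from hgv)).2.1 rfl⟩
  rcases hy.2.2 with h | h
  · exact absurd h (hout y hy.1)
  · exact h

end mix

/-- Two disjoint sets with one unmatched vertex each, joined by a vertex -/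
theorem existsUnique_out_union {f : V → V} (hf : ∀ x, f (f x) = x) {A B : Set V} {w : V}
    (hAB : ∀ y ∈ A, y ∉ B) (hwA : w ∉ A) (hwB : w ∉ B) (hfw : f w ∈ A) (hA : ∃! s, Out f A s)
    (hB : ∃! s, Out f B s) : ∃! s, Out f (A ∪ {w} ∪ B) s := by
  obtain ⟨k, hk, hku⟩ := hB
  have how : Out f A (f w) := ⟨hfw, .inr (by rwa [hf])⟩
  have hkA : k ∉ A := fun h => hAB k h hk.1
  refine ⟨k, ⟨.inr hk.1, ?_⟩, ?_⟩
  · rcases hk.2 with h | h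
    · exact .inl h
    · right
      rintro ((h1 | h1) | h1)
      · have := hA.unique how ⟨h1, .inr (by rwa [hf])⟩
        exact hwB (by rw [← hf w, this, hf]; exact hk.1)
      · have h2 : f w = k := by rw [← show f k = w from h1, hf]
        exact hkA (h2 ▸ hfw)
      · exact h h1
  · rintro t ⟨(ht | ht) | ht, h2⟩
    · by_cases h3 : t = f w
      · subst h3
        rw [hf] at h2
        rcases h2 with h2 | h2
        · exact absurd (h2 ▸ hfw) hwA
        · exact absurd (.inl (.inr rfl)) h2
      · have := not_out ht fun ho => h3 (hA.unique ho how)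
        rcases h2 with h2 | h2
        · exact absurd h2 this.1
        · exact absurd (.inl (.inl this.2)) h2
    · obtain rfl : t = w := ht
      rcases h2 with h2 | h2
      · exact absurd (h2 ▸ hfw) hwA
      · exact absurd (.inl (.inl hfw)) h2
    · refine hku t ⟨ht, h2.imp_right fun h3 h4 => h3 (.inr h4)⟩

/-! ### Growing the alternating forest -/

namespace IsForest

variable {d : ℕ} {D I : Set V} {cl : V → V → Prop} {N : V → V → V}

/-- Extend the forest by an edge `v u` and the matching edge of `u`. -/
theorem grow [Finite V] (h : IsForest H d D I cl N) {u v : V} (hv : v ∈ D) (huv : H.Adj v u)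
    (huD : u ∉ D) (huI : u ∉ I) {N' : V → V → V} (hN : ∀ x ∈ D, N' x = N x)
    (hN' : N' (N v u) = mix {u} u v (N v) (N v)) :
    N v u ∉ D ∧ IsForest H d (D ∪ {N v u}) (I ∪ {u})
      (fun k l => cl k l ∨ (k = N v u ∧ l = N v u)) N' := by
  set r := N v u with hr
  have hm := h.isMatch v hv
  have hvv := h.self v hv
  have hvr : N v r = u := hm.invol u
  -- Missed vertices are outer, so `u` is matched.
  have hru : r ≠ u := fun he => huD (h.missed_mem v hv u he)
  have hrD : r ∉ D := fun hrD => by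
    rcases h.outer v hv r hrD with h1 | h1
    · exact huI (hvr ▸ h1)
    · rw [hvr] at h1
      exact huD (h.mem _ _ (h.symm _ _ h1))
  have hrI : r ∉ I := fun hrI => huD (hvr ▸ h.inner v hv r hrI)
  have hvu : v ≠ u := huv.ne
  have hxu : ∀ x ∈ D, N x u = r := fun x hx => h.rest x hx v hv u huD huI
  have hvr' : v ≠ r := fun he => hrD (he ▸ hv)
  have hvS : v ∉ ({u} : Set V) := hvu
  -- The matching for `r` is `N v` with the edge `u r` exchanged for `v u`.
  have n1 : N' r u = v := by rw [hN', mix_left]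
  have n2 : N' r v = u := by rw [hN', mix_right hvu.symm]
  have n3 : N' r r = r := by rw [hN', mix_of_free (S := {u}) rfl hru hvr'.symm hvr]
  have n4 : ∀ y, y ≠ u → y ≠ v → y ≠ r → N' r y = N v y := fun y h1 h2 h3 => by
    rw [hN', mix_of_notMem (S := {u}) rfl h1 h2]
    exact fun h4 => h3 (by rw [← hm.invol y, show N v y = u from h4])
  have hout : ∃! s, Out (N v) {u} s := ⟨u, ⟨rfl, .inr hru⟩, fun s hs => hs.1⟩
  have hclD : ∀ k l, cl k l → l ∈ D := fun k l hkl => h.mem _ _ (h.symm _ _ hkl)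
  have hcl1 : ∀ k ∈ D, {l | cl k l ∨ (k = r ∧ l = r)} = {l | cl k l} := fun k hk => by
    ext l
    simp [show k ≠ r from fun he => hrD (he ▸ hk)]
  have hcl2 : {l | cl r l ∨ (r = r ∧ l = r)} = {r} := by
    ext l
    simp [show ¬ cl r l from fun hl => hrD (h.mem _ _ hl)]
  have hIne : ∀ w ∈ I, w ≠ u ∧ w ≠ v ∧ w ≠ r := fun w hw =>
    ⟨fun he => huI (he ▸ hw), fun he => h.disj w hw (he ▸ hv), fun he => hrI (he ▸ hw)⟩
  refine ⟨hrD, ?_, ?_, ?_, ?_, ?_, ?_, ?_, ?_, ?_, ?_, ?_, ?_, ?_, ?_⟩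
  · rintro x (hx | rfl)
    · rw [hN x hx]; exact h.isMatch x hx
    · rw [hN']
      exact isMatch_mix hm hm rfl hvS huv hvv fun y hy hyu => absurd hy hyu
  · rintro x (hx | rfl)
    · rw [hN x hx]; exact h.self x hx
    · exact n3
  · rintro x (hx | rfl)
    · rw [hN x hx]; exact h.size x hx
    · rw [hN', ncard_missed_mix (S := {u}) (u := u) hm rfl hvS hvv (fun y hy hyu => absurd hy hyu) hout
        (w := r) hru hvr, h.size v hv]
  · rintro x (hx | rfl) y hy
    · rw [hN x hx] at hy; exact .inl (h.missed_mem x hx y hy)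
    · by_cases h1 : y = u
      · rw [h1, n1] at hy; exact absurd hy hvu
      by_cases h2 : y = v
      · rw [h2, n2] at hy; exact absurd hy.symm hvu
      by_cases h3 : y = r
      · exact .inr h3
      · rw [n4 y h1 h2 h3] at hy; exact .inl (h.missed_mem v hv y hy)
  · rintro w (hw | rfl) (h1 | h1)
    · exact h.disj w hw h1
    · exact hrI ((show w = r from h1) ▸ hw)
    · exact huD h1
    · exact hru (show w = r from h1).symm
  · rintro x (hx | rfl) w (hw | rfl)
    · rw [hN x hx]; exact .inl (h.inner x hx w hw)
    · rw [hN x hx, hxu x hx]; exact .inr rfl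
    · rw [n4 w (hIne w hw).1 (hIne w hw).2.1 (hIne w hw).2.2]
      exact .inl (h.inner v hv w hw)
    · rw [n1]; exact .inl hv
  · have key : ∀ x ∈ D ∪ {r}, ∀ y, y ∉ D ∪ {r} → y ∉ I ∪ {u} → N' x y = N v y := by
      rintro x (hx | rfl) y hy hyI
      · rw [hN x hx]
        exact h.rest x hx v hv y (fun h1 => hy (.inl h1)) (fun h1 => hyI (.inl h1))
      · exact n4 y (fun h1 => hyI (.inr h1)) (fun h1 => hy (.inl (h1 ▸ hv)))
          (fun h1 => hy (.inr h1))
    intro x hx y hy z hz hz'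
    rw [key x hx z hz hz', key y hy z hz hz']
  · rintro x (hx | rfl) k (hk | rfl)
    · rw [hN x hx]
      exact (h.outer x hx k hk).imp .inl .inl
    · rw [hN x hx, show N x r = u by rw [← hxu x hx, (h.isMatch x hx).invol]]
      exact .inl (.inr rfl)
    · by_cases hkv : k = v
      · rw [hkv, n2]; exact .inl (.inr rfl)
      · rw [n4 k (fun h1 => huD (h1 ▸ hk)) hkv (fun h1 => hrD (h1 ▸ hk))]
        exact (h.outer v hv k hk).imp .inl .inl
    · exact .inr (.inr ⟨rfl, n3⟩)
  · rintro k (hk | rfl)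
    · exact .inl (h.refl k hk)
    · exact .inr ⟨rfl, rfl⟩
  · rintro k l (hkl | ⟨h1, h2⟩)
    · exact .inl (h.symm _ _ hkl)
    · exact .inr ⟨h2, h1⟩
  · rintro k l m (h1 | ⟨h1, h2⟩) (h3 | ⟨h3, h4⟩)
    · exact .inl (h.trans _ _ _ h1 h3)
    · exact absurd (h3 ▸ hclD _ _ h1) hrD
    · exact absurd (h2 ▸ h.mem _ _ h3) hrD
    · exact .inr ⟨h1, h4⟩
  · rintro k l (hkl | ⟨h1, -⟩)
    · exact .inl (h.mem _ _ hkl)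
    · exact .inr h1
  · rintro x (hx | rfl) k (hk | rfl)
    · rw [hcl1 k hk, hN x hx]; exact h.out x hx k hk
    · rw [hcl2]
      refine ⟨r, ⟨rfl, .inr ?_⟩, fun s hs => hs.1⟩
      rw [hN x hx, show N x r = u by rw [← hxu x hx, (h.isMatch x hx).invol]]
      exact hru.symm
    · rw [hcl1 k hk]
      have : ∀ s, Out (N' r) {l | cl k l} s ↔ Out (N v) {l | cl k l} s := fun s => by
        refine and_congr_right fun hs => ?_
        have hsD : s ∈ D := hclD _ _ hs
        by_cases hsv : s = v
        · rw [hsv, n2, hvv]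
          simp only [true_or, iff_true]
          exact .inr fun h1 => huD (hclD _ _ h1)
        · rw [n4 s (fun h1 => huD (h1 ▸ hsD)) hsv (fun h1 => hrD (h1 ▸ hsD))]
      simpa only [this] using h.out v hv k hk
    · rw [hcl2]
      exact ⟨r, ⟨rfl, .inl n3⟩, fun s hs => hs.1⟩
  · rintro w (hw | rfl)
    · obtain ⟨a, b, hab⟩ := h.two w hw
      refine ⟨a, b, ?_⟩
      rintro x (hx | rfl)
      · rw [hN x hx]; exact hab x hx
      · rw [n4 w (hIne w hw).1 (hIne w hw).2.1 (hIne w hw).2.2]; exact hab v hv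
    -- The new inner vertex is matched to its child `r` in all the old matchings, and to its parent
    -- `v` in the one that misses `r`.
    · refine ⟨r, v, ?_⟩
      rintro x (hx | rfl)
      · rw [hN x hx]; exact .inl (hxu x hx)
      · exact .inr n1

end IsForest

/-! ### Petals, blossoms and augmentation -/

/-- A union of blossoms and inner vertices that can be part of a larger blossom -/
structure IsPetal (D I : Set V) (cl : V → V → Prop) (N : V → V → V) (S : Set V) : Prop where
  sub : ∀ y ∈ S, y ∈ D ∨ y ∈ I
  sat : ∀ y z, y ∈ S → cl y z → z ∈ S
  inner : ∀ x ∈ D, ∀ w ∈ S, w ∈ I → N x w ∈ S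
  out : ∀ x ∈ D, ∃! s, Out (N x) S s

namespace IsForest

variable {d : ℕ} {D I : Set V} {cl : V → V → Prop} {N : V → V → V}

theorem isPetal_class (h : IsForest H d D I cl N) {u : V} (hu : u ∈ D) :
    IsPetal D I cl N {l | cl u l} where
  sub _ hy := .inl (h.mem _ _ (h.symm _ _ hy))
  sat _ _ hy hyz := h.trans _ _ _ hy hyz
  inner _ _ w hw hwI := absurd (h.mem _ _ (h.symm _ _ hw)) (h.disj w hwI)
  out x hx := h.out x hx u hu

section petal

variable {S : Set V} {u v w : V}

/-- The only vertex of a petal with `u` that `N u` does not match within the petal is `u`. -/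
theorem eq_of_out (h : IsForest H d D I cl N) (hS : IsPetal D I cl N S) (hu : u ∈ D) (huS : u ∈ S)
    {s : V} (hs : Out (N u) S s) : s = u :=
  (hS.out u hu).unique hs ⟨huS, .inl (h.self u hu)⟩

theorem out_of_notMem (h : IsForest H d D I cl N) (hv : v ∈ D) (hw : w ∉ S) (hvw : N v w ∈ S) :
    Out (N v) S (N v w) := ⟨hvw, .inr (by rwa [(h.isMatch v hv).invol])⟩

/-- A petal contains the partners of its inner vertices, and an outer vertex is matched to an inner
vertex or within its blossom. Hence a matching edge can leave a petal only from an outer to an inner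
vertex. -/
theorem mem_inner (h : IsForest H d D I cl N) (hS : IsPetal D I cl N S) (hv : v ∈ D)
    (hw : w ∉ S) (hvw : N v w ∈ S) : w ∈ I := by
  have hi : N v (N v w) = w := (h.isMatch v hv).invol w
  rcases hS.sub _ hvw with h1 | h1
  · rcases h.outer v hv _ h1 with h2 | h2
    · rwa [hi] at h2
    · rw [hi] at h2
      exact absurd (hS.sat _ _ hvw h2) hw
  · have := hS.inner v hv _ hvw h1
    rw [hi] at this
    exact absurd this hw

/-- By `IsForest.two`, each stored matching gives `w` the partner `N v w`, which lies in `S`, or the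
partner `N u w`, which does not. Either way the edge at `w` uses up the left-out vertex of `S` or
that of the blossom of `N u w`, and the other one remains the only left-out vertex of the union. -/
theorem isPetal_extend (h : IsForest H d D I cl N) (hS : IsPetal D I cl N S) (hu : u ∈ D)
    (hv : v ∈ D) (huS : u ∈ S) (hw : w ∉ S) (hvw : N v w ∈ S) :
    IsPetal D I cl N (S ∪ {w} ∪ {l | cl (N u w) l}) := by
  have hwI := h.mem_inner hS hv hw hvw
  have hwD := h.disj w hwI
  have hD : N u w ∈ D := h.inner u hu w hwI
  have hclD : ∀ k l, cl k l → l ∈ D := fun k l hkl => h.mem _ _ (h.symm _ _ hkl)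
  -- In `S` the matching `N u` leaves out only `u`, which it misses, so none of its edges leaves
  -- `S`.
  have hnS : N u w ∉ S := fun hn => hw (by
    have h1 := h.eq_of_out hS hu huS (h.out_of_notMem hu hw hn)
    rw [← (h.isMatch u hu).invol w, h1, h.self u hu]
    exact huS)
  have hdis : ∀ y ∈ S, y ∉ {l | cl (N u w) l} := fun y hy hcl =>
    hnS (hS.sat _ _ hy (h.symm _ _ hcl))
  have hwK : w ∉ {l | cl (N u w) l} := fun hcl => hwD (hclD _ _ hcl)
  have htwo : ∀ x ∈ D, N x w = N v w ∨ N x w = N u w := by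
    obtain ⟨a, b, hab⟩ := h.two w hwI
    intro x hx
    have h4 : N v w ≠ N u w := fun he => hnS (he ▸ hvw)
    rcases hab x hx with h1 | h1 <;> rcases hab u hu with h2 | h2 <;>
      rcases hab v hv with h3 | h3 <;> rw [h1, h2, h3] <;> simp
    all_goals exact absurd (h3.trans h2.symm) h4
  refine ⟨?_, ?_, ?_, ?_⟩
  · rintro y ((hy | rfl) | hy)
    · exact hS.sub y hy
    · exact .inr hwI
    · exact .inl (hclD _ _ hy)
  · rintro y z ((hy | rfl) | hy) hyz
    · exact .inl (.inl (hS.sat _ _ hy hyz))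
    · exact absurd (h.mem _ _ hyz) hwD
    · exact .inr (h.trans _ _ _ hy hyz)
  · rintro x hx y ((hy | rfl) | hy) hyI
    · exact .inl (.inl (hS.inner x hx y hy hyI))
    · rcases htwo x hx with he | he <;> rw [he]
      · exact .inl (.inl hvw)
      · exact .inr (h.refl _ hD)
    · exact absurd (hclD _ _ hy) (h.disj y hyI)
  · intro x hx
    have hi := (h.isMatch x hx).invol
    rcases htwo x hx with he | he
    · exact existsUnique_out_union hi hdis hw hwK (he ▸ hvw) (hS.out x hx) (h.out x hx _ hD)
    · have := existsUnique_out_union hi (fun y hy hy' => hdis y hy' hy) hwK hw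
        (by rw [he]; exact h.refl _ hD) (h.out x hx _ hD) (hS.out x hx)
      rwa [union_right_comm, union_comm _ S, union_right_comm] at this

/-- The matching `N u` matches the vertices of a petal other than `u` within the petal. -/
theorem petal_matching (h : IsForest H d D I cl N) (hS : IsPetal D I cl N S) (hu : u ∈ D)
    (huS : u ∈ S) (y : V) (hy : y ∈ S) (hyu : y ≠ u) :
    N u y ∈ S ∧ N u y ≠ u ∧ N u y ≠ y := by
  have := not_out hy fun ho => hyu (h.eq_of_out hS hu huS ho)
  exact ⟨this.2, fun he => hyu (by rw [← (h.isMatch u hu).invol y, he, h.self u hu]), this.1⟩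

/-- The properties of the matchings that miss the inner vertices of a blossom -/
theorem mix_petal [Finite V] (h : IsForest H d D I cl N) (hS : IsPetal D I cl N S) (hu : u ∈ D)
    (hv : v ∈ D) (hvS : v ∈ S) (huv : H.Adj v u) {T : Set V} (hT : IsPetal D I cl N T)
    (huT : u ∈ T) (hvT : v ∉ T) (hTS : T ⊆ S) (hw : w ∉ T) (hwS : w ∈ S) (hvw : N v w ∈ T) :
    IsMatch H (mix T u v (N u) (N v)) ∧ mix T u v (N u) (N v) w = w ∧
    (missed (mix T u v (N u) (N v))).ncard = d ∧
    (∀ y, y ∉ S → mix T u v (N u) (N v) y = N v y) ∧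
    (∀ y ∈ S, mix T u v (N u) (N v) y ∈ S) ∧
    (∀ y ∈ S, mix T u v (N u) (N v) y = y → y = w) := by
  have hmu := h.isMatch u hu
  have hmv := h.isMatch v hv
  have hvv := h.self v hv
  have hpet := h.petal_matching hT hu huT
  have hne : u ≠ v := huv.ne'
  have hwv : w ≠ v := fun he => hvT (by rw [he, hvv] at hvw; exact hvw)
  -- `N v` has only one edge across the boundary of `T`.
  have huniq : ∀ y, y ∉ T → N v y ∈ T → y = w := fun y hy hy' => by
    have := (hT.out v hv).unique (h.out_of_notMem hv hy hy') (h.out_of_notMem hv hw hvw)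
    rw [← hmv.invol y, this, hmv.invol]
  refine ⟨?_, ?_, ?_, ?_, ?_, ?_⟩
  · exact isMatch_mix hmu hmv huT hvT huv hvv fun y hy hyu => ⟨(hpet y hy hyu).1, (hpet y hy hyu).2.1⟩
  · exact mix_of_free huT hw hwv hvw
  · rw [ncard_missed_mix hmv huT hvT hvv (fun y hy hyu => (hpet y hy hyu).2.2) (hT.out v hv) hw hvw,
      h.size v hv]
  · intro y hy
    refine mix_of_notMem huT (fun h1 => hy (hTS h1)) (fun h1 => hy (h1 ▸ hvS)) fun h1 => ?_
    exact hy (huniq y (fun h1 => hy (hTS h1)) h1 ▸ hwS)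
  · intro y hy
    by_cases h1 : y = u
    · rw [h1, mix_left]; exact hvS
    by_cases h2 : y = v
    · rw [h2, mix_right hne]; exact hTS huT
    by_cases h3 : y ∈ T
    · rw [mix_of_mem hvT h3 h1]; exact hTS (hpet y h3 h1).1
    by_cases h4 : N v y ∈ T
    · rw [mix_of_free huT h3 h2 h4]; exact hy
    · rw [mix_of_notMem huT h3 h2 h4]
      exact (h.petal_matching hS hv hvS y hy h2).1
  · intro y hy he
    by_cases h1 : y = u
    · rw [h1, mix_left] at he; exact absurd he.symm hne
    by_cases h2 : y = v
    · rw [h2, mix_right hne] at he; exact absurd he hne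
    by_cases h3 : y ∈ T
    · rw [mix_of_mem hvT h3 h1] at he; exact absurd he (hpet y h3 h1).2.2
    by_cases h4 : N v y ∈ T
    · exact huniq y h3 h4
    · rw [mix_of_notMem huT h3 h2 h4] at he
      exact absurd he (h.petal_matching hS hv hvS y hy h2).2.2

/-- Shrink a petal to a blossom. -/
theorem shrink (h : IsForest H d D I cl N) (hS : IsPetal D I cl N S)
    (hv : v ∈ D) {N' : V → V → V} (hN : ∀ x ∈ D, N' x = N x)
    (hN' : ∀ w ∈ S, w ∈ I → IsMatch H (N' w) ∧ N' w w = w ∧ (missed (N' w)).ncard = d ∧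
      (∀ y, y ∉ S → N' w y = N v y) ∧ (∀ y ∈ S, N' w y ∈ S) ∧ ∀ y ∈ S, N' w y = y → y = w) :
    IsForest H d (D ∪ S) (I \ S) (fun k l => cl k l ∨ (k ∈ S ∧ l ∈ S)) N' := by
  have hclD : ∀ k l, cl k l → l ∈ D := fun k l hkl => h.mem _ _ (h.symm _ _ hkl)
  have hcase : ∀ x ∈ D ∪ S, x ∈ D ∨ (x ∈ S ∧ x ∈ I) := by
    rintro x (hx | hx)
    · exact .inl hx
    · exact (hS.sub x hx).imp_right fun h1 => ⟨hx, h1⟩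
  have hc1 : ∀ k ∈ S, {l | cl k l ∨ (k ∈ S ∧ l ∈ S)} = S := fun k hk => by
    ext l
    exact ⟨fun h1 => h1.elim (hS.sat k l hk) fun h2 => h2.2, fun h1 => .inr ⟨hk, h1⟩⟩
  have hc2 : ∀ k, k ∉ S → {l | cl k l ∨ (k ∈ S ∧ l ∈ S)} = {l | cl k l} := fun k hk => by
    ext l
    simp [hk]
  have houter : ∀ x ∈ D, ∀ k ∈ D ∪ S, N x k ∈ I \ S ∨ (cl k (N x k) ∨ (k ∈ S ∧ N x k ∈ S)) := by
    intro x hx k hk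
    by_cases hkS : k ∈ S
    · by_cases h1 : N x k ∈ S
      · exact .inr (.inr ⟨hkS, h1⟩)
      · rcases hcase k hk with hkD | ⟨-, hkI⟩
        · exact (h.outer x hx k hkD).imp (fun h2 => ⟨h2, h1⟩) .inl
        · exact absurd (hS.inner x hx k hkS hkI) h1
    · have hkD := hk.resolve_right hkS
      refine (h.outer x hx k hkD).imp (fun h2 => ⟨h2, fun h3 => hkS ?_⟩) .inl
      have := hS.inner x hx _ h3 h2
      rwa [(h.isMatch x hx).invol] at this
  refine ⟨?_, ?_, ?_, ?_, ?_, ?_, ?_, ?_, ?_, ?_, ?_, ?_, ?_, ?_⟩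
  · intro x hx
    rcases hcase x hx with hx | ⟨h1, h2⟩
    · rw [hN x hx]; exact h.isMatch x hx
    · exact (hN' x h1 h2).1
  · intro x hx
    rcases hcase x hx with hx | ⟨h1, h2⟩
    · rw [hN x hx]; exact h.self x hx
    · exact (hN' x h1 h2).2.1
  · intro x hx
    rcases hcase x hx with hx | ⟨h1, h2⟩
    · rw [hN x hx]; exact h.size x hx
    · exact (hN' x h1 h2).2.2.1
  · intro x hx y hy
    rcases hcase x hx with hx | ⟨h1, h2⟩
    · rw [hN x hx] at hy; exact .inl (h.missed_mem x hx y hy)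
    · by_cases hyS : y ∈ S
      · exact .inr hyS
      · rw [(hN' x h1 h2).2.2.2.1 y hyS] at hy
        exact .inl (h.missed_mem v hv y hy)
  · rintro w ⟨h1, h2⟩ (h3 | h3)
    · exact h.disj w h1 h3
    · exact h2 h3
  · rintro x hx w ⟨hw, hwS⟩
    rcases hcase x hx with hx | ⟨h1, h2⟩
    · rw [hN x hx]; exact .inl (h.inner x hx w hw)
    · rw [(hN' x h1 h2).2.2.2.1 w hwS]
      exact .inl (h.inner v hv w hw)
  · have key : ∀ x ∈ D ∪ S, ∀ r, r ∉ D ∪ S → r ∉ I \ S → N' x r = N v r := by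
      intro x hx r hr hrI
      have hrS : r ∉ S := fun h1 => hr (.inr h1)
      rcases hcase x hx with hx | ⟨h1, h2⟩
      · rw [hN x hx]
        exact h.rest x hx v hv r (fun h1 => hr (.inl h1)) fun h1 => hrI ⟨h1, hrS⟩
      · exact (hN' x h1 h2).2.2.2.1 r hrS
    intro x hx y hy r hr hrI
    rw [key x hx r hr hrI, key y hy r hr hrI]
  · intro x hx k hk
    rcases hcase x hx with hx | ⟨h1, h2⟩
    · rw [hN x hx]; exact houter x hx k hk
    · by_cases hkS : k ∈ S
      · exact .inr (.inr ⟨hkS, (hN' x h1 h2).2.2.2.2.1 k hkS⟩)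
      · rw [(hN' x h1 h2).2.2.2.1 k hkS]
        exact houter v hv k hk
  · rintro k (hk | hk)
    · exact .inl (h.refl k hk)
    · exact .inr ⟨hk, hk⟩
  · rintro k l (hkl | ⟨h1, h2⟩)
    · exact .inl (h.symm _ _ hkl)
    · exact .inr ⟨h2, h1⟩
  · rintro k l m (h1 | ⟨h1, h2⟩) (h3 | ⟨h3, h4⟩)
    · exact .inl (h.trans _ _ _ h1 h3)
    · exact .inr ⟨hS.sat _ _ h3 (h.symm _ _ h1), h4⟩
    · exact .inr ⟨h1, hS.sat _ _ h2 h3⟩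
    · exact .inr ⟨h1, h4⟩
  · rintro k l (hkl | ⟨h1, -⟩)
    · exact .inl (h.mem _ _ hkl)
    · exact .inr h1
  · intro x hx k hk
    by_cases hkS : k ∈ S
    · rw [hc1 k hkS]
      rcases hcase x hx with hx | ⟨h1, h2⟩
      · rw [hN x hx]; exact hS.out x hx
      · obtain ⟨-, a2, -, -, a5, a6⟩ := hN' x h1 h2
        refine ⟨x, ⟨h1, .inl a2⟩, ?_⟩
        rintro y ⟨hy, h3 | h3⟩
        · exact a6 y hy h3
        · exact absurd (a5 y hy) h3
    · rw [hc2 k hkS]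
      have hkD := hk.resolve_right hkS
      rcases hcase x hx with hx | ⟨h1, h2⟩
      · rw [hN x hx]; exact h.out x hx k hkD
      · have : ∀ s, Out (N' x) {l | cl k l} s ↔ Out (N v) {l | cl k l} s := fun s => by
          refine and_congr_right fun hs => ?_
          rw [(hN' x h1 h2).2.2.2.1 s fun hsS => hkS (hS.sat _ _ hsS (h.symm _ _ hs))]
        simpa only [this] using h.out v hv k hkD
  · rintro w ⟨hw, hwS⟩
    obtain ⟨a, b, hab⟩ := h.two w hw
    refine ⟨a, b, fun x hx => ?_⟩
    rcases hcase x hx with hx | ⟨h1, h2⟩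
    · rw [hN x hx]; exact hab x hx
    · rw [(hN' x h1 h2).2.2.2.1 w hwS]; exact hab v hv

/-- The state of the search for a blossom through the edge `v u` -/
structure IsSearch (h : IsForest H d D I cl N) (u v : V) (S : Set V) (N' : V → V → V) : Prop where
  petal : IsPetal D I cl N S
  mem : u ∈ S
  old : ∀ x ∈ D, N' x = N x
  new : ∀ w ∈ S, w ∈ I → ∃ T, IsPetal D I cl N T ∧ u ∈ T ∧ v ∉ T ∧ T ⊆ S ∧ w ∉ T ∧ N v w ∈ T ∧
    N' w = mix T u v (N u) (N v)

theorem isSearch_initial (h : IsForest H d D I cl N) (hu : u ∈ D) :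
    h.IsSearch u v {l | cl u l} N where
  petal := h.isPetal_class hu
  mem := h.refl u hu
  old _ _ := rfl
  new w hw hwI := absurd (h.mem _ _ (h.symm _ _ hw)) (h.disj w hwI)

theorem IsSearch.notMem {h : IsForest H d D I cl N} {N' : V → V → V} (hs : h.IsSearch u v S N')
    (hv : v ∈ D) (hw : w ∉ S) (hvw : N v w ∈ S) : v ∉ S := fun hvS => hw (by
  have := h.eq_of_out hs.petal hv hvS (h.out_of_notMem hv hw hvw)
  rw [← (h.isMatch v hv).invol w, this, h.self v hv]
  exact hvS)

/-- The set `S` as it is before the extension becomes the witness `T` of the new vertex `w`. At that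
time `v` is outside, for otherwise `N v` would have no edge leaving `S`. -/
theorem IsSearch.extend {h : IsForest H d D I cl N} {N' N'' : V → V → V}
    (hs : h.IsSearch u v S N') (hu : u ∈ D) (hv : v ∈ D) (hw : w ∉ S) (hvw : N v w ∈ S)
    (h1 : N'' w = mix S u v (N u) (N v)) (h2 : ∀ x, x ≠ w → N'' x = N' x) :
    h.IsSearch u v (S ∪ {w} ∪ {l | cl (N u w) l}) N'' where
  petal := h.isPetal_extend hs.petal hu hv hs.mem hw hvw
  mem := .inl (.inl hs.mem)
  old x hx := by
    rw [h2 x fun he => h.disj w (h.mem_inner hs.petal hv hw hvw) (he ▸ hx), hs.old x hx]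
  new := by
    have hsub : S ⊆ S ∪ {w} ∪ {l | cl (N u w) l} := fun y hy => .inl (.inl hy)
    rintro y ((hy | rfl) | hy) hyI
    · obtain ⟨T, a1, a2, a3, a4, a5, a6, a7⟩ := hs.new y hy hyI
      exact ⟨T, a1, a2, a3, a4.trans hsub, a5, a6, by rw [h2 y fun he => hw (he ▸ hy), a7]⟩
    · exact ⟨S, hs.petal, hs.mem, hs.notMem hv hw hvw, hsub, hw, hvw, h1⟩
    · exact absurd (h.mem _ _ (h.symm _ _ hy)) (h.disj y hyI)

theorem IsSearch.shrink [Finite V] {h : IsForest H d D I cl N} {N' : V → V → V}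
    (hs : h.IsSearch u v S N') (hu : u ∈ D) (hv : v ∈ D) (huv : H.Adj v u) (hvS : v ∈ S) :
    IsForest H d (D ∪ S) (I \ S) (fun k l => cl k l ∨ (k ∈ S ∧ l ∈ S)) N' := by
  refine h.shrink hs.petal hv hs.old fun w hw hwI => ?_
  obtain ⟨T, a1, a2, a3, a4, a5, a6, a7⟩ := hs.new w hw hwI
  rw [a7]
  exact h.mix_petal hs.petal hu hv hvS huv a1 a2 a3 a4 a5 hw a6

/-- A blossom with `v` that starts from another class contains an inner vertex. -/
theorem IsSearch.exists_inner {h : IsForest H d D I cl N} {N' : V → V → V}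
    (hs : h.IsSearch u v S N') (hcl : ¬ cl u v) (hu : u ∈ D) (hv : v ∈ D) (hvS : v ∈ S) :
    ∃ w ∈ S, w ∉ D := by
  by_contra! hno
  -- Here `s` is the vertex of the blossom of `u` that `N v` leaves out. It is not `v`, so `N v`
  -- matches it within `S`. If `S` had only outer vertices, the partner would have to be in the same
  -- blossom, against the choice of `s`.
  obtain ⟨s, hs1, hs2⟩ := h.out v hv u hu
  have hsS : s ∈ S := hs.petal.sat _ _ hs.mem hs1.1
  by_cases hsv : s = v
  · exact hcl (hsv ▸ hs1.1)
  have h1 := h.petal_matching hs.petal hv hvS s hsS hsv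
  have h2 := hno _ h1.1
  rcases h.outer v hv s (hno s hsS) with h3 | h3
  · exact h.disj _ h3 h2
  · exact hs1.2.elim h1.2.2 fun h4 => h4 (h.trans _ _ _ hs1.1 h3)

/-- No edge of `N v` leaves `S`, so following `N u` inside `S` and adding the edge `v u` frees no
vertex outside, while it covers `v` and all of `S`. -/
theorem IsSearch.augment [Finite V] {h : IsForest H d D I cl N} {N' : V → V → V}
    (hs : h.IsSearch u v S N') (hu : u ∈ D) (hv : v ∈ D) (huv : H.Adj v u) (hvS : v ∉ S)
    (hout : ∀ w, w ∉ S → N v w ∉ S) :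
    IsMatch H (mix S u v (N u) (N v)) ∧ (missed (mix S u v (N u) (N v))).ncard < d := by
  have hpet := h.petal_matching hs.petal hu hs.mem
  refine ⟨isMatch_mix (h.isMatch u hu) (h.isMatch v hv) hs.mem hvS huv (h.self v hv)
    fun y hy hyu => ⟨(hpet y hy hyu).1, (hpet y hy hyu).2.1⟩, ?_⟩
  rw [← h.size v hv]
  exact ncard_missed_mix_lt hs.mem hvS (h.self v hv)
    (fun y hy hyu => (hpet y hy hyu).2.2) hout

end petal

end IsForest

end Matching

/-! ## Colourings -/

namespace Colour

open Function Set Matching SimpleGraph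

variable {V : Type}

/-- The subgraph of `G` that `W` induces is `(P₃ + K₁)`-free. -/
def FreeOn (G : SimpleGraph V) (W : Set V) : Prop :=
  ∀ x ∈ W, ∀ v ∈ W, ∀ y ∈ W, ∀ t ∈ W, G.Adj x v → G.Adj v y → x ≠ y → ¬ G.Adj x y →
    t ≠ x → t ≠ v → t ≠ y → ¬ G.Adj t x → ¬ G.Adj t v → ¬ G.Adj t y → False

theorem freeOn_of_p3K1Free {G : SimpleGraph V} {W : Set V} (h : P3K1Free (G.induce W)) :
    FreeOn G W := by
  intro x hx v hv y hy t ht hxv hvy hne hxy htx htv hty atx atv aty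
  let φ : Fin 3 ⊕ Fin 1 → W := Sum.elim ![⟨x, hx⟩, ⟨v, hv⟩, ⟨y, hy⟩] fun _ => ⟨t, ht⟩
  have hinj : Injective φ := by
    rintro (a | a) (b | b) he
    · fin_cases a <;> fin_cases b <;>
        simp_all [φ, hxv.ne, hxv.ne', hvy.ne, hvy.ne', hne.symm]
    · fin_cases a <;> simp_all [φ, eq_comm]
    · fin_cases b <;> simp_all [φ, eq_comm]
    · simp [Subsingleton.elim a b]
  have hadj : ∀ p q, (G.induce W).Adj (φ p) (φ q) ↔
      (pathGraph 3 ⊕g completeGraph (Fin 1)).Adj p q := by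
    rintro (a | a) (b | b)
    · fin_cases a <;> fin_cases b <;>
        simp [φ, pathGraph_adj, hxv, hxv.symm, hvy, hvy.symm, hxy, mt G.adj_symm hxy]
    · fin_cases a <;> simp [φ, mt G.adj_symm atx, mt G.adj_symm atv, mt G.adj_symm aty]
    · fin_cases b <;> simp [φ, atx, atv, aty]
    · simp [φ, Subsingleton.elim a b]
  exact h ⟨⟨⟨φ, hinj⟩, fun {p q} => hadj p q⟩⟩

/-! ### Removing a large independent set from a (P₃ + K₁)-free graph -/

/-- The subgraph of `G` that `W` induces has a proper colouring with `k` colours. -/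
def ColorableOn (G : SimpleGraph V) (W : Set V) (k : ℕ) : Prop :=
  ∃ (c : V → ℕ) (T : Finset ℕ), T.card = k ∧ (∀ x ∈ W, c x ∈ T) ∧
    ∀ x ∈ W, ∀ y ∈ W, G.Adj x y → c x ≠ c y

theorem colorableOn_of_colorable {G : SimpleGraph V} {W : Set V} {k : ℕ}
    (h : (G.induce W).Colorable k) : ColorableOn G W k := by
  classical
  obtain ⟨c⟩ := h
  refine ⟨fun x => if hx : x ∈ W then c ⟨x, hx⟩ else 0, Finset.range k, by simp, ?_, ?_⟩
  · intro x hx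
    simp [hx]
  · intro x hx y hy hxy
    simp only [hx, hy, dif_pos]
    exact fun he => c.valid (v := ⟨x, hx⟩) (w := ⟨y, hy⟩) (by simpa using hxy) (Fin.ext he)

theorem ColorableOn.mono {G : SimpleGraph V} {W W' : Set V} {k : ℕ} (h : ColorableOn G W k)
    (hW : W' ⊆ W) : ColorableOn G W' k := by
  obtain ⟨c, T, h1, h2, h3⟩ := h
  exact ⟨c, T, h1, fun x hx => h2 x (hW hx), fun x hx y hy => h3 x (hW hx) y (hW hy)⟩

theorem FreeOn.mono {G : SimpleGraph V} {W W' : Set V} (h : FreeOn G W) (hW : W' ⊆ W) :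
    FreeOn G W' := fun x hx v hv y hy t ht =>
  h x (hW hx) v (hW hv) y (hW hy) t (hW ht)

/-- The removal of a maximal independent set with at least three vertices from a
`(P₃ + K₁)`-free graph lowers the chromatic number. -/
theorem ColorableOn.diff {G : SimpleGraph V} {W S : Set V} {k : ℕ} (hfree : FreeOn G W)
    (hSW : S ⊆ W) (hS : ∀ x ∈ S, ∀ y ∈ S, ¬ G.Adj x y)
    (hmax : ∀ v ∈ W, v ∉ S → ∃ x ∈ S, G.Adj x v) {a : V} (ha : a ∈ S)
    (h3 : ∀ x y, ∃ z ∈ S, z ≠ x ∧ z ≠ y) (hc : ColorableOn G W k) :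
    ∃ l, k = l + 1 ∧ ColorableOn G (W \ S) l := by
  classical
  obtain ⟨c, T, hT, hcT, hcW⟩ := hc
  have hcompl : ∀ v ∈ W, ∀ x ∈ S, ∀ y ∈ S, x ≠ y → G.Adj x v → G.Adj y v →
      ∀ z ∈ S, G.Adj z v := by
    intro v hv x hx y hy hxy hxv hyv z hz
    by_contra hzv
    have hvS : v ∉ S := fun hvS => hS x hx v hvS hxv
    refine hfree x (hSW hx) v hv y (hSW hy) z (hSW hz) hxv hyv.symm hxy (hS x hx y hy) ?_ ?_ ?_
      (hS z hz x hx) hzv (hS z hz y hy)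
    · rintro rfl; exact hzv hxv
    · rintro rfl; exact hvS hz
    · rintro rfl; exact hzv hyv
  have : Nonempty V := ⟨a⟩
  choose! p hpS hpv using hmax
  have haW := hSW ha
  -- Outside `S`, a vertex `u` of colour `c a` is to receive the colour of `p u`. It is not adjacent
  -- to `a`, so `p u` is its only neighbour in `S`. If its neighbour `v` were not adjacent to `p u`,
  -- then `u`, `v`, `p v` would be an induced path, and a third vertex `t` of `S` would have no edge
  -- to it: an edge `t v` would make `v` adjacent to all of `S`.
  have key : ∀ u ∈ W, u ∉ S → ∀ v ∈ W, v ∉ S → G.Adj u v → c u = c a → c (p u) ≠ c v := by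
    intro u hu huS v hv hvS huv hua
    refine hcW _ (hSW (hpS u hu huS)) v hv ?_
    by_contra hxv
    have hone : ∀ y ∈ S, y ≠ p u → ¬ G.Adj y u := fun y hy hne hyu =>
      hcW a haW u hu (hcompl u hu y hy _ (hpS u hu huS) hne hyu (hpv u hu huS) a ha) hua.symm
    have hy := hpS v hv hvS
    have hyv := hpv v hv hvS
    have hne : p v ≠ p u := fun he => hxv (he ▸ hyv)
    obtain ⟨t, ht, htx, hty⟩ := h3 (p u) (p v)
    refine hfree u hu v hv (p v) (hSW hy) t (hSW ht) huv hyv.symm (fun he => huS (he ▸ hy))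
      (fun h => hone _ hy hne h.symm) (fun he => huS (he ▸ ht)) (fun he => hvS (he ▸ ht)) hty
      (hone t ht htx) (fun htv => hxv ?_) (hS t ht _ hy)
    exact hcompl v hv t ht _ hy hty htv hyv _ (hpS u hu huS)
  refine ⟨(T.erase (c a)).card, ?_, fun v => if c v = c a then c (p v) else c v, T.erase (c a), rfl,
    ?_, ?_⟩
  · rw [Finset.card_erase_add_one (hcT a haW), hT]
  · rintro x ⟨hx, hxS⟩
    dsimp only
    split_ifs with hxa
    · refine Finset.mem_erase.2 ⟨?_, hcT _ (hSW (hpS x hx hxS))⟩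
      rw [← hxa]
      exact hcW _ (hSW (hpS x hx hxS)) x hx (hpv x hx hxS)
    · exact Finset.mem_erase.2 ⟨hxa, hcT x hx⟩
  · rintro x ⟨hx, hxS⟩ y ⟨hy, hyS⟩ hxy
    simp only
    split_ifs with h1 h2 h2
    · exact absurd (h1.trans h2.symm) (hcW x hx y hy hxy)
    · exact key x hx hxS y hy hyS hxy h1
    · exact (key y hy hyS x hx hxS hxy.symm h2).symm
    · exact hcW x hx y hy hxy

/-! ### The invariant of the greedy phase -/

/-- `E` partitions the complement of `U` into `r` colour classes that were chosen greedily. -/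
structure IsGreedy (G : SimpleGraph V) (U : Set V) (E : V → V → Prop) (r : ℕ) : Prop where
  colours : ∃ f : V → ℕ, (∀ x, x ∉ U → f x < r) ∧
    (∀ x, x ∉ U → ∀ y, y ∉ U → (E x y ↔ f x = f y))
  notMem : ∀ x y, E x y → x ∉ U ∧ y ∉ U
  proper : ∀ x y, E x y → ¬ G.Adj x y
  bound : ∀ (M : Set V) (k : ℕ), FreeOn G Mᶜ → ColorableOn G Mᶜ k →
    ∃ l, ColorableOn G (U \ M) l ∧ r + l + (M ∩ U).ncard ≤ k + M.ncard

theorem isGreedy_univ (G : SimpleGraph V) : IsGreedy G univ (fun _ _ => False) 0 where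
  colours := ⟨fun _ => 0, by simp, by simp⟩
  notMem := by simp
  proper := by simp
  bound M k _ hk := ⟨k, hk.mono (by simp [compl_eq_univ_sdiff]), by simp⟩

/-- The new class raises `r` by one. If it meets `M`, the smaller `M ∩ U` makes up for it; otherwise
it is a maximal independent subset of `U \ M`, and `ColorableOn.diff` lowers `l`. -/
theorem IsGreedy.step [Finite V] {G : SimpleGraph V} {U : Set V} {E : V → V → Prop} {r : ℕ}
    (h : IsGreedy G U E r) {S : Set V} (hSU : S ⊆ U) (hS : ∀ x ∈ S, ∀ y ∈ S, ¬ G.Adj x y)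
    (hmax : ∀ v ∈ U, v ∉ S → ∃ x ∈ S, G.Adj x v) {a : V} (ha : a ∈ S)
    (h3 : ∀ x y, ∃ z ∈ S, z ≠ x ∧ z ≠ y) :
    IsGreedy G (U \ S) (fun x y => E x y ∨ (x ∈ S ∧ y ∈ S)) (r + 1) where
  colours := by
    classical
    obtain ⟨f, h1, h2⟩ := h.colours
    refine ⟨fun x => if x ∈ S then r else f x, ?_, ?_⟩
    · intro x hx
      by_cases hxS : x ∈ S
      · simp [hxS]
      · have := h1 x fun hU => hx ⟨hU, hxS⟩
        simp only [hxS, if_false]; omega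
    · intro x hx y hy
      by_cases hxS : x ∈ S <;> by_cases hyS : y ∈ S
      · simp [hxS, hyS]
      · have hyU : y ∉ U := fun hU => hy ⟨hU, hyS⟩
        have := h1 y hyU
        have hE : ¬ E x y := fun hE => (h.notMem x y hE).1 (hSU hxS)
        simp only [hxS, hyS, hE, if_true, if_false]
        simp; omega
      · have hxU : x ∉ U := fun hU => hx ⟨hU, hxS⟩
        have := h1 x hxU
        have hE : ¬ E x y := fun hE => (h.notMem x y hE).2 (hSU hyS)
        simp only [hxS, hyS, hE, if_true, if_false]
        simp; omega
      · have hxU : x ∉ U := fun hU => hx ⟨hU, hxS⟩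
        have hyU : y ∉ U := fun hU => hy ⟨hU, hyS⟩
        simpa [hxS, hyS] using h2 x hxU y hyU
  notMem := by
    rintro x y (hE | ⟨h1, h2⟩)
    · exact ⟨fun hx => (h.notMem x y hE).1 hx.1, fun hy => (h.notMem x y hE).2 hy.1⟩
    · exact ⟨fun hx => hx.2 h1, fun hy => hy.2 h2⟩
  proper := by
    rintro x y (hE | ⟨h1, h2⟩)
    · exact h.proper x y hE
    · exact hS x h1 y h2
  bound M k hM hk := by
    obtain ⟨l, hl, hle⟩ := h.bound M k hM hk
    by_cases hd : ∃ x ∈ S, x ∈ M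
    · obtain ⟨x, hxS, hxM⟩ := hd
      refine ⟨l, hl.mono fun y hy => ⟨hy.1.1, hy.2⟩, ?_⟩
      have : (M ∩ (U \ S)).ncard < (M ∩ U).ncard := by
        refine ncard_lt_ncard ⟨fun y hy => ⟨hy.1, hy.2.1⟩, fun hss => ?_⟩ (toFinite _)
        exact (hss ⟨hxM, hSU hxS⟩).2.2 hxS
      omega
    · push Not at hd
      obtain ⟨l', rfl, hl'⟩ := ColorableOn.diff (hM.mono (W' := U \ M) fun y hy => hy.2)
        (fun y hy => ⟨hSU hy, hd y hy⟩) hS (fun v hv => hmax v hv.1) ha h3 hl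
      refine ⟨l', hl'.mono fun y hy => ⟨⟨hy.1.1, hy.2⟩, hy.1.2⟩, ?_⟩
      have : (M ∩ (U \ S)).ncard ≤ (M ∩ U).ncard :=
        ncard_le_ncard (fun y hy => ⟨hy.1, hy.2.1⟩) (toFinite _)
      omega

/-! ### Matchings of the complement and the number of colours -/

/-- The complement of `G`, restricted to edges within `U` -/
def coGraph (G : SimpleGraph V) (U : Set V) : SimpleGraph V where
  Adj x y := x ∈ U ∧ y ∈ U ∧ x ≠ y ∧ ¬ G.Adj x y
  symm := ⟨fun _ _ h => ⟨h.2.1, h.1, h.2.2.1.symm, fun h' => h.2.2.2 h'.symm⟩⟩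

theorem IsMatch.apply_of_notMem {G : SimpleGraph V} {U : Set V} {f : V → V}
    (hf : IsMatch (coGraph G U) f) {x : V} (hx : x ∉ U) : f x = x := by
  by_contra h
  exact hx (hf.adj x h).1

theorem IsMatch.apply_mem {G : SimpleGraph V} {U : Set V} {f : V → V}
    (hf : IsMatch (coGraph G U) f) {x : V} (hx : x ∈ U) : f x ∈ U := by
  by_cases h : f x = x
  · rwa [h]
  · exact (hf.adj x h).2.1

open Classical in
/-- The number of orbits of an involution -/
theorem two_mul_card_le_apply [LinearOrder V] (X : Finset V) (f : V → V) (h1 : ∀ x ∈ X, f x ∈ X)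
    (h2 : ∀ x ∈ X, f (f x) = x) :
    2 * (X.filter fun x => x ≤ f x).card = X.card + (X.filter fun x => f x = x).card := by
  have e1 : (X.filter fun x => x < f x).card = (X.filter fun x => f x < x).card := by
    refine Finset.card_bij' (fun x _ => f x) (fun x _ => f x) ?_ ?_ ?_ ?_ <;>
      simp only [Finset.mem_filter]
    · exact fun x hx => ⟨h1 x hx.1, by rw [h2 x hx.1]; exact hx.2⟩
    · exact fun x hx => ⟨h1 x hx.1, by rw [h2 x hx.1]; exact hx.2⟩
    · exact fun x hx => h2 x hx.1
    · exact fun x hx => h2 x hx.1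
  have e2 : (X.filter fun x => x ≤ f x).card + (X.filter fun x => f x < x).card = X.card := by
    have := Finset.card_filter_add_card_filter_not (s := X) (fun x => x ≤ f x)
    simpa only [not_le] using this
  have e3 : (X.filter fun x => x ≤ f x).card =
      (X.filter fun x => x < f x).card + (X.filter fun x => f x = x).card := by
    rw [← Finset.card_union_of_disjoint]
    · congr 1
      ext x
      simp only [Finset.mem_filter, Finset.mem_union, le_iff_lt_or_eq, ← and_or_left, eq_comm]
    · exact Finset.disjoint_filter.2 fun x _ hx he => hx.ne' he
  omega

/-- A colouring of `U \ M` yields a matching of the complement. -/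
theorem exists_matching [Fintype V] [LinearOrder V] {G : SimpleGraph V} {U M : Set V} {l : ℕ}
    (hU : ∀ x ∈ U, ∀ y ∈ U, ∀ z ∈ U, x ≠ y → x ≠ z → y ≠ z →
      G.Adj x y ∨ G.Adj x z ∨ G.Adj y z) (hl : ColorableOn G (U \ M) l) :
    ∃ g, IsMatch (coGraph G U) g ∧
      (missed g).ncard + U.ncard ≤ 2 * (M ∩ U).ncard + 2 * l + Uᶜ.ncard := by
  classical
  obtain ⟨c, T, hT, hcT, hc⟩ := hl
  -- Without independent triples, a colour class in `U \ M` has at most two vertices. The involution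
  -- `g` swaps the two vertices of a class of size two and fixes everything else.
  let P : V → V → Prop := fun x y => y ∈ U \ M ∧ y ≠ x ∧ c y = c x
  let g : V → V := fun x => if h : x ∈ U \ M ∧ ∃ y, P x y then h.2.choose else x
  have uniq : ∀ x y z, x ∈ U \ M → P x y → P x z → y = z := by
    rintro x y z hx ⟨hy, hyx, cy⟩ ⟨hz, hzx, cz⟩
    by_contra hyz
    rcases hU x hx.1 y hy.1 z hz.1 hyx.symm hzx.symm hyz with h | h | h
    · exact hc x hx y hy h cy.symm
    · exact hc x hx z hz h cz.symm
    · exact hc y hy z hz h (cy.trans cz.symm)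
  have g1 : ∀ x y, x ∈ U \ M → P x y → g x = y := fun x y hx hy => by
    have hp : x ∈ U \ M ∧ ∃ y, P x y := ⟨hx, y, hy⟩
    simp only [g, dif_pos hp]
    exact uniq x _ y hx hp.2.choose_spec hy
  have g2 : ∀ x, g x ≠ x → x ∈ U \ M ∧ P x (g x) := fun x hx => by
    by_cases hp : x ∈ U \ M ∧ ∃ y, P x y
    · obtain ⟨h1, y, hy⟩ := hp
      rw [g1 x y h1 hy]
      exact ⟨h1, hy⟩
    · exact absurd (dif_neg hp) hx
  have hinv : ∀ x, g (g x) = x := fun x => by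
    by_cases hx : g x = x
    · rw [hx, hx]
    · obtain ⟨h1, h2, h3, h4⟩ := g2 x hx
      exact g1 _ x h2 ⟨h1, h3.symm, h4.symm⟩
  have hg : IsMatch (coGraph G U) g := by
    refine ⟨hinv, fun x hx => ?_⟩
    obtain ⟨h1, h2, h3, h4⟩ := g2 x hx
    exact ⟨h1.1, h2.1, h3.symm, fun h5 => hc x h1 _ h2 h5 h4.symm⟩
  refine ⟨g, hg, ?_⟩
  set X : Finset V := (U \ M).toFinset with hX
  have hmaps : ∀ x ∈ X, g x ∈ X := fun x hx => by
    by_cases h : g x = x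
    · rwa [h]
    · simpa [hX] using (g2 x h).2.1
  have e1 := two_mul_card_le_apply X g hmaps fun x _ => hinv x
  -- The lower vertices of the orbits have different colours, so there are at most `l` orbits.
  have e2 : (X.filter fun x => x ≤ g x).card ≤ l := by
    rw [← hT]
    refine Finset.card_le_card_of_injOn c (fun x hx => ?_) ?_
    · have : x ∈ U \ M := by simpa [hX] using (Finset.mem_filter.1 hx).1
      exact hcT x this
    · intro x hx y hy hxy
      obtain ⟨hxX, hxg⟩ := Finset.mem_filter.1 hx
      obtain ⟨hyX, hyg⟩ := Finset.mem_filter.1 hy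
      replace hxX : x ∈ U \ M := by simpa [hX] using hxX
      replace hyX : y ∈ U \ M := by simpa [hX] using hyX
      by_contra hne
      rw [g1 x y hxX ⟨hyX, Ne.symm hne, hxy.symm⟩] at hxg
      rw [g1 y x hyX ⟨hxX, hne, hxy⟩] at hyg
      exact hne (le_antisymm hxg hyg)
  have e3 : (missed g).ncard ≤ (X.filter fun x => g x = x).card + (M ∩ U).ncard + Uᶜ.ncard := by
    have hsub : missed g ⊆ ((X.filter fun x => g x = x : Finset V) : Set V) ∪ (M ∩ U) ∪ Uᶜ := by
      intro x hx
      by_cases hxU : x ∈ U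
      · by_cases hxM : x ∈ M
        · exact .inl (.inr ⟨hxM, hxU⟩)
        · refine .inl (.inl ?_)
          have hx' : g x = x := hx
          simp [hX, hxU, hxM, hx']
      · exact .inr hxU
    refine (ncard_le_ncard hsub (toFinite _)).trans ((ncard_union_le _ _).trans ?_)
    refine Nat.add_le_add_right ((ncard_union_le _ _).trans ?_) _
    rw [ncard_coe_finset]
  have e4 : U.ncard = X.card + (M ∩ U).ncard := by
    rw [hX, ← ncard_eq_toFinset_card', inter_comm, add_comm, ncard_inter_add_ncard_sdiff_eq_ncard _ _ (toFinite _)]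
  omega

/-- The colour classes of the greedy phase and a maximum matching of the complement of the rest form
a good colouring. -/
theorem IsGreedy.card_image_le [Fintype V] [LinearOrder V] {G : SimpleGraph V} {U : Set V}
    {E : V → V → Prop} {r : ℕ} (h : IsGreedy G U E r)
    (hU : ∀ x ∈ U, ∀ y ∈ U, ∀ z ∈ U, x ≠ y → x ≠ z → y ≠ z →
      G.Adj x y ∨ G.Adj x z ∨ G.Adj y z) {f : V → V} (hf : IsMatch (coGraph G U) f)
    (hmax : ∀ g, IsMatch (coGraph G U) g → (missed f).ncard ≤ (missed g).ncard) {c : V → ℕ}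
    (hc : ∀ x y, E x y ∨ x = y ∨ f x = y → c x = c y) {M : Set V} {k : ℕ}
    (hM : FreeOn G Mᶜ) (hk : ColorableOn G Mᶜ k) :
    (Finset.univ.image c).card ≤ k + M.ncard := by
  classical
  obtain ⟨l, hl, hle⟩ := h.bound M k hM hk
  obtain ⟨g, hg, hgle⟩ := exists_matching hU hl
  have hfg := hmax g hg
  obtain ⟨φ, hφ, hφE⟩ := h.colours
  set A : Finset V := U.toFinset.filter fun x => x ≤ f x with hA
  have e1 : 2 * A.card = U.toFinset.card + (U.toFinset.filter fun x => f x = x).card := by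
    convert two_mul_card_le_apply U.toFinset f (fun x hx => by
      simpa using IsMatch.apply_mem hf (by simpa using hx)) fun x _ => hf.invol x
  have e2 : (missed f).ncard = (U.toFinset.filter fun x => f x = x).card + Uᶜ.ncard := by
    have : missed f = ((U.toFinset.filter fun x => f x = x : Finset V) : Set V) ∪ Uᶜ := by
      ext x
      by_cases hx : x ∈ U
      · simp [missed, hx]
      · simp [missed, hx, IsMatch.apply_of_notMem hf hx]
    rw [this, ncard_union_eq _ (toFinite _) (toFinite _), ncard_coe_finset]
    refine disjoint_left.2 fun x hx hx' => hx' ?_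
    have := (Finset.mem_filter.1 (Finset.mem_coe.1 hx)).1
    simpa using this
  have e3 : U.ncard = U.toFinset.card := ncard_eq_toFinset_card' U
  -- The label of a vertex is its greedy class outside `U` and the lower end of its matching edge,
  -- or itself if unmatched, inside `U`. There are at most `r + A.card` labels, and `c` factors
  -- through them.
  let m : V → ℕ ⊕ V := fun x => if x ∈ U then .inr (min x (f x)) else .inl (φ x)
  have hm : ∀ x y, m x = m y → c x = c y := by
    intro x y hxy
    simp only [m] at hxy
    split_ifs at hxy with hx hy hy
    · have he : min x (f x) = min y (f y) := Sum.inr.inj hxy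
      have hmin : ∀ z, c (min z (f z)) = c z := fun z => by
        rcases min_choice z (f z) with h1 | h1 <;> rw [h1]
        exact (hc z (f z) (.inr (.inr rfl))).symm
      rw [← hmin x, he, hmin]
    · exact hc x y (.inl ((hφE x hx y hy).2 (Sum.inl.inj hxy)))
  have e4 : (Finset.univ.image c).card ≤ (Finset.univ.image m).card := by
    have hsub : Finset.univ.image c ⊆ (Finset.univ.image m).image
        (fun t => if ht : ∃ x, m x = t then c ht.choose else 0) := by
      intro t ht
      obtain ⟨x, -, rfl⟩ := Finset.mem_image.1 ht
      refine Finset.mem_image.2 ⟨m x, Finset.mem_image_of_mem _ (Finset.mem_univ x), ?_⟩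
      have hx : ∃ y, m y = m x := ⟨x, rfl⟩
      rw [dif_pos hx]
      exact hm _ _ hx.choose_spec
    exact (Finset.card_le_card hsub).trans Finset.card_image_le
  have e5 : Finset.univ.image m ⊆ (Finset.range r).disjSum A := by
    intro t ht
    obtain ⟨x, -, rfl⟩ := Finset.mem_image.1 ht
    simp only [m]
    split_ifs with hx
    · refine Finset.inr_mem_disjSum.2 (Finset.mem_filter.2 ?_)
      rcases le_total x (f x) with h1 | h1
      · rw [min_eq_left h1]; exact ⟨by simpa using hx, h1⟩
      · rw [min_eq_right h1, hf.invol]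
        exact ⟨by simpa using IsMatch.apply_mem hf hx, h1⟩
    · exact Finset.inl_mem_disjSum.2 (Finset.mem_range.2 (hφ x hx))
  have e6 := Finset.card_le_card e5
  rw [Finset.card_disjSum, Finset.card_range] at e6
  omega

end Colour

/-! ## The colouring program -/

namespace RelProg

open Function Set Matching Colour

namespace Fml

/-- Disjunction -/
def or (φ ψ : Fml) : Fml := .neg (.and (.neg φ) (.neg ψ))

/-- The unary relation kept in the diagonal of relation `a` -/
def un (a x : ℕ) : Fml := .rel a x x x

/-- The binary relation kept in relation `a` -/
def bin (a x y : ℕ) : Fml := .rel a x y y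

section holds

variable {n : ℕ} {G : SimpleGraph (Fin n)} {h : Store n}

theorem holds_adj {x y : ℕ} : (adj x y).Holds G h ↔ G.Adj (h.env x) (h.env y) := Iff.rfl

theorem holds_eq {x y : ℕ} : (eq x y).Holds G h ↔ h.env x = h.env y := Iff.rfl

theorem holds_rel {a x y z : ℕ} :
    (rel a x y z).Holds G h ↔ h.rel a (h.env x) (h.env y) (h.env z) := Iff.rfl

theorem holds_neg {φ : Fml} : (neg φ).Holds G h ↔ ¬ φ.Holds G h := Iff.rfl

theorem holds_and {φ ψ : Fml} : (and φ ψ).Holds G h ↔ φ.Holds G h ∧ ψ.Holds G h := Iff.rfl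

theorem holds_ex {x : ℕ} {φ : Fml} : (ex x φ).Holds G h ↔ ∃ a, φ.Holds G (h.setVar x a) := Iff.rfl

theorem holds_or {φ ψ : Fml} : (or φ ψ).Holds G h ↔ φ.Holds G h ∨ ψ.Holds G h := by
  simp only [or, Holds]; tauto

theorem holds_un {a x : ℕ} : (un a x).Holds G h ↔ h.rel a (h.env x) (h.env x) (h.env x) := Iff.rfl

theorem holds_bin {a x y : ℕ} :
    (bin a x y).Holds G h ↔ h.rel a (h.env x) (h.env y) (h.env y) := Iff.rfl

end holds

end Fml

theorem setVar_env {n : ℕ} (h : Store n) (x y : ℕ) (a : Fin n) :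
    (h.setVar x a).env y = if y = x then a else h.env y := by
  simp [Store.setVar, update_apply]

theorem setVar_rel {n : ℕ} (h : Store n) (x : ℕ) (a : Fin n) : (h.setVar x a).rel = h.rel := rfl

theorem Stmt.Exec.rel_eq {n : ℕ} {G : SimpleGraph (Fin n)} {a : ℕ} {φ : Fml} {h h' : Store n}
    (H : (Stmt.assign a φ).Exec G h h') (p q r : Fin n) :
    h'.rel a p q r ↔ φ.Holds G (((h.setVar 0 p).setVar 1 q).setVar 2 r) := by
  rw [H.1, update_self]

theorem Stmt.Exec.rel_ne {n : ℕ} {G : SimpleGraph (Fin n)} {a : ℕ} {φ : Fml} {h h' : Store n}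
    (H : (Stmt.assign a φ).Exec G h h') {b : ℕ} (hb : b ≠ a) : h'.rel b = h.rel b := by
  rw [H.1, update_of_ne hb]

/-- The unary relation `a` of a store as a set -/
def Store.set {n : ℕ} (h : Store n) (a : ℕ) : Set (Fin n) := {x | h.rel a x x x}

/-- The binary relation `a` of a store -/
def Store.bin {n : ℕ} (h : Store n) (a : ℕ) (x y : Fin n) : Prop := h.rel a x y y

theorem iter_induction {n : ℕ} {G : SimpleGraph (Fin n)} {P : Stmt} {h h' : Store n}
    (H : (Stmt.iter P).Exec G h h') (J : ℕ → Store n → Prop) (h0 : J 0 h)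
    (hstep : ∀ i < n, ∀ h h', J i h → P.Exec G h h' → J (i + 1) h') : J n h' := by
  obtain ⟨f, rfl, rfl, hf⟩ := H
  have : ∀ i ≤ n, J i (f i) := by
    intro i
    induction i with
    | zero => exact fun _ => h0
    | succ i ih => exact fun hi => hstep i (by omega) _ _ (ih (by omega)) (hf i (by omega))
  exact this n le_rfl

/-! Relations: `0` the uncoloured vertices, `1` having equal colours, `2` a set that is being built,
`3` the outer and `4` the inner vertices, `5` the blossoms, `6` the matchings that miss the outer
vertices, `7` the current matching. -/

open Fml Stmt

/-! ### The greedy phase -/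

/-- The variables `3`, `4`, `5` hold three independent vertices. -/
def triple : Fml :=
  .and (.and (un 0 3) (.and (un 0 4) (un 0 5)))
    (.and (.and (.neg (.eq 3 4)) (.and (.neg (.eq 3 5)) (.neg (.eq 4 5))))
      (.and (.neg (.adj 3 4)) (.and (.neg (.adj 3 5)) (.neg (.adj 4 5)))))

/-- The variable `9` holds an uncoloured vertex that can be added to the independent set. -/
def addable : Fml :=
  .and (un 0 9) (.and (.neg (un 2 9)) (.neg (.ex 10 (.and (un 2 10) (.adj 10 9)))))

/-- Extend the independent set by one vertex. -/
def extendSet : Stmt := .pick 9 addable (.assign 2 (.or (un 2 0) (.eq 0 9))) .skip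

/-- Colour a maximal independent set that contains the variables `3`, `4`, `5`. -/
def colourSet : Stmt :=
  .seq (.assign 2 (.or (.eq 0 3) (.or (.eq 0 4) (.eq 0 5))))
    (.seq (.iter extendSet)
      (.seq (.assign 1 (.or (bin 1 0 1) (.and (un 2 0) (un 2 1))))
        (.assign 0 (.and (un 0 0) (.neg (un 2 0))))))

/-- One step of the greedy phase -/
def greedyStep : Stmt :=
  .pick 3 (.ex 4 (.ex 5 triple)) (.pick 4 (.ex 5 triple) (.pick 5 triple colourSet .skip) .skip)
    .skip

/-- The greedy phase -/
def greedy : Stmt := .seq (.assign 0 (.eq 0 0)) (.iter greedyStep)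

section greedy

variable {n : ℕ} {G : SimpleGraph (Fin n)} {h h' : Store n}

theorem holds_triple : triple.Holds G h ↔
    (h.env 3 ∈ h.set 0 ∧ h.env 4 ∈ h.set 0 ∧ h.env 5 ∈ h.set 0) ∧
    (h.env 3 ≠ h.env 4 ∧ h.env 3 ≠ h.env 5 ∧ h.env 4 ≠ h.env 5) ∧
    ¬ G.Adj (h.env 3) (h.env 4) ∧ ¬ G.Adj (h.env 3) (h.env 5) ∧ ¬ G.Adj (h.env 4) (h.env 5) :=
  Iff.rfl

theorem holds_addable : addable.Holds G h ↔ h.env 9 ∈ h.set 0 ∧ h.env 9 ∉ h.set 2 ∧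
    ∀ y ∈ h.set 2, ¬ G.Adj y (h.env 9) := by
  simp [addable, holds_and, holds_neg, holds_un, holds_ex, holds_adj, setVar_env, setVar_rel,
    Store.set]

theorem exec_extendSet {U S : Set (Fin n)} (hU : h.set 0 = U) (hS : h.set 2 = S)
    (H : extendSet.Exec G h h') : h'.rel 0 = h.rel 0 ∧ h'.rel 1 = h.rel 1 ∧
    ((∃ d ∈ U, d ∉ S ∧ (∀ y ∈ S, ¬ G.Adj y d) ∧ h'.set 2 = insert d S) ∨
      h'.set 2 = S ∧ ∀ d ∈ U, d ∉ S → ∃ y ∈ S, G.Adj y d) := by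
  subst hU hS
  rcases H with ⟨d, hd, H⟩ | ⟨hno, rfl⟩
  · rw [holds_addable] at hd
    refine ⟨H.rel_ne (by decide), H.rel_ne (by decide), .inl ⟨d, ?_⟩⟩
    simp only [setVar_env, if_true] at hd
    refine ⟨hd.1, hd.2.1, hd.2.2, ?_⟩
    ext x
    simp [Store.set, H.rel_eq, holds_or, holds_un, holds_eq, setVar_env, setVar_rel, or_comm]
  · refine ⟨rfl, rfl, .inr ⟨rfl, fun d hd hdS => ?_⟩⟩
    have := hno d
    rw [holds_addable] at this
    simp only [setVar_env, if_true] at this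
    by_contra! hadj
    exact this ⟨hd, hdS, hadj⟩

theorem exec_colourSet {r : ℕ} (hg : IsGreedy G (h.set 0) (h.bin 1) r) (ht : triple.Holds G h)
    (H : colourSet.Exec G h h') : IsGreedy G (h'.set 0) (h'.bin 1) (r + 1) ∧
    (h'.set 0).ncard < (h.set 0).ncard := by
  obtain ⟨h₁, H₁, h₂, H₂, h₃, H₃, H₄⟩ := H
  rw [holds_triple] at ht
  obtain ⟨⟨ha, hb, hc⟩, ⟨hab, hac, hbc⟩, nab, nac, nbc⟩ := ht
  set a := h.env 3
  set b := h.env 4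
  set c := h.env 5
  have hS₁ : h₁.set 2 = {a, b, c} := by
    ext x
    simp [Store.set, H₁.rel_eq, holds_or, holds_eq, setVar_env, a, b, c]
  have hrel₁ : h₁.rel 0 = h.rel 0 ∧ h₁.rel 1 = h.rel 1 := ⟨H₁.rel_ne (by decide), H₁.rel_ne (by decide)⟩
  -- Each round adds a vertex unless the set is already maximal. For `i = n` the first alternative
  -- would need more than `n` vertices.
  have key := iter_induction H₂ (fun i k => (k.rel 0 = h.rel 0 ∧ k.rel 1 = h.rel 1) ∧
      ({a, b, c} ⊆ k.set 2 ∧ k.set 2 ⊆ h.set 0 ∧ ∀ x ∈ k.set 2, ∀ y ∈ k.set 2, ¬ G.Adj x y) ∧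
      (i + 1 ≤ (k.set 2).ncard ∨ ∀ d ∈ h.set 0, d ∉ k.set 2 → ∃ y ∈ k.set 2, G.Adj y d)) ?_ ?_
  · obtain ⟨hrel₂, ⟨hsub, hS, hind⟩, hmax⟩ := key
    set S := h₂.set 2 with hSdef
    replace hmax := hmax.resolve_left fun hle => by
      have := ncard_le_ncard (subset_univ S) (toFinite _)
      rw [ncard_univ, Nat.card_eq_fintype_card, Fintype.card_fin] at this
      omega
    have hU' : h'.set 0 = h.set 0 \ S := by
      ext x
      simp [Store.set, H₄.rel_eq, holds_and, holds_neg, holds_un, setVar_env, setVar_rel,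
        H₃.rel_ne (show 0 ≠ 1 by decide), H₃.rel_ne (show 2 ≠ 1 by decide), hrel₂.1, hSdef]
    have hE' : h'.bin 1 = fun x y => h.bin 1 x y ∨ (x ∈ S ∧ y ∈ S) := by
      funext x y
      simp [Store.bin, H₄.rel_ne (show 1 ≠ 0 by decide), H₃.rel_eq, holds_or, holds_bin, holds_and,
        holds_un, setVar_env, setVar_rel, hrel₂.2, hSdef, Store.set]
    have haS : a ∈ S := hsub (by simp)
    have hbS : b ∈ S := hsub (by simp)
    have hcS : c ∈ S := hsub (by simp)
    rw [hU', hE']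
    refine ⟨hg.step hS hind hmax haS ?_, ?_⟩
    · intro x y
      by_contra! hno
      have h1 := hno a haS
      have h2 := hno b hbS
      have h3 := hno c hcS
      by_cases e1 : a = x
      · by_cases e2 : b = x
        · exact hab (e1.trans e2.symm)
        · by_cases e3 : c = x
          · exact hac (e1.trans e3.symm)
          · exact hbc ((h2 e2).trans (h3 e3).symm)
      · by_cases e2 : b = x
        · by_cases e3 : c = x
          · exact hbc (e2.trans e3.symm)
          · exact hac ((h1 e1).trans (h3 e3).symm)
        · exact hab ((h1 e1).trans (h2 e2).symm)
    · exact ncard_lt_ncard ⟨sdiff_subset, fun hss => (hss ha).2 haS⟩ (toFinite _)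
  · refine ⟨hrel₁, ⟨by rw [hS₁], ?_, ?_⟩, .inl ?_⟩
    · rw [hS₁]
      rintro x (rfl | rfl | rfl)
      exacts [ha, hb, hc]
    · rw [hS₁]
      rintro x (rfl | rfl | rfl) y (rfl | rfl | rfl) hadj
      · exact hadj.ne rfl
      · exact nab hadj
      · exact nac hadj
      · exact nab hadj.symm
      · exact hadj.ne rfl
      · exact nbc hadj
      · exact nac hadj.symm
      · exact nbc hadj.symm
      · exact hadj.ne rfl
    · rw [hS₁]
      exact Nat.one_le_iff_ne_zero.2 (ncard_ne_zero_of_mem (mem_insert a _) (toFinite _))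
  · rintro i - k k' ⟨⟨e0, e1⟩, ⟨hsub, hS, hind⟩, hmax⟩ Hk
    have e0' : k.set 0 = h.set 0 := by simp only [Store.set, e0]
    obtain ⟨f0, f1, ⟨d, hd, hdS, hdn, hk'⟩ | ⟨hk', hk''⟩⟩ := exec_extendSet e0' rfl Hk
    · refine ⟨⟨f0.trans e0, f1.trans e1⟩, ?_, ?_⟩
      · rw [hk']
        refine ⟨hsub.trans (subset_insert _ _), insert_subset hd hS, ?_⟩
        rintro x (rfl | hx) y (rfl | hy) hadj
        · exact hadj.ne rfl
        · exact hdn y hy hadj.symm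
        · exact hdn x hx hadj
        · exact hind x hx y hy hadj
      · rcases hmax with hle | hmax
        · left
          rw [hk', ncard_insert_of_notMem hdS (toFinite _)]
          omega
        · obtain ⟨y, hy, hyd⟩ := hmax d hd hdS
          exact absurd hyd (hdn y hy)
    · rw [hk']
      exact ⟨⟨f0.trans e0, f1.trans e1⟩, ⟨hsub, hS, hind⟩, .inr hk''⟩

/-- No three vertices of `U` are independent. -/
def NoTriple (G : SimpleGraph (Fin n)) (U : Set (Fin n)) : Prop :=
  ∀ x ∈ U, ∀ y ∈ U, ∀ z ∈ U, x ≠ y → x ≠ z → y ≠ z → G.Adj x y ∨ G.Adj x z ∨ G.Adj y z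

theorem exec_greedyStep {r : ℕ} (hg : IsGreedy G (h.set 0) (h.bin 1) r)
    (H : greedyStep.Exec G h h') :
    (∃ r', IsGreedy G (h'.set 0) (h'.bin 1) r' ∧ (h'.set 0).ncard < (h.set 0).ncard ∧
      ¬ NoTriple G (h.set 0)) ∨ h' = h ∧ NoTriple G (h.set 0) := by
  rcases H with ⟨a, ⟨b, c, ht⟩, ⟨b', ⟨c', ht'⟩, ⟨c'', ht'', H⟩ | ⟨hno, -⟩⟩ | ⟨hno, -⟩⟩ | ⟨hno, rfl⟩
  · have hk := exec_colourSet (h := ((h.setVar 3 a).setVar 4 b').setVar 5 c'') hg ht'' H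
    refine .inl ⟨r + 1, hk.1, hk.2, fun hno => ?_⟩
    obtain ⟨⟨h3, h4, h5⟩, ⟨n1, n2, n3⟩, a1, a2, a3⟩ := holds_triple.1 ht''
    exact (hno _ h3 _ h4 _ h5 n1 n2 n3).elim a1 fun h => h.elim a2 a3
  -- The inner choices cannot fail, because the guard of the preceding choice provides a witness.
  · exact absurd ht' (hno c')
  · exact absurd ⟨c, ht⟩ (hno b)
  · refine .inr ⟨rfl, fun x hx y hy z hz hxy hxz hyz => ?_⟩
    by_contra! hadj
    refine hno x ⟨y, z, holds_triple.2 ?_⟩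
    simp only [setVar_env]
    exact ⟨⟨hx, hy, hz⟩, ⟨hxy, hxz, hyz⟩, hadj⟩

theorem exec_greedy (hE : ∀ x y, ¬ h.bin 1 x y) (H : greedy.Exec G h h') :
    ∃ r, IsGreedy G (h'.set 0) (h'.bin 1) r ∧ NoTriple G (h'.set 0) := by
  obtain ⟨h₁, H₁, H₂⟩ := H
  have hU : h₁.set 0 = univ := by
    ext x
    simp [Store.set, H₁.rel_eq, holds_eq]
  have hE' : h₁.bin 1 = fun _ _ => False := by
    funext x y
    simpa [Store.bin, H₁.rel_ne (show 1 ≠ 0 by decide)] using hE x y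
  -- A round that finds a triple shrinks the uncoloured set, so after `n` rounds that set is empty
  -- or has no triple.
  obtain ⟨⟨r, hr⟩, hle⟩ := iter_induction H₂ (fun i k =>
    (∃ r, IsGreedy G (k.set 0) (k.bin 1) r) ∧ ((k.set 0).ncard + i ≤ n ∨ NoTriple G (k.set 0)))
    ⟨⟨0, by rw [hU, hE']; exact isGreedy_univ G⟩, .inl (by rw [hU, ncard_univ]; simp)⟩ (by
      rintro i - k k' ⟨⟨r, hr⟩, hle⟩ Hk
      rcases exec_greedyStep hr Hk with ⟨r', hr', hlt, hn⟩ | ⟨rfl, hno⟩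
      · refine ⟨⟨r', hr'⟩, ?_⟩
        have := hle.resolve_right hn
        left; omega
      · exact ⟨⟨r, hr⟩, .inr hno⟩)
  refine ⟨r, hr, hle.elim (fun h0 => ?_) id⟩
  have : h'.set 0 = ∅ := (ncard_eq_zero (toFinite _)).1 (by omega)
  intro x hx
  simp [this] at hx

end greedy

end RelProg

namespace RelProg

open Function Set Matching Colour

open Fml Stmt

/-! ### The matching phase -/

/-- Adjacency in the complement, restricted to the uncoloured vertices -/
def coAdj (x y : ℕ) : Fml :=
  .and (un 0 x) (.and (un 0 y) (.and (.neg (.eq x y)) (.neg (.adj x y))))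

/-- The edge from variable `6` to variable `7` leaves a blossom and does not lead to an inner
vertex. -/
def enabled : Fml := .and (un 3 6) (.and (coAdj 6 7) (.and (.neg (un 4 7)) (.neg (bin 5 6 7))))

/-- The variable `x` has a partner in the set `2` in the matching that misses variable `6`. -/
def entering (x : ℕ) : Fml := .ex 10 (.and (.rel 6 6 x 10) (un 2 10))

/-- The variable `y` is the partner of `x` in the new matching. -/
def mixFml (x y : ℕ) : Fml :=
  .or (.and (.eq x 7) (.eq y 6)) (.and (.neg (.eq x 7))
    (.or (.and (.eq x 6) (.eq y 7)) (.and (.neg (.eq x 6))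
      (.or (.and (un 2 x) (.rel 6 7 x y)) (.and (.neg (un 2 x))
        (.or (.and (entering x) (.eq y x)) (.and (.neg (entering x)) (.rel 6 6 x y))))))))

/-- Store the new matching as the one that misses variable `8`. -/
def setRow : Stmt :=
  .assign 6 (.or (.and (.neg (.eq 0 8)) (.rel 6 0 1 2)) (.and (.eq 0 8) (mixFml 1 2)))

/-- Start a new forest. -/
def reset : Stmt :=
  .seq (.assign 3 (un 7 0)) (.seq (.assign 4 (.neg (.eq 0 0)))
    (.seq (.assign 5 (.and (.eq 0 1) (un 7 0))) (.assign 6 (bin 7 1 2))))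

/-- Extend the forest by the variables `7` and `8`. -/
def growForest : Stmt :=
  .seq (.assign 2 (.eq 0 7)) (.pick 8 (.rel 6 6 7 8) (.seq setRow
    (.seq (.assign 3 (.or (un 3 0) (.eq 0 8))) (.seq (.assign 4 (.or (un 4 0) (.eq 0 7)))
      (.assign 5 (.or (bin 5 0 1) (.and (.eq 0 8) (.eq 1 8))))))) .skip)

/-- Extend the set `2` by an inner vertex and a blossom. -/
def extendPetal : Stmt :=
  .pick 8 (.and (.neg (un 2 8)) (entering 8)) (.seq setRow (.assign 2 (.or (un 2 0)
    (.or (.eq 0 8) (.ex 10 (.and (.rel 6 7 8 10) (bin 5 10 0))))))) .skip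

/-- Turn the set `2` into a blossom. -/
def shrinkPetal : Stmt :=
  .seq (.assign 3 (.or (un 3 0) (un 2 0))) (.seq (.assign 4 (.and (un 4 0) (.neg (un 2 0))))
    (.assign 5 (.or (bin 5 0 1) (.and (un 2 0) (un 2 1)))))

/-- Replace the current matching by a larger one. -/
def augment : Stmt := .seq (.assign 7 (mixFml 0 1)) reset

/-- Use an edge between two blossoms. -/
def joinBlossoms : Stmt :=
  .seq (.assign 2 (bin 5 7 0)) (.seq (.iter extendPetal) (.pick 11 (un 2 6) shrinkPetal augment))

/-- One step of the matching phase -/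
def matchStep : Stmt :=
  .pick 6 (.ex 7 enabled) (.pick 7 enabled (.pick 11 (un 3 7) joinBlossoms growForest) .skip) .skip

/-- The matching phase -/
def maxMatching : Stmt :=
  .seq (.assign 7 (.eq 0 1)) (.seq reset
    (.iter (.iter (.seq matchStep (.seq matchStep (.seq matchStep matchStep))))))

section matching

variable {n : ℕ} {G : SimpleGraph (Fin n)} {h h' : Store n}

theorem holds_enabled : enabled.Holds G h ↔ h.env 6 ∈ h.set 3 ∧
    (coGraph G (h.set 0)).Adj (h.env 6) (h.env 7) ∧ h.env 7 ∉ h.set 4 ∧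
    ¬ h.bin 5 (h.env 6) (h.env 7) := Iff.rfl

theorem holds_entering {x : ℕ} (hx : x ≠ 10) {g : Fin n → Fin n}
    (hg : ∀ y z, h.rel 6 (h.env 6) y z ↔ g y = z) :
    (entering x).Holds G h ↔ g (h.env x) ∈ h.set 2 := by
  simp [entering, holds_ex, holds_and, holds_rel, holds_un, setVar_env, setVar_rel, hx, hg,
    Store.set]

/-- The row of variable `7` is needed only at vertices of set `2` other than variable `7` itself.
This matters when the forest grows: there variable `7` is not outer and has no row, but set `2` is a
singleton and `hf` is void. -/
theorem holds_mixFml {x y : ℕ} (hx : x ≠ 10) {f g : Fin n → Fin n}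
    (hg : ∀ y z, h.rel 6 (h.env 6) y z ↔ g y = z)
    (hf : ∀ y ∈ h.set 2, y ≠ h.env 7 → ∀ z, h.rel 6 (h.env 7) y z ↔ f y = z) :
    (mixFml x y).Holds G h ↔ mix (h.set 2) (h.env 7) (h.env 6) f g (h.env x) = h.env y := by
  simp only [mixFml, holds_or, holds_and, holds_neg, holds_eq, holds_un, holds_rel,
    holds_entering hx hg, hg]
  by_cases h1 : h.env x = h.env 7
  · simp [h1, mix, eq_comm]
  by_cases h2 : h.env x = h.env 6
  · simp [h2, mix, eq_comm, show h.env 6 ≠ h.env 7 from fun h => h1 (h2.trans h)]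
  by_cases h3 : h.env x ∈ h.set 2
  · have h3' : h.rel 2 (h.env x) (h.env x) (h.env x) := h3
    simp [h1, h2, h3, h3', mix, hf _ h3 h1]
  · have h3' : ¬ h.rel 2 (h.env x) (h.env x) (h.env x) := h3
    by_cases h4 : g (h.env x) ∈ h.set 2
    · simp [h1, h2, h3, h3', h4, mix, eq_comm]
    · simp [h1, h2, h3, h3', h4, mix]

/-- The relations of the store describe the matching `f` and a forest with matchings `N`. -/
structure IsState (G : SimpleGraph (Fin n)) (h : Store n) (N : Fin n → Fin n → Fin n)
    (f : Fin n → Fin n) : Prop where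
  matching : ∀ x y, h.bin 7 x y ↔ f x = y
  isMatch : IsMatch (coGraph G (h.set 0)) f
  forest : IsForest (coGraph G (h.set 0)) (missed f).ncard (h.set 3) (h.set 4) (h.bin 5) N
  rows : ∀ x ∈ h.set 3, ∀ y z, h.rel 6 x y z ↔ N x y = z
  missed_sub : missed f ⊆ h.set 3

theorem IsState.missed_eq {N : Fin n → Fin n → Fin n} {f : Fin n → Fin n}
    (hs : IsState G h N f) : h.set 7 = missed f := by
  ext x
  exact hs.matching x x

theorem exec_reset {f : Fin n → Fin n} (hm : ∀ x y, h.bin 7 x y ↔ f x = y)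
    (hf : IsMatch (coGraph G (h.set 0)) f) (H : reset.Exec G h h') :
    IsState G h' (fun _ => f) f ∧ (h'.rel 0 = h.rel 0 ∧ h'.rel 1 = h.rel 1) := by
  obtain ⟨h₁, H₁, h₂, H₂, h₃, H₃, H₄⟩ := H
  have e : ∀ b, b ≠ 3 → b ≠ 4 → b ≠ 5 → b ≠ 6 → h'.rel b = h.rel b := fun b b3 b4 b5 b6 => by
    rw [H₄.rel_ne b6, H₃.rel_ne b5, H₂.rel_ne b4, H₁.rel_ne b3]
  have e0 : h'.set 0 = h.set 0 := by
    simp only [Store.set, e 0 (by decide) (by decide) (by decide) (by decide)]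
  have e7 : h'.bin 7 = h.bin 7 := by
    funext x y
    simp only [Store.bin, e 7 (by decide) (by decide) (by decide) (by decide)]
  have hm' : ∀ x, h.rel 7 x x x ↔ f x = x := fun x => hm x x
  have e3 : h'.set 3 = missed f := by
    ext x
    simp [Store.set, H₄.rel_ne (show 3 ≠ 6 by decide), H₃.rel_ne (show 3 ≠ 5 by decide),
      H₂.rel_ne (show 3 ≠ 4 by decide), H₁.rel_eq, holds_un, setVar_env, setVar_rel, missed, hm']
  have e4 : h'.set 4 = ∅ := by
    ext x
    simp [Store.set, H₄.rel_ne (show 4 ≠ 6 by decide), H₃.rel_ne (show 4 ≠ 5 by decide),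
      H₂.rel_eq, holds_neg, holds_eq]
  have e5 : h'.bin 5 = fun x y => x = y ∧ x ∈ missed f := by
    funext x y
    simp [Store.bin, H₄.rel_ne (show 5 ≠ 6 by decide), H₃.rel_eq, holds_and, holds_eq, holds_un,
      setVar_env, setVar_rel, H₂.rel_ne (show 7 ≠ 4 by decide), H₁.rel_ne (show 7 ≠ 3 by decide),
      missed, hm']
  refine ⟨⟨?_, ?_, ?_, ?_, ?_⟩, e 0 (by decide) (by decide) (by decide) (by decide),
    e 1 (by decide) (by decide) (by decide) (by decide)⟩
  · rwa [e7]
  · rwa [e0]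
  · rw [e0, e3, e4, e5]
    exact isForest_initial hf
  · intro x _ y z
    rw [← hm y z]
    simp [H₄.rel_eq, holds_bin, setVar_env, setVar_rel, H₃.rel_ne (show 7 ≠ 5 by decide),
      H₂.rel_ne (show 7 ≠ 4 by decide), H₁.rel_ne (show 7 ≠ 3 by decide), Store.bin]
  · rw [e3]

theorem exec_setRow {f g : Fin n → Fin n}
    (hg : ∀ y z, h.rel 6 (h.env 6) y z ↔ g y = z)
    (hf : ∀ y ∈ h.set 2, y ≠ h.env 7 → ∀ z, h.rel 6 (h.env 7) y z ↔ f y = z)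
    (H : setRow.Exec G h h') :
    (∀ x, x ≠ h.env 8 → h'.rel 6 x = h.rel 6 x) ∧
    ∀ y z, h'.rel 6 (h.env 8) y z ↔ mix (h.set 2) (h.env 7) (h.env 6) f g y = z := by
  have key : ∀ x y z, h'.rel 6 x y z ↔ (x ≠ h.env 8 ∧ h.rel 6 x y z) ∨
      (x = h.env 8 ∧ mix (h.set 2) (h.env 7) (h.env 6) f g y = z) := by
    intro x y z
    rw [H.rel_eq]
    have := holds_mixFml (G := G) (h := ((h.setVar 0 x).setVar 1 y).setVar 2 z) (x := 1) (y := 2)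
      (by decide) (f := f) (g := g) (by simpa [setVar_env, setVar_rel] using hg)
      (by simpa [setVar_env, setVar_rel, Store.set] using hf)
    simp only [holds_or, holds_and, holds_neg, holds_eq, holds_rel, this]
    simp [setVar_env, setVar_rel, Store.set]
  refine ⟨fun x hx => ?_, fun y z => by simp [key]⟩
  funext y z
  simp [key, hx]

/-! ### Progress and correctness of the matching phase -/

/-- A measure of progress -/
noncomputable def progress (h : Store n) : ℕ :=
  (n - (h.set 7).ncard) * (n + 1) + (h.set 3).ncard

theorem progress_lt_of_set_three (h7 : h'.rel 7 = h.rel 7) (h3 : h.set 3 ⊂ h'.set 3) :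
    progress h < progress h' := by
  have : h'.set 7 = h.set 7 := by simp only [Store.set, h7]
  rw [progress, progress, this]
  have := ncard_lt_ncard h3 (toFinite _)
  omega

theorem ncard_le (S : Set (Fin n)) : S.ncard ≤ n := by
  have := ncard_le_ncard (subset_univ S) (toFinite _)
  rwa [ncard_univ, Nat.card_eq_fintype_card, Fintype.card_fin] at this

/-- A larger matching starts a new forest. The weight `n + 1` outweighs the loss of outer vertices,
of which there are at most `n`. -/
theorem progress_lt_of_set_seven (h7 : (h'.set 7).ncard < (h.set 7).ncard) :
    progress h < progress h' := by
  have h1 := ncard_le (h.set 7)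
  have h2 := ncard_le (h.set 3)
  have h3 : (n - (h.set 7).ncard + 1) * (n + 1) ≤ (n - (h'.set 7).ncard) * (n + 1) :=
    Nat.mul_le_mul_right _ (by omega)
  rw [progress, progress]
  rw [Nat.add_mul] at h3
  omega

theorem progress_le : progress h ≤ n * (n + 1) + n :=
  Nat.add_le_add (Nat.mul_le_mul_right _ (Nat.sub_le _ _)) (ncard_le _)

variable {N : Fin n → Fin n → Fin n} {f : Fin n → Fin n}

/-- Only the row of `N v u` is rewritten. This vertex was not outer before, so the rows of the old
outer vertices survive and the outer set grows. -/
theorem exec_growForest (hs : IsState G h N f) (he : enabled.Holds G h)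
    (h7 : h.env 7 ∉ h.set 3) (H : growForest.Exec G h h') :
    (∃ N' f', IsState G h' N' f') ∧ (h'.rel 0 = h.rel 0 ∧ h'.rel 1 = h.rel 1) ∧
      progress h < progress h' := by
  classical
  obtain ⟨hv, huv, huI, -⟩ := holds_enabled.1 he
  obtain ⟨h₁, H₁, H⟩ := H
  have e6 : h₁.env 6 = h.env 6 := H₁.2 6 (by decide)
  have e7 : h₁.env 7 = h.env 7 := H₁.2 7 (by decide)
  have r₁ : ∀ b, b ≠ 2 → h₁.rel b = h.rel b := fun b hb => H₁.rel_ne hb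
  have hS₁ : h₁.set 2 = {h.env 7} := by
    ext x
    simp [Store.set, H₁.rel_eq, holds_eq, setVar_env]
  set v := h.env 6
  set u := h.env 7
  rcases H with ⟨w, hw, h₂, H₂, h₃, H₃, h₄, H₄, H₅⟩ | ⟨hno, -⟩
  swap
  · refine absurd ?_ (hno (N v u))
    simp [holds_rel, setVar_env, setVar_rel, e6, e7, r₁, hs.rows v hv]
  have hwN : N v u = w := by
    rw [← hs.rows v hv]
    simpa [holds_rel, setVar_env, setVar_rel, e6, e7, r₁] using hw
  obtain ⟨row1, row2⟩ := exec_setRow (f := N v) (g := N v) (h := h₁.setVar 8 w)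
    (by simpa [setVar_env, setVar_rel, e6, r₁] using hs.rows v hv)
    (by
      intro y hy hyu
      have hy' : y ∈ h₁.set 2 := hy
      rw [hS₁] at hy'
      simp [setVar_env, e7] at hyu
      exact absurd hy' hyu) H₂
  have q₂ : ∀ b, b ≠ 6 → h₂.rel b = h₁.rel b := fun b hb => H₂.rel_ne hb
  have r₂ : ∀ b, b ≠ 2 → b ≠ 6 → h₂.rel b = h.rel b := fun b hb hb' => by rw [q₂ b hb', r₁ b hb]
  have env₂ : ∀ x, 3 ≤ x → h₂.env x = (h₁.setVar 8 w).env x := H₂.2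
  have w₂ : h₂.env 8 = w := by simp [env₂, setVar_env]
  have w₃ : h₃.env 8 = w := by rw [H₃.2 8 (by decide), w₂]
  have w₄ : h₄.env 8 = w := by rw [H₄.2 8 (by decide), w₃]
  have u₃ : h₃.env 7 = u := by rw [H₃.2 7 (by decide), env₂ 7 (by decide)]; simpa [setVar_env] using e7
  have d3 : h'.set 3 = h.set 3 ∪ {N v u} := by
    ext x
    simp [Store.set, H₅.rel_ne (show 3 ≠ 5 by decide), H₄.rel_ne (show 3 ≠ 4 by decide),
      H₃.rel_eq, holds_or, holds_un, holds_eq, setVar_env, setVar_rel, r₂, w₂, hwN, or_comm]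
  have d4 : h'.set 4 = h.set 4 ∪ {u} := by
    ext x
    simp [Store.set, H₅.rel_ne (show 4 ≠ 5 by decide), H₄.rel_eq, holds_or, holds_un, holds_eq,
      setVar_env, setVar_rel, H₃.rel_ne (show 4 ≠ 3 by decide), r₂, u₃, or_comm]
  have d5 : h'.bin 5 = fun k l => h.bin 5 k l ∨ (k = N v u ∧ l = N v u) := by
    funext k l
    simp [Store.bin, H₅.rel_eq, holds_or, holds_bin, holds_and, holds_eq, setVar_env, setVar_rel,
      H₄.rel_ne (show 5 ≠ 4 by decide), H₃.rel_ne (show 5 ≠ 3 by decide), r₂, w₄, hwN]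
  have d6 : h'.rel 6 = h₂.rel 6 := by
    rw [H₅.rel_ne (by decide), H₄.rel_ne (by decide), H₃.rel_ne (by decide)]
  have d : ∀ b, b ≠ 2 → b ≠ 3 → b ≠ 4 → b ≠ 5 → b ≠ 6 → h'.rel b = h.rel b := by
    intro b b2 b3 b4 b5 b6
    rw [H₅.rel_ne b5, H₄.rel_ne b4, H₃.rel_ne b3, r₂ b b2 b6]
  have d0 : h'.set 0 = h.set 0 := by simp [Store.set, d]
  obtain ⟨hrD, hF⟩ := hs.forest.grow (u := u) (v := v) hv huv h7 huI
    (N' := update N (N v u) (mix {u} u v (N v) (N v)))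
    (fun x hx => update_of_ne (by
      rintro rfl
      rcases hs.forest.outer v hv _ hx with h1 | h1
      · rw [(hs.forest.isMatch v hv).invol] at h1; exact huI h1
      · rw [(hs.forest.isMatch v hv).invol] at h1
        exact h7 (hs.forest.mem _ _ (hs.forest.symm _ _ h1))) _ _)
    (update_self _ _ _)
  refine ⟨⟨update N (N v u) (mix {u} u v (N v) (N v)), f, ?_, ?_, ?_, ?_, ?_⟩, ?_, ?_⟩
  · simpa [Store.bin, d] using hs.matching
  · rw [d0]; exact hs.isMatch
  · rw [d0, d3, d4, d5]
    exact hF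
  · intro x hx y z
    rw [d6]
    by_cases hxw : x = w
    · subst hxw
      have := row2 y z
      simp only [setVar_env, if_true] at this
      rw [this, hwN, update_self]
      simp [e6, e7, Store.set, setVar_rel, ← hS₁]
    · rw [row1 x (by simpa [setVar_env] using hxw), hwN, update_of_ne hxw]
      have hx' : x ∈ h.set 3 := by
        rw [d3, hwN] at hx
        exact hx.resolve_right hxw
      rw [setVar_rel, r₁ 6 (by decide)]
      exact hs.rows x hx' y z
  · rw [d3]; exact hs.missed_sub.trans subset_union_left
  · exact ⟨by simp [d], by simp [d]⟩
  · refine progress_lt_of_set_three (by simp [d]) ?_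
    rw [d3]
    exact ⟨subset_union_left, fun hss => hrD (hss (.inr rfl))⟩

/-- Only the row of the inner vertex `w` is rewritten. The rows of variables `6` and `7`, which are
outer, stay intact and can be used both to find the blossom of the partner of `w` and in later
rounds. -/
theorem exec_extendPetal {F : IsForest (coGraph G (h.set 0)) (missed f).ncard (h.set 3) (h.set 4)
    (h.bin 5) N} {k k' : Store n} {N' : Fin n → Fin n → Fin n}
    (hv : h.env 6 ∈ h.set 3) (hu : h.env 7 ∈ h.set 3)
    (hrel : ∀ b, b ≠ 2 → b ≠ 6 → k.rel b = h.rel b) (h6 : k.env 6 = h.env 6)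
    (h7 : k.env 7 = h.env 7) (hF : F.IsSearch (h.env 7) (h.env 6) (k.set 2) N')
    (hrows : ∀ x, x ∈ h.set 3 ∨ x ∈ k.set 2 → ∀ y z, k.rel 6 x y z ↔ N' x y = z)
    (H : extendPetal.Exec G k k') :
    (k' = k ∧ ∀ w, w ∉ k.set 2 → N (h.env 6) w ∉ k.set 2) ∨
    ((∃ N'', F.IsSearch (h.env 7) (h.env 6) (k'.set 2) N'' ∧
      ∀ x, x ∈ h.set 3 ∨ x ∈ k'.set 2 → ∀ y z, k'.rel 6 x y z ↔ N'' x y = z) ∧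
      (∀ b, b ≠ 2 → b ≠ 6 → k'.rel b = h.rel b) ∧ k'.env 6 = h.env 6 ∧ k'.env 7 = h.env 7 ∧
      (k.set 2).ncard < (k'.set 2).ncard ∧ ∃ w, w ∉ k.set 2 ∧ N (h.env 6) w ∈ k.set 2) := by
  classical
  set v := h.env 6
  set u := h.env 7
  have rv : ∀ y z, k.rel 6 v y z ↔ N v y = z := fun y z => by
    rw [hrows v (.inl hv), hF.old v hv]
  have ru : ∀ y z, k.rel 6 u y z ↔ N u y = z := fun y z => by
    rw [hrows u (.inl hu), hF.old u hu]
  have hen : ∀ w, (Fml.and (.neg (un 2 8)) (entering 8)).Holds G (k.setVar 8 w) ↔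
      w ∉ k.set 2 ∧ N v w ∈ k.set 2 := fun w => by
    rw [holds_and, holds_neg, holds_entering (by decide) (g := N v)
      (by simpa [setVar_env, setVar_rel, h6] using rv)]
    simp [holds_un, setVar_env, setVar_rel, Store.set]
  rcases H with ⟨w, hw, h₁, H₁, H₂⟩ | ⟨hno, rfl⟩
  swap
  · exact .inl ⟨rfl, fun w hw hw' => hno w ((hen w).2 ⟨hw, hw'⟩)⟩
  right
  obtain ⟨hwS, hvw⟩ := (hen w).1 hw
  obtain ⟨row1, row2⟩ := exec_setRow (f := N u) (g := N v) (h := k.setVar 8 w)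
    (by simpa [setVar_env, setVar_rel, h6] using rv)
    (by
      intro y _ _
      simpa [setVar_env, setVar_rel, h7] using ru y) H₁
  have huw : u ≠ w := fun he => hwS (he ▸ hF.mem)
  have env₁ : ∀ x, 3 ≤ x → h₁.env x = (k.setVar 8 w).env x := H₁.2
  have w₁ : h₁.env 8 = w := by simp [env₁, setVar_env]
  have u₁ : h₁.env 7 = u := by simp [env₁, setVar_env, h7]
  have q : ∀ b, b ≠ 6 → h₁.rel b = k.rel b := fun b hb => H₁.rel_ne hb
  have ru₁ : h₁.rel 6 u = k.rel 6 u := row1 u (by simpa [setVar_env] using huw)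
  have hS : k'.set 2 = k.set 2 ∪ {w} ∪ {l | h.bin 5 (N u w) l} := by
    ext x
    simp [Store.set, H₂.rel_eq, holds_or, holds_un, holds_eq, holds_ex, holds_and, holds_rel,
      holds_bin, setVar_env, setVar_rel, q, w₁, u₁, ru₁, ru, hrel, Store.bin]
    tauto
  refine ⟨⟨update N' w (mix (k.set 2) u v (N u) (N v)), ?_, ?_⟩, ?_, ?_, ?_, ?_, w, hwS, hvw⟩
  · rw [hS]
    exact hF.extend hu hv hwS hvw (update_self _ _ _) fun x hx => update_of_ne hx _ _
  · intro x hx y z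
    rw [H₂.rel_ne (show 6 ≠ 2 by decide)]
    by_cases hxw : x = w
    · subst hxw
      have := row2 y z
      simp only [setVar_env, if_true] at this
      rw [this, update_self]
      simp [h6, h7, Store.set, setVar_rel, u, v]
    · rw [row1 x (by simpa [setVar_env] using hxw), update_of_ne hxw]
      refine hrows x ?_ y z
      rw [hS] at hx
      rcases hx with hx | (hx | hx) | hx
      · exact .inl hx
      · exact .inr hx
      · exact absurd hx hxw
      · exact .inl (F.mem _ _ (F.symm _ _ hx))
  · intro b b2 b6
    rw [H₂.rel_ne b2, q b b6, hrel b b2 b6]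
  · rw [H₂.2 6 (by decide), env₁ 6 (by decide)]
    simpa [setVar_env] using h6
  · rw [H₂.2 7 (by decide), u₁]
  · rw [hS]
    refine ncard_lt_ncard ⟨fun y hy => .inl (.inl hy), fun hss => hwS (hss (.inl (.inr rfl)))⟩
      (toFinite _)

/-- If the search reaches variable `6`, the set becomes a blossom, and as it contains an inner
vertex the outer set grows. Otherwise the search has stopped without an edge of `N v` leaving the
set, and the matching is enlarged. -/
theorem exec_joinBlossoms (hs : IsState G h N f) (he : enabled.Holds G h)
    (hu : h.env 7 ∈ h.set 3) (H : joinBlossoms.Exec G h h') :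
    (∃ N' f', IsState G h' N' f') ∧ (h'.rel 0 = h.rel 0 ∧ h'.rel 1 = h.rel 1) ∧
      progress h < progress h' := by
  classical
  obtain ⟨hv, huv, huI, hcl⟩ := holds_enabled.1 he
  have F := hs.forest
  obtain ⟨h₁, H₁, h₂, H₂, H₃⟩ := H
  have hS₁ : h₁.set 2 = {l | h.bin 5 (h.env 7) l} := by
    ext x
    simp [Store.set, H₁.rel_eq, holds_bin, setVar_env, setVar_rel, Store.bin]
  -- Each round enlarges the set unless the search is finished, so `n` rounds are enough.
  obtain ⟨⟨N', hF, hrows⟩, hrel, h6, h7, hdone⟩ := iter_induction H₂ (fun i k =>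
    (∃ N', F.IsSearch (h.env 7) (h.env 6) (k.set 2) N' ∧
      ∀ x, x ∈ h.set 3 ∨ x ∈ k.set 2 → ∀ y z, k.rel 6 x y z ↔ N' x y = z) ∧
    (∀ b, b ≠ 2 → b ≠ 6 → k.rel b = h.rel b) ∧ k.env 6 = h.env 6 ∧ k.env 7 = h.env 7 ∧
    (i + 1 ≤ (k.set 2).ncard ∨ ∀ w, w ∉ k.set 2 → N (h.env 6) w ∉ k.set 2))
    (by
      refine ⟨⟨N, ?_, ?_⟩, ?_, H₁.2 6 (by decide), H₁.2 7 (by decide), .inl ?_⟩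
      · rw [hS₁]; exact F.isSearch_initial hu
      · intro x hx y z
        rw [H₁.rel_ne (by decide)]
        refine hs.rows x (hx.elim id fun hx => ?_) y z
        rw [hS₁] at hx
        exact F.mem _ _ (F.symm _ _ hx)
      · exact fun b b2 _ => H₁.rel_ne b2
      · rw [hS₁]
        exact Nat.one_le_iff_ne_zero.2 (ncard_ne_zero_of_mem
          (show h.env 7 ∈ {l | h.bin 5 (h.env 7) l} from F.refl _ hu) (toFinite _)))
    (by
      rintro i - k k' ⟨⟨N', hF, hrows⟩, hrel, h6, h7, hdone⟩ Hk
      rcases exec_extendPetal hv hu hrel h6 h7 hF hrows Hk with ⟨rfl, hd⟩ | ⟨a1, a2, a3, a4, a5, a6⟩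
      · exact ⟨⟨N', hF, hrows⟩, hrel, h6, h7, .inr hd⟩
      · refine ⟨a1, a2, a3, a4, .inl ?_⟩
        obtain ⟨w, hw, hw'⟩ := a6
        have := hdone.resolve_right fun hd => hd w hw hw'
        omega)
  replace hdone := hdone.resolve_left fun hle => by
    have := ncard_le (h₂.set 2)
    omega
  set v := h.env 6
  set u := h.env 7
  set S := h₂.set 2 with hSdef
  rcases H₃ with ⟨a, hvS, h₃, H₃, h₄, H₄, H₅⟩ | ⟨hvS, h₃, H₃, H₄⟩
  · replace hvS : h₂.rel 2 v v v := by
      simpa [holds_un, setVar_env, setVar_rel, h6] using hvS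
    replace hvS : v ∈ S := hvS
    have d3 : h'.set 3 = h.set 3 ∪ S := by
      ext x
      simp [Store.set, H₅.rel_ne (show 3 ≠ 5 by decide), H₄.rel_ne (show 3 ≠ 4 by decide),
        H₃.rel_eq, holds_or, holds_un, setVar_env, setVar_rel, hrel, hSdef]
    have d4 : h'.set 4 = h.set 4 \ S := by
      ext x
      simp [Store.set, H₅.rel_ne (show 4 ≠ 5 by decide), H₄.rel_eq, holds_and, holds_neg, holds_un,
        setVar_env, setVar_rel, H₃.rel_ne (show 4 ≠ 3 by decide),
        H₃.rel_ne (show 2 ≠ 3 by decide), hrel, hSdef]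
    have d5 : h'.bin 5 = fun k l => h.bin 5 k l ∨ (k ∈ S ∧ l ∈ S) := by
      funext k l
      simp [Store.bin, H₅.rel_eq, holds_or, holds_bin, holds_and, holds_un, setVar_env, setVar_rel,
        H₄.rel_ne (show 5 ≠ 4 by decide), H₃.rel_ne (show 5 ≠ 3 by decide),
        H₄.rel_ne (show 2 ≠ 4 by decide), H₃.rel_ne (show 2 ≠ 3 by decide), hrel, hSdef, Store.set]
    have d : ∀ b, b ≠ 3 → b ≠ 4 → b ≠ 5 → h'.rel b = h₂.rel b := by
      intro b b3 b4 b5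
      rw [H₅.rel_ne b5, H₄.rel_ne b4, H₃.rel_ne b3, setVar_rel]
    have d0 : h'.set 0 = h.set 0 := by simp [Store.set, d, hrel]
    refine ⟨⟨N', f, ?_, ?_, ?_, ?_, ?_⟩, ?_, ?_⟩
    · simpa [Store.bin, d, hrel] using hs.matching
    · rw [d0]; exact hs.isMatch
    · rw [d0, d3, d4, d5]
      exact hF.shrink hu hv huv hvS
    · rw [d3]
      intro x hx y z
      rw [d 6 (by decide) (by decide) (by decide)]
      exact hrows x hx y z
    · rw [d3]; exact hs.missed_sub.trans subset_union_left
    · exact ⟨by simp [d, hrel], by simp [d, hrel]⟩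
    · refine progress_lt_of_set_three (by simp [d, hrel]) ?_
      rw [d3]
      obtain ⟨w, hwS, hwD⟩ := hF.exists_inner (fun hcl' => hcl (F.symm _ _ hcl')) hu hv hvS
      exact ⟨subset_union_left, fun hss => hwD (hss (.inr hwS))⟩
  · replace hvS : ¬ h₂.rel 2 v v v := by
      simpa [holds_un, setVar_env, setVar_rel, h6] using hvS v
    replace hvS : v ∉ S := hvS
    have rv : ∀ y z, h₂.rel 6 v y z ↔ N v y = z := fun y z => by
      rw [hrows v (.inl hv), hF.old v hv]
    have ru : ∀ y z, h₂.rel 6 u y z ↔ N u y = z := fun y z => by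
      rw [hrows u (.inl hu), hF.old u hu]
    obtain ⟨hm, hlt⟩ := hF.augment hu hv huv hvS hdone
    have d0 : h₃.set 0 = h.set 0 := by
      simp [Store.set, H₃.rel_ne (show 0 ≠ 7 by decide), hrel]
    have hm7 : ∀ x y, h₃.bin 7 x y ↔ mix S u v (N u) (N v) x = y := by
      intro x y
      have := holds_mixFml (G := G) (h := ((h₂.setVar 0 x).setVar 1 y).setVar 2 y) (x := 0) (y := 1)
        (by decide) (f := N u) (g := N v) (by simpa [setVar_env, setVar_rel, h6] using rv)
        (by simpa [setVar_env, setVar_rel, h7] using fun y _ _ => ru y)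
      rw [Store.bin, H₃.rel_eq, this]
      simp [setVar_env, setVar_rel, Store.set, h6, h7, hSdef]
    obtain ⟨hst, e0, e1⟩ := exec_reset hm7 (by rwa [d0]) H₄
    refine ⟨⟨_, _, hst⟩, ⟨?_, ?_⟩, ?_⟩
    · rw [e0, H₃.rel_ne (by decide), hrel 0 (by decide) (by decide)]
    · rw [e1, H₃.rel_ne (by decide), hrel 1 (by decide) (by decide)]
    · refine progress_lt_of_set_seven ?_
      rwa [hst.missed_eq, hs.missed_eq]

/-- No edge leaves a blossom except to inner vertices. -/
def Stuck (G : SimpleGraph (Fin n)) (h : Store n) : Prop :=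
  ∀ v ∈ h.set 3, ∀ u, (coGraph G (h.set 0)).Adj v u → u ∈ h.set 4 ∨ h.bin 5 v u

theorem exec_matchStep (hs : IsState G h N f) (H : matchStep.Exec G h h') :
    (∃ N' f', IsState G h' N' f') ∧ (h'.rel 0 = h.rel 0 ∧ h'.rel 1 = h.rel 1) ∧
      ((h' = h ∧ Stuck G h) ∨ (¬ Stuck G h ∧ progress h < progress h')) := by
  rcases H with ⟨v, ⟨u, hen⟩, ⟨u', hen', H⟩ | ⟨hno, -⟩⟩ | ⟨hno, rfl⟩
  · have hnot : ¬ Stuck G h := fun hst => by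
      obtain ⟨hv, huv, hI, hcl⟩ := holds_enabled.1 hen'
      exact (hst _ hv _ huv).elim hI hcl
    have hs' : ∀ a, IsState G (((h.setVar 6 v).setVar 7 u').setVar 11 a) N f :=
      fun a => ⟨hs.matching, hs.isMatch, hs.forest, hs.rows, hs.missed_sub⟩
    -- Variable `11` does not occur in the guard, so this choice is a mere test whether variable `7`
    -- is outer.
    rcases H with ⟨a, ha, H⟩ | ⟨ha, H⟩
    · obtain ⟨h1, h2, h3⟩ := exec_joinBlossoms (hs' a) hen' ha H
      exact ⟨h1, h2, .inr ⟨hnot, h3⟩⟩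
    · have hs'' : IsState G ((h.setVar 6 v).setVar 7 u') N f :=
        ⟨hs.matching, hs.isMatch, hs.forest, hs.rows, hs.missed_sub⟩
      obtain ⟨h1, h2, h3⟩ := exec_growForest hs'' hen' (fun hm => ha u' hm) H
      exact ⟨h1, h2, .inr ⟨hnot, h3⟩⟩
  · exact absurd hen (hno u)
  · refine ⟨⟨N, f, hs⟩, ⟨rfl, rfl⟩, .inl ⟨rfl, fun v hv u huv => ?_⟩⟩
    by_contra! hn
    refine hno v ⟨u, holds_enabled.2 ?_⟩
    simp only [setVar_env]
    exact ⟨hv, huv, hn.1, hn.2⟩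

/-- The state after at least `j` steps of the matching phase -/
def AtLeast (G : SimpleGraph (Fin n)) (R : ℕ → Fin n → Fin n → Fin n → Prop) (j : ℕ)
    (h : Store n) : Prop :=
  (∃ N f, IsState G h N f) ∧ (h.rel 0 = R 0 ∧ h.rel 1 = R 1) ∧ (Stuck G h ∨ j ≤ progress h)

theorem AtLeast.step {R : ℕ → Fin n → Fin n → Fin n → Prop} {j : ℕ} (hj : AtLeast G R j h)
    (H : matchStep.Exec G h h') : AtLeast G R (j + 1) h' := by
  obtain ⟨⟨N, f, hs⟩, ⟨e0, e1⟩, hd⟩ := hj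
  obtain ⟨hs', ⟨e0', e1'⟩, hd'⟩ := exec_matchStep hs H
  refine ⟨hs', ⟨e0'.trans e0, e1'.trans e1⟩, ?_⟩
  rcases hd' with ⟨rfl, hst⟩ | ⟨hn, hlt⟩
  · exact .inl hst
  · have := hd.resolve_left hn
    right; omega

/-- The two nested loops run `4 * n ^ 2` steps. Each step from a state that is not stuck raises
`progress`, whose bound `n * (n + 1) + n` is less than `4 * n ^ 2` for positive `n`; a stuck state
no longer changes. So the final forest is stuck and its matching is maximum. -/
theorem exec_maxMatching (H : maxMatching.Exec G h h') :
    (h'.rel 0 = h.rel 0 ∧ h'.rel 1 = h.rel 1) ∧ ∃ f, (∀ x y, h'.bin 7 x y ↔ f x = y) ∧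
      IsMatch (coGraph G (h.set 0)) f ∧
      ∀ g, IsMatch (coGraph G (h.set 0)) g → (missed f).ncard ≤ (missed g).ncard := by
  obtain ⟨h₁, H₁, h₂, H₂, H₃⟩ := H
  have e0 : h₁.rel 0 = h.rel 0 := H₁.rel_ne (by decide)
  have e1 : h₁.rel 1 = h.rel 1 := H₁.rel_ne (by decide)
  obtain ⟨hst, e0', e1'⟩ := exec_reset (f := id)
    (fun x y => by simp [Store.bin, H₁.rel_eq, holds_eq, setVar_env])
    ⟨fun _ => rfl, fun x hx => absurd rfl hx⟩ H₂
  obtain ⟨⟨N, f, hs⟩, ⟨r0, r1⟩, hd⟩ := iter_induction H₃ (fun i k => AtLeast G h.rel (i * (n * 4)) k)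
    ⟨⟨_, _, hst⟩, ⟨e0'.trans e0, e1'.trans e1⟩, .inr (by omega)⟩
    (fun i _ k k' hk Hk => by
      have := iter_induction Hk (fun l m => AtLeast G h.rel (i * (n * 4) + l * 4) m)
        (by simpa using hk) (fun l _ m m' hm ⟨m₁, M₁, m₂, M₂, m₃, M₃, M₄⟩ => by
          have := (((hm.step M₁).step M₂).step M₃).step M₄
          rwa [show (l + 1) * 4 = l * 4 + 1 + 1 + 1 + 1 by omega])
      rwa [Nat.add_mul, one_mul])
  refine ⟨⟨r0, r1⟩, f, hs.matching, ?_, ?_⟩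
  · simpa only [Store.set, r0] using hs.isMatch
  · intro g hg
    replace hd : Stuck G h' := hd.resolve_right fun hle => by
      have h1 := progress_le (h := h')
      rcases Nat.eq_zero_or_pos n with rfl | hn
      · exact (h.env 0).elim0
      · nlinarith
    replace hg : IsMatch (coGraph G (h'.set 0)) g := by simpa only [Store.set, r0] using hg
    rcases (h'.set 3).eq_empty_or_nonempty with hD | hD
    · have : missed f = ∅ := subset_empty_iff.1 (hD ▸ hs.missed_sub)
      simp [this]
    · exact hs.forest.le_ncard_missed hD hd hg

end matching

/-- The whole program -/
def main : Stmt :=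
  .seq greedy (.seq maxMatching (.assign 1 (.or (bin 1 0 1) (.or (.eq 0 1) (bin 7 0 1)))))

end RelProg

/-! ### Correctness of the whole program -/

namespace RelProg

open Function Set Matching Colour Fml

/-- The greedy classes lie outside the uncoloured set, where the matching is the identity, so the
two relations do not interact and their union with equality is an equivalence. -/
theorem exec_main {n : ℕ} {G : SimpleGraph (Fin n)} {h h' : Store n}
    (hrel : ∀ a u v w, ¬ h.rel a u v w) (H : main.Exec G h h') :
    Equivalence (h'.bin 1) ∧ (∀ x y, h'.bin 1 x y → ¬ G.Adj x y) ∧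
      ∀ c : Fin n → ℕ, (∀ x y, h'.bin 1 x y → c x = c y) → ∀ (M : Set (Fin n)) (k : ℕ),
        FreeOn G Mᶜ → ColorableOn G Mᶜ k → (Finset.univ.image c).card ≤ k + M.ncard := by
  obtain ⟨h₁, H₁, h₂, H₂, H₃⟩ := H
  obtain ⟨r, hg, hno⟩ := exec_greedy (fun x y => hrel 1 x y y) H₁
  obtain ⟨⟨-, e1⟩, f, hf, hm, hmax⟩ := exec_maxMatching H₂
  have hE : ∀ x y, h'.bin 1 x y ↔ (h₁.bin 1 x y ∨ x = y ∨ f x = y) := by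
    intro x y
    rw [← hf]
    simp [Store.bin, H₃.rel_eq, holds_or, holds_bin, holds_eq, setVar_env, setVar_rel, e1]
  obtain ⟨φ, -, hφ⟩ := hg.colours
  have hfix : ∀ x, x ∉ h₁.set 0 → f x = x := fun x hx => IsMatch.apply_of_notMem hm hx
  have hsymm : ∀ {x y}, h₁.bin 1 x y → h₁.bin 1 y x := fun {x y} hxy => by
    obtain ⟨hx, hy⟩ := hg.notMem x y hxy
    rw [hφ y hy x hx, ← (hφ x hx y hy).1 hxy]
  have htrans : ∀ {x y z}, h₁.bin 1 x y → h₁.bin 1 y z → h₁.bin 1 x z := fun {x y z} hxy hyz => by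
    obtain ⟨hx, hy⟩ := hg.notMem x y hxy
    obtain ⟨-, hz⟩ := hg.notMem y z hyz
    rw [hφ x hx z hz, (hφ x hx y hy).1 hxy, (hφ y hy z hz).1 hyz]
  refine ⟨⟨fun x => (hE x x).2 (.inr (.inl rfl)), fun {x y} hxy => ?_, fun {x y z} hxy hyz => ?_⟩,
    fun x y hxy => ?_, fun c hc M k hM hk => ?_⟩
  · rw [hE] at hxy ⊢
    rcases hxy with hxy | rfl | rfl
    · exact .inl (hsymm hxy)
    · exact .inr (.inl rfl)
    · exact .inr (.inr (hm.invol x))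
  · rw [hE] at hxy hyz ⊢
    rcases hxy with hxy | rfl | rfl
    · rcases hyz with hyz | rfl | rfl
      · exact .inl (htrans hxy hyz)
      · exact .inl hxy
      · rw [hfix y (hg.notMem x y hxy).2]
        exact .inl hxy
    · exact hyz
    · rcases hyz with hyz | rfl | rfl
      · have := hfix (f x) (hg.notMem _ _ hyz).1
        rw [hm.invol] at this
        rw [← this] at hyz
        exact .inl hyz
      · exact .inr (.inr rfl)
      · exact .inr (.inl (hm.invol x).symm)
  · rcases (hE x y).1 hxy with hxy | rfl | rfl
    · exact hg.proper x y hxy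
    · exact G.irrefl
    · by_cases hx : f x = x
      · rw [hx]; exact G.irrefl
      · exact (hm.adj x hx).2.2.2
  · exact hg.card_image_le hno hm hmax (fun x y hxy => hc x y ((hE x y).2 hxy)) hM hk

end RelProg

theorem mainTheorem11 :
    ∃ (A : Ram.Program) (p : Polynomial ℕ), ∀ (n : ℕ) (G : SimpleGraph (Fin n)),
      ∃ (t : ℕ) (s : Ram.State), Ram.Exec A (Ram.graphInput G) t s ∧ t ≤ p.eval n ∧
        ∃ c : G.Coloring ℕ, (∀ v : Fin n, c v = s.colour v) ∧
          ∀ M : Finset (Fin n), IsMinimumModulator (fun _ H => P3K1Free H) G M →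
            ((Finset.univ.image c).card : ℕ∞) ≤
              (G.induce (M : Set (Fin n))ᶜ).chromaticNumber + (M.card : ℕ∞) := by
  obtain ⟨A, p, hA⟩ := RelProg.exists_program RelProg.main 1
  refine ⟨A, p, fun n G => ?_⟩
  obtain ⟨t, s, hexec, ht, hout⟩ := hA n G
  refine ⟨t, s, hexec, ht, ?_⟩
  let c : Fin n → ℕ := fun v => s.colour v
  have key : (∀ x y, G.Adj x y → c x ≠ c y) ∧
      ∀ (M : Set (Fin n)) (k : ℕ), Colour.FreeOn G Mᶜ → Colour.ColorableOn G Mᶜ k →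
        (Finset.univ.image c).card ≤ k + M.ncard := by
    rcases Nat.eq_zero_or_pos n with rfl | hn
    -- The empty graph has no store to run on, but it needs no colour.
    · exact ⟨fun x => x.elim0, fun M k _ _ => by simp⟩
    obtain ⟨h', H, hout⟩ := hout ⟨fun _ => ⟨0, hn⟩, fun _ _ _ _ => False⟩ (by simp) (by simp)
    obtain ⟨heq, hproper, hbound⟩ := RelProg.exec_main (by simp) H
    have hw : ∀ v, ∃ w : Fin n, c v = w ∧ h'.bin 1 v w :=
      fun v => (hout v v (heq.refl v)).imp fun _ hw => ⟨hw.1, hw.2.1⟩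
    -- Colours are representatives of the classes, so equal colours imply equivalence, and
    -- equivalent vertices are not adjacent.
    refine ⟨fun x y hxy he => ?_, fun M k hM hk => hbound c (fun x y hxy => ?_) M k hM hk⟩
    · obtain ⟨w, h1, h2⟩ := hw x
      obtain ⟨w', h3, h4⟩ := hw y
      obtain rfl : w = w' := Fin.ext (h1.symm.trans (he.trans h3))
      exact hproper x y (heq.trans h2 (heq.symm h4)) hxy
    · obtain ⟨w, h1, h2⟩ := hw x
      obtain ⟨w', h3, h4⟩ := hw y
      -- The colour of a vertex is the least element of its class, so the colours of two equivalent
      -- vertices bound each other.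
      obtain ⟨z, h5, -, h6⟩ := hout x w' (heq.trans hxy h4)
      obtain ⟨z', h7, -, h8⟩ := hout y w (heq.trans (heq.symm hxy) h2)
      have a1 : (w : ℕ) = z := h1.symm.trans h5
      have a2 : (w' : ℕ) = z' := h3.symm.trans h7
      rw [h1, h3]
      rw [Fin.le_def] at h6 h8
      omega
  refine ⟨SimpleGraph.Coloring.mk c fun {x y} hxy => key.1 x y hxy, fun v => rfl, ?_⟩
  intro M hM
  have hne : (G.induce (M : Set (Fin n))ᶜ).chromaticNumber ≠ ⊤ :=
    SimpleGraph.chromaticNumber_ne_top_iff_exists.2 ⟨_, SimpleGraph.colorable_of_fintype _⟩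
  obtain ⟨k, hk⟩ := ENat.ne_top_iff_exists.1 hne
  have := key.2 M k (Colour.freeOn_of_p3K1Free hM.1)
    (Colour.colorableOn_of_colorable (SimpleGraph.chromaticNumber_le_iff_colorable.1 hk.symm.le))
  rw [Set.ncard_coe_finset] at this
  rw [← hk]
  exact_mod_cast this
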